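/- Let $d\ge 3$, let $\Psi:\mathbb{R}^{d-1}\to\mathbb{R}$ be Lipschitz with $\|\nabla\Psi\|_{L^\infty}\le M$, and let $\Omega=\{(x',t)\in\mathbb{R}^{d-1}\times\mathbb{R}: t>\Psi(x')\}$. Let $A=(a_{ij})$ be a real, symmetric, measurable $d\times d$ matrix function on $\mathbb{R}^d$ such that, for some $\mu>0$, $\mu|\xi|^2\le a_{ij}(x)\xi_i\xi_j$ for all $\xi\in\mathbb{R}^d$ and a.e. $x$, and $\|A\|_{L^\infty}\le\mu^{-1}$; $A$ is independent of $x_d$, i.e. $A(x',s)=A(x',t)$ for all $x'\in\mathbb{R}^{d-1}$, $s,t\in\mathbb{R}$; and $\int_0^t\eta(\rho)\frac{d\rho}{\rho}<\infty$ for every $t>0$, where $$\eta(\rho)=\sup_{x_0\in\mathbb{R}^d,\,0<r\le\rho}\Big(|B(x_0,r)|^{-2}\int_{B(x_0,r)\cap\Omega}\int_{B(x_0,r)\cap\Omega}|A(x',x_d)-A(y',x_d)|^2\,dx\,dy\Big)^{1/2}.$$ Let $V\in L^\infty_{loc}(\mathbb{R}^d)$, $V>0$ a.e., satisfy $\|V\|_{L^\infty(B)}\le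 C_V\,\frac1{|B|}\int_B V$ for every ball $B\subset\mathbb{R}^d$, and put $$m(y,V)=\inf_{r>0}\Big\{\frac1r:\ \frac1{r^{d-2}}\int_{B(y,r)}V(z)\,dz\le 1\Big\}.$$ Let $N(x,y)$ be the Neumann function of $\mathcal{L}+V=-\mathrm{div}(A\nabla)+V$ in $\Omega$. That is, $N$ is continuous on $\{(x,y)\in\Omega\times\Omega: x\ne y\}$ and: (a) for every $x\in\Omega$, $v=N(x,\cdot)$ is a weak solution of $\mathcal{L}v+Vv=\delta_x$ in $\Omega$, $\partial v/\partial\nu=0$ on $\partial\Omega$: $v$ and its weak gradient $\nabla v$ are integrable on bounded subsets of $\Omega$, $\nabla v$ and $V^{1/2}v$ are in $L^2(\Omega\setminus B(x,r))$ for every $r>0$, and $\int_\Omega (A\nabla v\cdot\nabla\varphi+Vv\varphi)\,dy=\varphi(x)$ for all $\varphi\in C_c^\infty(\mathbb{R}^d)$; (b) for every $f\in C_c^\infty(\Omega)$, $u(x)=\int_\Omega N(x,y)f(y)\,dy$ is the weak solution of $\mathcal{L}u+Vu=f$ in $\Omega$, $\partial u/\partial\nu=0$ on $\partial\Omega$,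 with $\nabla u, V^{1/2}u\in L^2(\Omega)$, i.e. $\int_\Omega(A\nabla u\cdot\nabla\varphi+Vu\varphi)\,dx=\int_\Omega f\varphi\,dx$ for all $\varphi$ with $\nabla\varphi,V^{1/2}\varphi\in L^2(\Omega)$. Then for every integer $k\ge1$ there is a constant $C_k>0$, depending only on $k$, $d$, $\mu$, $M$ and $C_V$, such that for all $x,y\in\Omega$ with $x\ne y$, $$|N(x,y)|\le\frac{C_k}{(1+|x-y|\,m(y,V))^k}\cdot\frac1{|x-y|^{d-2}}.$$ -/

import Mathlib

open MeasureTheory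
open scoped NNReal ENNReal ContDiff

namespace SchrodingerNeumann

/-- The Euclidean space `ℝ^d`; below `d = n + 1`. -/
abbrev Eu (d : ℕ) : Type := EuclideanSpace ℝ (Fin d)

/-- The first `n` coordinates `x'` of `x = (x', x_d) ∈ ℝ^d`, `d = n + 1`. -/
def horiz {n : ℕ} (x : Eu (n + 1)) : Eu n := WithLp.toLp 2 (fun i => x i.castSucc)

/-- The last coordinate `x_d` of `x = (x', x_d) ∈ ℝ^d`, `d = n + 1`. -/
def vert {n : ℕ} (x : Eu (n + 1)) : ℝ := x (Fin.last n)

/-- The point `(x', t) ∈ ℝ^d`, `d = n + 1`. -/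
def pt {n : ℕ} (x' : Eu n) (t : ℝ) : Eu (n + 1) :=
  WithLp.toLp 2 (Fin.snoc (α := fun _ => ℝ) x'.ofLp t)

/-- The region `{(x', t) : t > Ψ(x')}` above the graph of `Ψ`. -/
def graphRegion {n : ℕ} (Ψ : Eu n → ℝ) : Set (Eu (n + 1)) := {x | Ψ (horiz x) < vert x}

/-! ### Coefficients -/

/-- The modulus of continuity
`η(ρ) = sup_{x₀, 0 < r ≤ ρ} (|B|⁻² ∫_{B ∩ Ω} ∫_{B ∩ Ω} |A(x', x_d) - A(y', x_d)|² dx dy)^{1/2}`,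
`B = B(x₀, r)`, as an extended nonnegative number. -/
noncomputable def diniModulus {n : ℕ} (Ω : Set (Eu (n + 1)))
    (A : Eu (n + 1) → Matrix (Fin (n + 1)) (Fin (n + 1)) ℝ) (ρ : ℝ) : ℝ≥0∞ :=
  ⨆ (x₀ : Eu (n + 1)) (r : ℝ) (_ : 0 < r ∧ r ≤ ρ),
    ((∫⁻ y in Metric.ball x₀ r ∩ Ω, ∫⁻ x in Metric.ball x₀ r ∩ Ω,
        ENNReal.ofReal (∑ i, ∑ j, (A x i j - A (pt (horiz y) (vert x)) i j) ^ 2))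
      / (volume (Metric.ball x₀ r)) ^ 2) ^ (1 / 2 : ℝ)

/-- The assumptions on the real coefficient matrix `A`: measurability, ellipticity and boundedness
with constant `μ`, symmetry, independence of the last variable, and the Dini condition. -/
structure IsCoefficient {n : ℕ} (μ : ℝ) (Ω : Set (Eu (n + 1)))
    (A : Eu (n + 1) → Matrix (Fin (n + 1)) (Fin (n + 1)) ℝ) : Prop where
  measurable : ∀ i j, Measurable fun x => A x i j
  elliptic : ∀ᵐ x, ∀ ξ : Eu (n + 1), μ * ‖ξ‖ ^ 2 ≤ ∑ i, ∑ j, A x i j * ξ i * ξ j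
  bounded : ∀ᵐ x, ∀ ξ ζ : Eu (n + 1), |∑ i, ∑ j, A x i j * ξ i * ζ j| ≤ μ⁻¹ * ‖ξ‖ * ‖ζ‖
  symmetric : ∀ x, (A x).IsSymm
  independent : ∀ (x' : Eu n) (s t : ℝ), A (pt x' s) = A (pt x' t)
  dini : ∀ t : ℝ, 0 < t →
    ∫⁻ ρ in Set.Ioc 0 t, diniModulus Ω A ρ / ENNReal.ofReal ρ < (⊤ : ℝ≥0∞)

/-! ### The potential -/

/-- `V > 0` a.e., `V ∈ L^∞_loc(ℝ^d)`, and `‖V‖_{L^∞(B)} ≤ C ⨍_B V` for all balls `B`. -/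
structure IsBInfty {d : ℕ} (C : ℝ) (V : Eu d → ℝ) : Prop where
  pos : ∀ᵐ x, 0 < V x
  locBounded : ∀ (x : Eu d) (r : ℝ), 0 < r → MemLp V ∞ (volume.restrict (Metric.ball x r))
  reverse : ∀ (x : Eu d) (r : ℝ), 0 < r →
    eLpNorm V ∞ (volume.restrict (Metric.ball x r))
      ≤ ENNReal.ofReal (C * ⨍ y in Metric.ball x r, V y)

/-- `ψ(x, r) = r^{-(d-2)} ∫_{B(x,r)} V` (used for `d ≥ 3` only). -/
noncomputable def psi {d : ℕ} (V : Eu d → ℝ) (x : Eu d) (r : ℝ) : ℝ :=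
  1 / r ^ (d - 2) * ∫ y in Metric.ball x r, V y

/-- The Fefferman-Phong-Shen maximal function
`m(x, V) = inf_{r > 0} {1 / r : ψ(x, r) ≤ 1}`. -/
noncomputable def fpsMax {d : ℕ} (V : Eu d → ℝ) (x : Eu d) : ℝ :=
  sInf {s : ℝ | ∃ r : ℝ, 0 < r ∧ psi V x r ≤ 1 ∧ s = 1 / r}

/-! ### Weak solutions and the Neumann function -/

/-- `G` is the weak (distributional) gradient of `u` in the open set `Ω`. -/
structure HasWeakGrad {d : ℕ} (Ω : Set (Eu d)) (u : Eu d → ℝ) (G : Eu d → Eu d) : Prop where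
  locInt : LocallyIntegrableOn u Ω
  locInt_grad : LocallyIntegrableOn G Ω
  byParts : ∀ φ : Eu d → ℝ, ContDiff ℝ ∞ φ → HasCompactSupport φ → tsupport φ ⊆ Ω →
    ∫ x in Ω, u x • gradient φ x = -∫ x in Ω, φ x • G x

/-- `∇u ∈ L²(U)` and `V^{1/2} u ∈ L²(U)`, where `G = ∇u`. -/
def FiniteEnergyOn {d : ℕ} (V : Eu d → ℝ) (U : Set (Eu d)) (u : Eu d → ℝ) (G : Eu d → Eu d) :
    Prop :=
  MemLp G 2 (volume.restrict U) ∧ MemLp (fun x => √(V x) * u x) 2 (volume.restrict U)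

/-- The bilinear form `∫_Ω (A ∇u · ∇φ + V u φ)` of `-div(A∇) + V`, where `G = ∇u`, `H = ∇φ`. -/
noncomputable def form {d : ℕ} (A : Eu d → Matrix (Fin d) (Fin d) ℝ) (V : Eu d → ℝ)
    (Ω : Set (Eu d)) (u : Eu d → ℝ) (G : Eu d → Eu d) (φ : Eu d → ℝ) (H : Eu d → Eu d) : ℝ :=
  ∫ x in Ω, ((∑ i, ∑ j, A x i j * G x j * H x i) + V x * u x * φ x)

/-- `u` is the finite energy weak solution of `-div(A∇u) + V u = f` in `Ω`, `∂u/∂ν = 0` on `∂Ω`: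
the weak formulation holds for all test functions of finite energy (with no condition on `∂Ω`). -/
def IsNeumannSolution {d : ℕ} (A : Eu d → Matrix (Fin d) (Fin d) ℝ) (V : Eu d → ℝ)
    (Ω : Set (Eu d)) (f u : Eu d → ℝ) : Prop :=
  ∃ G : Eu d → Eu d, HasWeakGrad Ω u G ∧ FiniteEnergyOn V Ω u G ∧
    ∀ (φ : Eu d → ℝ) (H : Eu d → Eu d), HasWeakGrad Ω φ H → FiniteEnergyOn V Ω φ H →
      form A V Ω u G φ H = ∫ x in Ω, f x * φ x

/-- `v = N(x, ·)` satisfies `-div(A∇v) + V v = δ_x` in `Ω` and `∂v/∂ν = 0` on `∂Ω` in the weak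
sense: `v` and `∇v` are integrable on bounded parts of `Ω`, have finite energy away from the pole
`x`, and the weak formulation holds for the restrictions to `Ω` of all `φ ∈ C_c^∞(ℝ^d)`. -/
def HasNeumannPole {d : ℕ} (A : Eu d → Matrix (Fin d) (Fin d) ℝ) (V : Eu d → ℝ)
    (Ω : Set (Eu d)) (x : Eu d) (v : Eu d → ℝ) : Prop :=
  ∃ G : Eu d → Eu d, HasWeakGrad Ω v G ∧
    (∀ R : ℝ, IntegrableOn v (Ω ∩ Metric.ball x R) ∧ IntegrableOn G (Ω ∩ Metric.ball x R)) ∧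
    (∀ r : ℝ, 0 < r → FiniteEnergyOn V (Ω \ Metric.ball x r) v G) ∧
    ∀ φ : Eu d → ℝ, ContDiff ℝ ∞ φ → HasCompactSupport φ →
      form A V Ω v G φ (gradient φ) = φ x

/-- `N` is the Neumann function of `-div(A∇) + V` in `Ω`: it is continuous off the diagonal,
`N(x, ·)` solves the Neumann problem with right-hand side `δ_x` for every `x ∈ Ω`, and `N` is the
kernel of the solution operator of the Neumann problem, i.e. for `f ∈ C_c^∞(Ω)` the finite energy
solution of `-div(A∇u) + V u = f` with `∂u/∂ν = 0` is `u(x) = ∫_Ω N(x, y) f(y) dy`.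
The first and the last condition determine `N` on `Ω × Ω` off the diagonal; its values on the
diagonal and outside `Ω × Ω` are irrelevant. -/
structure IsNeumannFunction {d : ℕ} (A : Eu d → Matrix (Fin d) (Fin d) ℝ) (V : Eu d → ℝ)
    (Ω : Set (Eu d)) (N : Eu d → Eu d → ℝ) : Prop where
  continuousOn : ContinuousOn (fun p : Eu d × Eu d => N p.1 p.2)
    {p | p.1 ∈ Ω ∧ p.2 ∈ Ω ∧ p.1 ≠ p.2}
  pole : ∀ x ∈ Ω, HasNeumannPole A V Ω x (N x)
  kernel : ∀ f : Eu d → ℝ, ContDiff ℝ ∞ f → HasCompactSupport f → tsupport f ⊆ Ω →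
    IsNeumannSolution A V Ω f (fun x => ∫ y in Ω, N x y * f y)

end SchrodingerNeumann

/-! Put `r = |x - y| / 2`. The balls `B(x, r)` and `B(y, r)` are disjoint, so `N(x, ·)` solves the
homogeneous Neumann problem in `Ω ∩ B(y, r)`. De Giorgi's local boundedness (`exists_sup_bound`)
bounds `N(x, y)²` by `r^{-d}` times the integral of `N(x, ·)²` over this set. What remains is an
`L²` bound there, and its decay on a smaller concentric ball.

The `L²` bound (`exists_lintegral_neumann_le`) is a duality argument. For a test function `f`
supported in `Ω ∩ B(y, r)` the function `u = ∫ N(·, z) f(z) dz` has finite energy, and the energy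
estimate (`exists_energy_bound`) gives `∫ u² ≤ K r⁴ ∫ f²` over `Ω ∩ B(x, r)`. There `u` solves the
homogeneous problem, so De Giorgi's bound at `x` yields `u(x)² ≤ K r^{4-d} ∫ f²`. Hence `∫ N(x, ·)²
≤ K r^{4-d}` over `Ω ∩ B(y, r)`, and `|N(x, y)| ≤ K r^{2-d}`.

The decay (`exists_decay`) concerns the case `r m(y, V) ≥ 1`. Then the potential has enough mass in
`B(y, r)` for the Fefferman-Phong inequality to hold at a scale `t` much smaller than `r`. Combined
with Caccioppoli's inequality on balls of radius comparable to `r`, it gains a factor of order `(t /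
r)²`. Since `t / r` is a negative power of `r m(y, V)` whose exponent depends only on the doubling
constant of `V`, finitely many repetitions give any prescribed power.

All estimates hold up to the boundary by one device. `Ω` is stable under translation by the ball of
radius `t` about `t e`, where `e` points upwards (`ConeRegion`). So `w(z)` can be compared with
averages of `w(z + h)` over that ball, the difference being controlled by `|h|` times the `L²` norm
of `∇w`. This gives the Nash inequality behind De Giorgi's iteration (`MemW.nash`), the averaging
inequality (`MemW.lintegral_sq_le_average`) and the Fefferman-Phong inequality
(`MemW.feffermanPhong`). Mollifying along the cone gives density of test functions
(`MemW.exists_smooth`). No extension operator and no Sobolev embedding enters. -/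

namespace SchrodingerNeumann

open Filter Topology Metric

local notation "⟪" x ", " y "⟫" => inner ℝ x y

/-! ### Continuity of translations in `L^p`. -/

section Translation
variable {d : ℕ} {F : Type*} [NormedAddCommGroup F]

/-- Translations act continuously on `L^p`. -/
lemma tendsto_eLpNorm_translate {p : ℝ≥0∞} (hp1 : 1 ≤ p) (hp : p ≠ ⊤) {g : Eu d → F}
    (hg : MemLp g p volume) :
    Tendsto (fun h : Eu d => eLpNorm (fun x => g (x - h) - g x) p volume) (𝓝 0) (𝓝 0) := by
  have : Fact (1 ≤ p) := ⟨hp1⟩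
  let T : Eu d → C(Eu d, Eu d) := fun h => ⟨fun x => x - h, by fun_prop⟩
  have hTm : ∀ h, MeasurePreserving (T h) (volume : Measure (Eu d)) volume := fun h =>
    measurePreserving_sub_right volume h
  have hT : Continuous T := by
    have : Continuous (fun a : Eu d × Eu d => a.2 - a.1) := by fun_prop
    exact ((ContinuousMap.mk _ this).curry).continuous
  have hc : Continuous (fun h => Lp.compMeasurePreserving (T h) (hTm h) (hg.toLp g)) :=
    Continuous.compMeasurePreservingLp continuous_const hT hTm hp
  have h0 := hc.tendsto 0
  rw [tendsto_iff_edist_tendsto_0] at h0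
  refine h0.congr fun h => ?_
  rw [Lp.edist_def]
  have e : ∀ h, (Lp.compMeasurePreserving (T h) (hTm h) (hg.toLp g) : Eu d → F)
      =ᵐ[volume] fun x => g (x - h) := fun h =>
    (Lp.coeFn_compMeasurePreserving _ _).trans
      ((hTm h).quasiMeasurePreserving.ae_eq_comp hg.coeFn_toLp)
  refine eLpNorm_congr_ae ?_
  filter_upwards [e h, e 0] with x h1 h2
  rw [Pi.sub_apply, h1, h2, sub_zero]

end Translation

/-! ### One-sided mollification along the direction `e`. -/

section Mollifier
variable {d : ℕ}

/-- A bump function supported in the ball of radius `δ / 2` about `-δ e`. -/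
noncomputable def shiftedBump (e : Eu d) {δ : ℝ} (hδ : 0 < δ) : ContDiffBump (-(δ • e)) :=
  ⟨δ / 4, δ / 2, by positivity, by linarith⟩

/-- The mollifier of integral one supported in the ball of radius `δ / 2` about `-δ e`. -/
noncomputable def moll (e : Eu d) {δ : ℝ} (hδ : 0 < δ) : Eu d → ℝ :=
  (shiftedBump e hδ).normed volume

variable (e : Eu d) {δ : ℝ} (hδ : 0 < δ)

lemma moll_contDiff : ContDiff ℝ ∞ (moll e hδ) := (shiftedBump e hδ).contDiff_normed
lemma moll_nonneg (x : Eu d) : 0 ≤ moll e hδ x := (shiftedBump e hδ).nonneg_normed x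
lemma moll_integral : ∫ x, moll e hδ x = 1 := (shiftedBump e hδ).integral_normed
lemma moll_integrable : Integrable (moll e hδ) := (shiftedBump e hδ).integrable_normed
lemma moll_tsupport : tsupport (moll e hδ) = closedBall (-(δ • e)) (δ / 2) :=
  (shiftedBump e hδ).tsupport_normed_eq
lemma moll_support : Function.support (moll e hδ) = ball (-(δ • e)) (δ / 2) :=
  (shiftedBump e hδ).support_normed_eq
lemma moll_hasCompactSupport : HasCompactSupport (moll e hδ) :=
  (shiftedBump e hδ).hasCompactSupport_normed

lemma moll_norm_lt {s : Eu d} (hs : moll e hδ s ≠ 0) : ‖s‖ < δ * (‖e‖ + 1) := by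
  have : s ∈ ball (-(δ • e)) (δ / 2) := by rw [← moll_support e hδ]; exact hs
  rw [mem_ball_iff_norm] at this
  calc ‖s‖ = ‖(s - -(δ • e)) + -(δ • e)‖ := by simp
    _ ≤ ‖s - -(δ • e)‖ + ‖-(δ • e)‖ := norm_add_le _ _
    _ < δ + δ * ‖e‖ := by
        rw [norm_neg, norm_smul, Real.norm_of_nonneg hδ.le]; linarith
    _ = _ := by ring

variable {F : Type*} [NormedAddCommGroup F] [NormedSpace ℝ F]

/-- Mollification of `g`. -/
noncomputable def mollify (g : Eu d → F) (x : Eu d) : F := ∫ t, moll e hδ (x - t) • g t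

lemma mollify_eq (g : Eu d → F) (x : Eu d) :
    mollify e hδ g x = ∫ s, moll e hδ s • g (x - s) := by
  rw [mollify, ← integral_sub_left_eq_self (fun s => moll e hδ s • g (x - s)) volume x]
  simp

lemma mollify_congr {g g' : Eu d → F} (h : g =ᵐ[volume] g') : mollify e hδ g = mollify e hδ g' := by
  ext1 x
  refine integral_congr_ae ?_
  filter_upwards [h] with t ht
  rw [ht]

/-- The probability measure with density the mollifier. -/
noncomputable def mollMeasure : Measure (Eu d) :=
  volume.withDensity fun s => ENNReal.ofReal (moll e hδ s)

instance : IsProbabilityMeasure (mollMeasure e hδ) := by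
  constructor
  rw [mollMeasure, withDensity_apply _ MeasurableSet.univ, setLIntegral_univ,
    ← ofReal_integral_eq_lintegral_ofReal (moll_integrable e hδ)
      (ae_of_all _ (moll_nonneg e hδ)), moll_integral, ENNReal.ofReal_one]

lemma ae_mollMeasure : ∀ᵐ s ∂(mollMeasure e hδ), ‖s‖ < δ * (‖e‖ + 1) := by
  rw [mollMeasure, ae_withDensity_iff (moll_contDiff e hδ).continuous.measurable.ennreal_ofReal]
  refine ae_of_all _ fun s hs => moll_norm_lt e hδ ?_
  rintro h
  simp [h] at hs

variable [CompleteSpace F]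

lemma mollify_sub_eq {g : Eu d → F} (hg : LocallyIntegrable g) (x : Eu d) :
    mollify e hδ g x - g x = ∫ s, (g (x - s) - g x) ∂(mollMeasure e hδ) := by
  have hm := (moll_contDiff e hδ).continuous.measurable.ennreal_ofReal
  rw [mollMeasure, integral_withDensity_eq_integral_toReal_smul hm (by simp)]
  have hi : Integrable (fun s => moll e hδ s • g (x - s)) := by
    have h1 : Integrable (fun t => moll e hδ (x - t) • g t) :=
      hg.integrable_smul_left_of_hasCompactSupport
        ((moll_contDiff e hδ).continuous.comp (continuous_const.sub continuous_id))
        ((moll_hasCompactSupport e hδ).comp_homeomorph (Homeomorph.subLeft x))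
    have := h1.comp_sub_left x
    simpa using this
  have hj : Integrable (fun s => moll e hδ s • g x) := (moll_integrable e hδ).smul_const _
  simp only [ENNReal.toReal_ofReal (moll_nonneg e hδ _), smul_sub]
  rw [integral_sub hi hj, integral_smul_const, moll_integral, one_smul, mollify_eq]

/-- Mollifications converge in `L^p`. -/
lemma eLpNorm_mollify_sub_le {p : ℝ≥0∞} (hp1 : 1 ≤ p) (hp : p ≠ ⊤) {g : Eu d → F}
    (hg : MemLp g p volume) {ε : ℝ≥0∞}
    (hε : ∀ h : Eu d, ‖h‖ < δ * (‖e‖ + 1) →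
      eLpNorm (fun x => g (x - h) - g x) p volume ≤ ε) :
    eLpNorm (fun x => mollify e hδ g x - g x) p volume ≤ ε := by
  wlog hgm : StronglyMeasurable g generalizing g with H
  · obtain ⟨g', hg', hgg'⟩ := hg.1
    have h1 := H (g := g') ((memLp_congr_ae hgg').1 hg) (fun h hh => ?_) hg'
    · rw [← mollify_congr e hδ hgg'] at h1
      refine le_trans (le_of_eq (eLpNorm_congr_ae ?_)) h1
      filter_upwards [hgg'] with x hx
      rw [hx]
    · refine le_trans (le_of_eq (eLpNorm_congr_ae ?_)) (hε h hh)
      filter_upwards [hgg', (measurePreserving_sub_right volume h).quasiMeasurePreserving.ae_eq_comp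
        hgg'] with x hx hx'
      simp only [Function.comp] at hx'
      rw [hx, hx']
  have hp0 : p ≠ 0 := (zero_lt_one.trans_le hp1).ne'
  have hpr : 0 < p.toReal := ENNReal.toReal_pos hp0 hp
  -- The mollifier is a probability density, so the power `p` passes inside the average (Jensen);
  -- Tonelli then leaves an average over `s` of translation differences, each at most `ε`.
  have key : ∀ x, ‖mollify e hδ g x - g x‖ₑ ^ p.toReal
      ≤ ∫⁻ s, ‖g (x - s) - g x‖ₑ ^ p.toReal ∂(mollMeasure e hδ) := by
    intro x
    rw [mollify_sub_eq e hδ (hg.locallyIntegrable hp1)]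
    have h1 : ‖∫ s, (g (x - s) - g x) ∂(mollMeasure e hδ)‖ₑ
        ≤ eLpNorm (fun s => g (x - s) - g x) p (mollMeasure e hδ) := by
      refine (enorm_integral_le_lintegral_enorm _).trans ?_
      rw [← eLpNorm_one_eq_lintegral_enorm]
      refine eLpNorm_le_eLpNorm_of_exponent_le hp1 ?_
      exact ((hgm.comp_measurable (measurable_const.sub measurable_id)).sub
        stronglyMeasurable_const).aestronglyMeasurable
    refine (ENNReal.rpow_le_rpow h1 hpr.le).trans (le_of_eq ?_)
    rw [eLpNorm_eq_lintegral_rpow_enorm_toReal hp0 hp, ← ENNReal.rpow_mul, one_div,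
      inv_mul_cancel₀ hpr.ne', ENNReal.rpow_one]
  have hmeas : Measurable (Function.uncurry fun (x s : Eu d) => ‖g (x - s) - g x‖ₑ ^ p.toReal) := by
    refine (StronglyMeasurable.enorm ?_).pow_const _
    exact (hgm.comp_measurable (measurable_fst.sub measurable_snd)).sub
      (hgm.comp_measurable measurable_fst)
  have hε' : ∀ h : Eu d, ‖h‖ < δ * (‖e‖ + 1) →
      ∫⁻ x, ‖g (x - h) - g x‖ₑ ^ p.toReal ≤ ε ^ p.toReal := by
    intro h hh
    have := ENNReal.rpow_le_rpow (hε h hh) hpr.le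
    rwa [eLpNorm_eq_lintegral_rpow_enorm_toReal hp0 hp, ← ENNReal.rpow_mul, one_div,
      inv_mul_cancel₀ hpr.ne', ENNReal.rpow_one] at this
  rw [eLpNorm_eq_lintegral_rpow_enorm_toReal hp0 hp]
  have : ∫⁻ x, ‖mollify e hδ g x - g x‖ₑ ^ p.toReal ≤ ε ^ p.toReal := by
    calc _ ≤ ∫⁻ x, ∫⁻ s, ‖g (x - s) - g x‖ₑ ^ p.toReal ∂(mollMeasure e hδ) := lintegral_mono key
      _ = ∫⁻ s, ∫⁻ x, ‖g (x - s) - g x‖ₑ ^ p.toReal ∂volume ∂(mollMeasure e hδ) :=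
          lintegral_lintegral_swap hmeas.aemeasurable
      _ ≤ ∫⁻ s, ε ^ p.toReal ∂(mollMeasure e hδ) := by
          refine lintegral_mono_ae ?_
          filter_upwards [ae_mollMeasure e hδ] with s hs using hε' s hs
      _ = _ := by simp
  calc _ ≤ (ε ^ p.toReal) ^ (1 / p.toReal) := ENNReal.rpow_le_rpow this (by positivity)
    _ = ε := by rw [← ENNReal.rpow_mul, mul_one_div_cancel hpr.ne', ENNReal.rpow_one]

lemma exists_eLpNorm_mollify_sub_le {p : ℝ≥0∞} (hp1 : 1 ≤ p) (hp : p ≠ ⊤) {g : Eu d → F}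
    (hg : MemLp g p volume) {ε : ℝ≥0∞} (hε : ε ≠ 0) :
    ∃ δ₀ : ℝ, 0 < δ₀ ∧ ∀ (δ : ℝ) (hδ : 0 < δ), δ < δ₀ →
      eLpNorm (fun x => mollify e hδ g x - g x) p volume ≤ ε := by
  have h := (tendsto_eLpNorm_translate hp1 hp hg).eventually (ge_mem_nhds (pos_iff_ne_zero.2 hε))
  obtain ⟨r, hr, hr'⟩ := Metric.eventually_nhds_iff.1 h
  have he : 0 < ‖e‖ + 1 := by positivity
  refine ⟨r / (‖e‖ + 1), by positivity, fun δ hδ hlt => eLpNorm_mollify_sub_le e hδ hp1 hp hg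
    fun h hh => hr' ?_⟩
  rw [dist_zero_right]
  exact hh.trans ((lt_div_iff₀ he).1 hlt)

end Mollifier

/-! ### Calculus of weak gradients: test functions, localisation, Leibniz rule. -/

section WeakGradient
variable {d : ℕ} {Ω : Set (Eu d)}

lemma one_le_infty : (1 : WithTop ℕ∞) ≤ ((⊤ : ℕ∞) : WithTop ℕ∞) := by exact_mod_cast le_top

lemma gradient_zero_of_notMem_tsupport {φ : Eu d → ℝ} {x : Eu d} (hx : x ∉ tsupport φ) :
    gradient φ x = 0 := by
  have h := notMem_tsupport_iff_eventuallyEq.1 hx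
  rw [h.gradient_eq]
  exact gradient_const x 0

lemma continuous_gradient {φ : Eu d → ℝ} {n : WithTop ℕ∞} (hφ : ContDiff ℝ n φ) (hn : 1 ≤ n) :
    Continuous (gradient φ) :=
  (InnerProductSpace.toDual ℝ (Eu d)).symm.continuous.comp (hφ.continuous_fderiv (by
    rintro rfl; simp at hn))

lemma hasCompactSupport_gradient {φ : Eu d → ℝ} (hc : HasCompactSupport φ) :
    HasCompactSupport (gradient φ) :=
  HasCompactSupport.intro hc fun _ hx => gradient_zero_of_notMem_tsupport hx

lemma inner_gradient {φ : Eu d → ℝ} (x v : Eu d) : ⟪v, gradient φ x⟫ = fderiv ℝ φ x v := by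
  rw [real_inner_comm, inner_gradient_left]

lemma gradient_mul {f g : Eu d → ℝ} {x : Eu d} (hf : DifferentiableAt ℝ f x)
    (hg : DifferentiableAt ℝ g x) :
    gradient (fun x => f x * g x) x = f x • gradient g x + g x • gradient f x := by
  refine ext_inner_left ℝ fun v => ?_
  rw [inner_gradient, inner_add_right, inner_smul_right, inner_smul_right, inner_gradient,
    inner_gradient, fderiv_fun_mul hf hg]
  simp

lemma gradient_comp {f : ℝ → ℝ} {g : Eu d → ℝ} {x : Eu d} (hf : DifferentiableAt ℝ f (g x))
    (hg : DifferentiableAt ℝ g x) :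
    gradient (fun x => f (g x)) x = deriv f (g x) • gradient g x := by
  refine ext_inner_left ℝ fun v => ?_
  rw [inner_gradient, inner_smul_right, inner_gradient,
    show fderiv ℝ (fun x => f (g x)) x = _ from HasFDerivAt.fderiv (hf.hasDerivAt.comp_hasFDerivAt x hg.hasFDerivAt)]
  simp

/-- Integration by parts against a test function, for `C^1` functions. -/
lemma integral_smul_gradient {f φ : Eu d → ℝ} (hf : ContDiff ℝ 1 f) (hφ : ContDiff ℝ 1 φ)
    (hc : HasCompactSupport φ) :
    ∫ x, f x • gradient φ x = -∫ x, φ x • gradient f x := by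
  have i1 : Integrable fun x => f x • gradient φ x :=
    (hf.continuous.smul (continuous_gradient hφ le_rfl)).integrable_of_hasCompactSupport
      (hasCompactSupport_gradient hc).smul_left
  have i2 : Integrable fun x => φ x • gradient f x :=
    (hφ.continuous.smul (continuous_gradient hf le_rfl)).integrable_of_hasCompactSupport
      hc.smul_right
  refine ext_inner_left ℝ fun v => ?_
  rw [inner_neg_right, ← integral_inner i1, ← integral_inner i2]
  have j1 := i1.const_inner (𝕜 := ℝ) v
  have j2 := i2.const_inner (𝕜 := ℝ) v
  simp only [inner_smul_right, inner_gradient] at j1 j2 ⊢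
  rw [integral_mul_fderiv_eq_neg_fderiv_mul_of_integrable (v := v) _ j1]
  · simp only [mul_comm]
  · exact (hf.continuous.mul hφ.continuous).integrable_of_hasCompactSupport hc.mul_left
  · exact fun x _ => hf.differentiable one_ne_zero x
  · exact fun x _ => hφ.differentiable one_ne_zero x
  · simpa only [mul_comm] using j2

lemma setIntegral_smul_gradient_eq {f φ : Eu d → ℝ} (hs : tsupport φ ⊆ Ω) :
    ∫ x in Ω, f x • gradient φ x = ∫ x, f x • gradient φ x :=
  setIntegral_eq_integral_of_forall_compl_eq_zero fun x hx => by
    rw [gradient_zero_of_notMem_tsupport fun h => hx (hs h), smul_zero]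

lemma setIntegral_test_smul_eq {φ : Eu d → ℝ} {G : Eu d → Eu d} (hs : tsupport φ ⊆ Ω) :
    ∫ x in Ω, φ x • G x = ∫ x, φ x • G x :=
  setIntegral_eq_integral_of_forall_compl_eq_zero fun x hx => by
    rw [image_eq_zero_of_notMem_tsupport fun h => hx (hs h), zero_smul]

lemma hasWeakGrad_of_contDiff {f : Eu d → ℝ} (hf : ContDiff ℝ 1 f) :
    HasWeakGrad Ω f (gradient f) where
  locInt := (hf.continuous.locallyIntegrable).locallyIntegrableOn _
  locInt_grad := ((continuous_gradient hf le_rfl).locallyIntegrable).locallyIntegrableOn _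
  byParts φ hφ hc hs := by
    rw [setIntegral_smul_gradient_eq hs, setIntegral_test_smul_eq hs]
    exact integral_smul_gradient hf (hφ.of_le one_le_infty) hc

lemma HasWeakGrad.congr {u u' : Eu d → ℝ} {G G' : Eu d → Eu d} (h : HasWeakGrad Ω u G)
    (hu : u =ᵐ[volume.restrict Ω] u') (hG : G =ᵐ[volume.restrict Ω] G') : HasWeakGrad Ω u' G' where
  locInt := h.locInt.congr hu
  locInt_grad := h.locInt_grad.congr hG
  byParts φ hφ hc hs := by
    have e1 : ∫ x in Ω, u' x • gradient φ x = ∫ x in Ω, u x • gradient φ x :=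
      integral_congr_ae (hu.mono fun x hx => by simp only [hx])
    have e2 : ∫ x in Ω, φ x • G' x = ∫ x in Ω, φ x • G x :=
      integral_congr_ae (hG.mono fun x hx => by simp only [hx])
    rw [e1, e2, h.byParts φ hφ hc hs]

lemma HasWeakGrad.neg {u : Eu d → ℝ} {G : Eu d → Eu d} (h : HasWeakGrad Ω u G) :
    HasWeakGrad Ω (fun x => -u x) (fun x => -G x) where
  locInt := h.locInt.neg
  locInt_grad := h.locInt_grad.neg
  byParts φ hφ hc hs := by
    simp only [neg_smul, smul_neg, integral_neg, h.byParts φ hφ hc hs]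

/-- A compactly supported continuous multiple of a locally integrable function is integrable. -/
lemma integrableOn_smul_of_tsupport {F : Type*} [NormedAddCommGroup F] [NormedSpace ℝ F]
    {f : Eu d → F} (hf : LocallyIntegrableOn f Ω) (hΩ : MeasurableSet Ω) {φ : Eu d → ℝ}
    (hφ : Continuous φ) (hc : HasCompactSupport φ) (hs : tsupport φ ⊆ Ω) :
    IntegrableOn (fun x => φ x • f x) Ω := by
  have h1 : IntegrableOn f (tsupport φ) := hf.integrableOn_compact_subset hs hc
  have h2 : IntegrableOn (fun x => φ x • f x) (tsupport φ) :=
    h1.continuousOn_smul hφ.continuousOn hc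
  refine h2.of_forall_sdiff_eq_zero hΩ fun x hx => ?_
  rw [image_eq_zero_of_notMem_tsupport hx.2, zero_smul]

lemma integrableOn_smul_of_tsupport' {f : Eu d → ℝ} (hf : LocallyIntegrableOn f Ω)
    (hΩ : MeasurableSet Ω) {H : Eu d → Eu d}
    (hφ : Continuous H) (hc : HasCompactSupport H) (hs : tsupport H ⊆ Ω) :
    IntegrableOn (fun x => f x • H x) Ω := by
  have h1 : IntegrableOn f (tsupport H) := hf.integrableOn_compact_subset hs hc
  have h2 : IntegrableOn (fun x => f x • H x) (tsupport H) :=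
    h1.smul_continuousOn hφ.continuousOn hc
  refine h2.of_forall_sdiff_eq_zero hΩ fun x hx => ?_
  rw [image_eq_zero_of_notMem_tsupport hx.2, smul_zero]

lemma tsupport_gradient_subset {φ : Eu d → ℝ} : tsupport (gradient φ) ⊆ tsupport φ :=
  closure_minimal (fun x hx => by
    by_contra h
    exact hx (gradient_zero_of_notMem_tsupport h)) (isClosed_tsupport _)

lemma tsupport_mono_of_zero {X M N : Type*} [TopologicalSpace X] [Zero M] [Zero N] {f : X → M}
    {g : X → N} (h : ∀ x, g x = 0 → f x = 0) : tsupport f ⊆ tsupport g :=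
  closure_mono fun x hx hg => hx (h x hg)

/-- The weak gradient of `u` is tested with `η φ`; the term `u φ ∇η` of the product rule moves to
the other side. -/
lemma integral_product_rule {u η φ : Eu d → ℝ} {G : Eu d → Eu d} (h : HasWeakGrad Ω u G)
    (hΩ : IsOpen Ω) (hη : ContDiff ℝ ∞ η) (hφ : ContDiff ℝ ∞ φ) (hc : HasCompactSupport φ)
    (hs : tsupport φ ⊆ Ω) :
    ∫ x in Ω, (η x * u x) • gradient φ x
      = -∫ x in Ω, φ x • (η x • G x + u x • gradient η x) := by
  have hgη : Continuous (gradient η) := continuous_gradient hη one_le_infty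
  have hgφ : Continuous (gradient φ) := continuous_gradient hφ one_le_infty
  have hb := h.byParts (fun x => η x * φ x) (hη.mul hφ) hc.mul_left
    ((tsupport_mul_subset_right).trans hs)
  have e1 : ∫ x in Ω, u x • gradient (fun y => η y * φ y) x
      = ∫ x in Ω, (u x • (η x • gradient φ x) + u x • (φ x • gradient η x)) := by
    refine integral_congr_ae (ae_of_all _ fun x => ?_)
    simp only
    rw [gradient_mul (hη.differentiable (by simp) x) (hφ.differentiable (by simp) x), smul_add]
  have s1 : tsupport (fun x => η x • gradient φ x) ⊆ Ω :=
    (tsupport_mono_of_zero fun x hx => by rw [hx, smul_zero]).trans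
      (tsupport_gradient_subset.trans hs)
  have s2 : tsupport (fun x => φ x • gradient η x) ⊆ Ω :=
    (tsupport_mono_of_zero fun x hx => by rw [hx, zero_smul]).trans hs
  have c1 : HasCompactSupport (fun x => η x • gradient φ x) :=
    (hasCompactSupport_gradient hc).mono' fun x hx => subset_tsupport _ fun h => hx (by
      simp only [h, smul_zero])
  have c2 : HasCompactSupport (fun x => φ x • gradient η x) :=
    hc.mono' fun x hx => subset_tsupport _ fun h => hx (by simp only [h, zero_smul])
  have j1 : IntegrableOn (fun x => u x • (η x • gradient φ x)) Ω :=
    integrableOn_smul_of_tsupport' h.locInt hΩ.measurableSet (hη.continuous.smul hgφ) c1 s1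
  have j2 : IntegrableOn (fun x => u x • (φ x • gradient η x)) Ω :=
    integrableOn_smul_of_tsupport' h.locInt hΩ.measurableSet (hφ.continuous.smul hgη) c2 s2
  have j3 : IntegrableOn (fun x => (η x * φ x) • G x) Ω :=
    integrableOn_smul_of_tsupport h.locInt_grad hΩ.measurableSet
      (hη.continuous.mul hφ.continuous) hc.mul_left (tsupport_mul_subset_right.trans hs)
  rw [e1, integral_add j1 j2] at hb
  have e2 : ∫ x in Ω, φ x • (η x • G x + u x • gradient η x)
      = (∫ x in Ω, (η x * φ x) • G x) + ∫ x in Ω, u x • (φ x • gradient η x) := by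
    rw [← integral_add j3 j2]
    refine integral_congr_ae (ae_of_all _ fun x => ?_)
    simp only [smul_add, smul_smul, mul_comm]
  have e3 : ∫ x in Ω, (η x * u x) • gradient φ x = ∫ x in Ω, u x • (η x • gradient φ x) := by
    simp only [smul_smul, mul_comm]
  rw [e2, e3]
  generalize (∫ x in Ω, u x • (η x • gradient φ x)) = A at hb ⊢
  generalize (∫ x in Ω, u x • (φ x • gradient η x)) = B at hb ⊢
  rw [neg_add, ← hb, add_neg_cancel_right]

/-- Leibniz rule with a smooth factor. -/
lemma HasWeakGrad.smooth_mul {u : Eu d → ℝ} {G : Eu d → Eu d} (h : HasWeakGrad Ω u G)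
    (hΩ : IsOpen Ω) {η : Eu d → ℝ} (hη : ContDiff ℝ ∞ η) :
    HasWeakGrad Ω (fun x => η x * u x) (fun x => η x • G x + u x • gradient η x) := by
  have h1 := h.locInt.continuousOn_mul hη.continuous.continuousOn hΩ.isLocallyClosed
  have h2 := h.locInt_grad.continuousOn_smul hΩ.isLocallyClosed hη.continuous.continuousOn
  have h3 := h.locInt.smul_continuousOn hΩ.isLocallyClosed
        (continuous_gradient hη one_le_infty).continuousOn
  exact ⟨h1, h2.add h3, fun φ hφ hc hs => integral_product_rule h hΩ hη hφ hc hs⟩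

end WeakGradient

/-! ### Gradients of mollifications. -/

section Gradient
variable {d : ℕ} {Ω : Set (Eu d)} (e : Eu d) {δ : ℝ} (hδ : 0 < δ)

lemma mollify_eq_convolution (g : Eu d → ℝ) :
    mollify e hδ g = convolution g (moll e hδ) (ContinuousLinearMap.lsmul ℝ ℝ) volume := by
  ext x
  simp [mollify, convolution, mul_comm]

lemma mollify_contDiff {g : Eu d → ℝ} (hg : LocallyIntegrable g) :
    ContDiff ℝ ∞ (mollify e hδ g) := by
  rw [mollify_eq_convolution]
  exact (moll_hasCompactSupport e hδ).contDiff_convolution_right _ hg (moll_contDiff e hδ)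

lemma moll_sub_ne_zero {x t : Eu d} (h : x - t ∈ tsupport (moll e hδ)) :
    t ∈ closedBall (x + δ • e) (δ / 2) := by
  rw [moll_tsupport, mem_closedBall_iff_norm] at h
  rw [mem_closedBall_iff_norm, ← norm_neg]
  rwa [show -(t - (x + δ • e)) = x - t - -(δ • e) by abel]

/-- The gradient of a mollification is the mollification of the gradient, at points whose
averaging region lies in the domain. -/
lemma gradient_mollify {w : Eu d → ℝ} {H : Eu d → Eu d} (hΩ : IsOpen Ω)
    (hw : HasWeakGrad Ω w H) {S : Set (Eu d)} (hS : MeasurableSet S)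
    (hwS : IntegrableOn w S ∨ LocallyIntegrable (S.indicator w)) {x : Eu d}
    (hx : closedBall (x + δ • e) (δ / 2) ⊆ S) (hx' : closedBall (x + δ • e) (δ / 2) ⊆ Ω) :
    gradient (mollify e hδ (S.indicator w)) x = mollify e hδ (S.indicator H) x := by
  have hwl : LocallyIntegrable (S.indicator w) := by
    rcases hwS with h | h
    · exact (integrable_indicator_iff hS |>.2 h).locallyIntegrable
    · exact h
  have hm1 : ContDiff ℝ 1 (moll e hδ) := (moll_contDiff e hδ).of_le one_le_infty
  -- The kernel `t ↦ moll (x - t)` is itself an admissible test function, its support lying in `Ω`.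
  -- The claim is the definition of the weak gradient tested with it, once the derivative in `x` is
  -- put on the kernel.
  let ψ : Eu d → ℝ := fun t => moll e hδ (x - t)
  have hψ : ContDiff ℝ ∞ ψ := (moll_contDiff e hδ).comp (contDiff_const.sub contDiff_id)
  have hψs : tsupport ψ ⊆ closedBall (x + δ • e) (δ / 2) := by
    refine closure_minimal (fun t ht => moll_sub_ne_zero e hδ (subset_tsupport _ ht))
      isClosed_closedBall
  have hψc : HasCompactSupport ψ := HasCompactSupport.of_support_subset_isCompact
    (isCompact_closedBall _ _) ((subset_tsupport _).trans hψs)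
  have hψd : ∀ t v, fderiv ℝ ψ t v = -fderiv ℝ (moll e hδ) (x - t) v := by
    intro t v
    have h1 : HasFDerivAt (fun t : Eu d => x - t) (-ContinuousLinearMap.id ℝ (Eu d)) t :=
      (hasFDerivAt_id t).const_sub x
    have h2 := ((hm1.differentiable one_ne_zero (x - t)).hasFDerivAt.comp t h1).fderiv
    rw [show fderiv ℝ ψ t = _ from h2]
    simp
  have hb := hw.byParts ψ hψ hψc (hψs.trans hx')
  refine ext_inner_left ℝ fun v => ?_
  rw [inner_gradient, mollify_eq_convolution,
    ((moll_hasCompactSupport e hδ).hasFDerivAt_convolution_right _ hwl hm1 x).fderiv,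
    convolution_precompR_apply (𝕜 := ℝ) _ hwl ((moll_hasCompactSupport e hδ).fderiv (𝕜 := ℝ))
      (hm1.continuous_fderiv one_ne_zero)]
  have hHi : IntegrableOn (fun t => ψ t • H t) Ω :=
    integrableOn_smul_of_tsupport hw.locInt_grad hΩ.measurableSet hψ.continuous hψc
      (hψs.trans hx')
  have hwi : IntegrableOn (fun t => w t • gradient ψ t) Ω :=
    integrableOn_smul_of_tsupport' hw.locInt hΩ.measurableSet
      (continuous_gradient hψ one_le_infty) (hasCompactSupport_gradient hψc)
      (tsupport_gradient_subset.trans (hψs.trans hx'))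
  have hb' := congrArg (fun z => ⟪v, z⟫) hb
  simp only [inner_neg_right] at hb'
  rw [← integral_inner hwi, ← integral_inner hHi] at hb'
  simp only [inner_smul_right, inner_gradient, hψd] at hb'
  have c1 : mollify e hδ (S.indicator H) x = ∫ t in Ω, ψ t • H t := by
    rw [setIntegral_test_smul_eq (hψs.trans hx')]
    refine integral_congr_ae (ae_of_all _ fun t => ?_)
    simp only
    by_cases ht : t ∈ S
    · rw [Set.indicator_of_mem ht]
    · rw [Set.indicator_of_notMem ht, show ψ t = 0 from
        image_eq_zero_of_notMem_tsupport fun h => ht (hx (hψs h)), smul_zero, zero_smul]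
  rw [c1, ← integral_inner hHi]
  simp only [inner_smul_right]
  rw [← neg_inj, ← hb', convolution_def, ← integral_neg, setIntegral_eq_integral_of_forall_compl_eq_zero]
  · refine integral_congr_ae (ae_of_all _ fun t => ?_)
    simp only [ContinuousLinearMap.lsmul_apply, smul_eq_mul]
    by_cases ht : t ∈ S
    · rw [Set.indicator_of_mem ht, mul_neg]
    · have h0 := gradient_zero_of_notMem_tsupport (φ := ψ) fun h => ht (hx (hψs h))
      have h1 := hψd t v
      rw [← inner_gradient, h0, inner_zero_right] at h1
      rw [← mul_neg, ← h1, mul_zero, mul_zero]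
  · intro t ht
    have h0 := gradient_zero_of_notMem_tsupport (φ := ψ) fun h => ht (hx' (hψs h))
    rw [← hψd, ← inner_gradient, h0, inner_zero_right, mul_zero]

end Gradient

/-- Open sets stable under translation along the cone generated by the unit ball about `e`. -/
structure ConeRegion {d : ℕ} (Ω : Set (Eu d)) (e : Eu d) : Prop where
  isOpen : IsOpen Ω
  shift : ∀ x ∈ Ω, ∀ w ∈ ball e 1, ∀ s : ℝ, 0 ≤ s → x + s • w ∈ Ω

/-- The Sobolev class `W^{1,p}(Ω)`, with the gradient recorded. -/
structure MemW {d : ℕ} (p : ℝ≥0∞) (Ω : Set (Eu d)) (w : Eu d → ℝ) (H : Eu d → Eu d) : Prop where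
  weakGrad : HasWeakGrad Ω w H
  memLp : MemLp w p (volume.restrict Ω)
  memLp_grad : MemLp H p (volume.restrict Ω)

/-! ### Density of smooth functions up to the boundary of a cone region. -/

section Density
variable {d : ℕ} {Ω : Set (Eu d)} {e : Eu d}

/-- Points of the averaging region are `x + δ w` with `w` within `1 / 2` of `e`, so they are reached
from `x` along the cone. This is why the mollifier is shifted by `-δ e`: its averages at points of
`Ω` only see `Ω`. -/
lemma ConeRegion.closedBall_subset (hΩ : ConeRegion Ω e) {x : Eu d} (hx : x ∈ Ω) {δ : ℝ}
    (hδ : 0 < δ) : closedBall (x + δ • e) (δ / 2) ⊆ Ω := by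
  intro t ht
  rw [mem_closedBall_iff_norm] at ht
  have h1 := hΩ.shift x hx (δ⁻¹ • (t - x)) ?_ δ hδ.le
  · rwa [smul_inv_smul₀ hδ.ne', add_sub_cancel] at h1
  · rw [mem_ball_iff_norm]
    have : δ⁻¹ • (t - x) - e = δ⁻¹ • (t - (x + δ • e)) := by
      rw [← sub_sub, smul_sub δ⁻¹ (t - x), inv_smul_smul₀ hδ.ne']
    rw [this, norm_smul, norm_inv, Real.norm_of_nonneg hδ.le, inv_mul_lt_iff₀ hδ]
    linarith

/-- Elements of `W^{1,p}(Ω)` of bounded support are limits of restrictions of test functions on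
the whole space. -/
lemma MemW.exists_smooth (hΩ : ConeRegion Ω e) {p : ℝ≥0∞} (hp1 : 1 ≤ p) (hp : p ≠ ⊤)
    {w : Eu d → ℝ} {H : Eu d → Eu d} (h : MemW p Ω w H) {c : Eu d} {r R : ℝ} (hrR : r < R)
    (hsupp : ∀ x ∈ Ω, x ∉ closedBall c r → w x = 0) {ε : ℝ≥0∞} (hε : ε ≠ 0) :
    ∃ φ : Eu d → ℝ, ContDiff ℝ ∞ φ ∧ HasCompactSupport φ ∧ tsupport φ ⊆ ball c R ∧
      eLpNorm (fun x => φ x - w x) p (volume.restrict Ω) ≤ ε ∧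
      eLpNorm (fun x => gradient φ x - H x) p (volume.restrict Ω) ≤ ε := by
  have hΩm := hΩ.isOpen.measurableSet
  have hw0 : MemLp (Ω.indicator w) p volume := (memLp_indicator_iff_restrict hΩm).2 h.memLp
  have hH0 : MemLp (Ω.indicator H) p volume := (memLp_indicator_iff_restrict hΩm).2 h.memLp_grad
  obtain ⟨δ₁, hδ₁, h1⟩ := exists_eLpNorm_mollify_sub_le e hp1 hp hw0 hε
  obtain ⟨δ₂, hδ₂, h2⟩ := exists_eLpNorm_mollify_sub_le e hp1 hp hH0 hε
  have he : 0 < ‖e‖ + 1 := by positivity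
  obtain ⟨δ, hδ, hδl⟩ := exists_between
    (lt_min (lt_min hδ₁ hδ₂) (div_pos (sub_pos.2 hrR) he))
  have hl1 : δ < δ₁ := hδl.trans_le ((min_le_left _ _).trans (min_le_left _ _))
  have hl2 : δ < δ₂ := hδl.trans_le ((min_le_left _ _).trans (min_le_right _ _))
  have hl3 : δ * (‖e‖ + 1) < R - r :=
    (lt_div_iff₀ he).1 (hδl.trans_le (min_le_right _ _))
  -- The shifted kernel enlarges the support by at most `δ (‖e‖ + 1)`, which `hl3` keeps below the
  -- margin `R - r`.
  have hts : tsupport (mollify e hδ (Ω.indicator w)) ⊆ closedBall c (r + δ * (‖e‖ + 1)) := by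
    refine closure_minimal (fun x hx => ?_) isClosed_closedBall
    by_contra hxb
    refine hx ?_
    refine integral_eq_zero_of_ae (ae_of_all _ fun t => ?_)
    simp only [Pi.zero_apply, smul_eq_mul, mul_eq_zero]
    by_cases hm : moll e hδ (x - t) = 0
    · exact Or.inl hm
    refine Or.inr ?_
    by_cases ht : t ∈ Ω
    · rw [Set.indicator_of_mem ht]
      refine hsupp t ht fun htc => hxb ?_
      rw [mem_closedBall_iff_norm] at htc ⊢
      have := moll_norm_lt e hδ hm
      calc ‖x - c‖ = ‖(t - c) + (x - t)‖ := by congr 1; abel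
        _ ≤ ‖t - c‖ + ‖x - t‖ := norm_add_le _ _
        _ ≤ _ := by linarith
    · rw [Set.indicator_of_notMem ht]
  refine ⟨mollify e hδ (Ω.indicator w), mollify_contDiff e hδ (hw0.locallyIntegrable hp1), ?_, ?_,
    ?_, ?_⟩
  · exact (isCompact_closedBall _ _).of_isClosed_subset (isClosed_tsupport _) hts
  · exact hts.trans (closedBall_subset_ball (by linarith))
  · refine le_trans (le_of_eq ?_) (((eLpNorm_restrict_le _ _ _ Ω)).trans (h1 δ hδ hl1))
    refine eLpNorm_congr_ae ?_
    filter_upwards [ae_restrict_mem hΩm] with x hx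
    rw [Set.indicator_of_mem hx]
  -- Extension by zero may jump across the boundary of `Ω`, but averages at points of `Ω` do not see
  -- the jump. So on `Ω` the gradient of the mollification is the mollification of the extended `H`.
  · refine le_trans (le_of_eq ?_) (((eLpNorm_restrict_le _ _ _ Ω)).trans (h2 δ hδ hl2))
    refine eLpNorm_congr_ae ?_
    filter_upwards [ae_restrict_mem hΩm] with x hx
    rw [gradient_mollify e hδ hΩ.isOpen h.weakGrad hΩm (Or.inr (hw0.locallyIntegrable hp1))
      (hΩ.closedBall_subset hx hδ) (hΩ.closedBall_subset hx hδ), Set.indicator_of_mem hx]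

/-- Sequential form of `MemW.exists_smooth`. -/
lemma MemW.exists_seq_smooth (hΩ : ConeRegion Ω e) {p : ℝ≥0∞} (hp1 : 1 ≤ p) (hp : p ≠ ⊤)
    {w : Eu d → ℝ} {H : Eu d → Eu d} (h : MemW p Ω w H) {c : Eu d} {r R : ℝ} (hrR : r < R)
    (hsupp : ∀ x ∈ Ω, x ∉ closedBall c r → w x = 0) :
    ∃ φ : ℕ → Eu d → ℝ, (∀ j, ContDiff ℝ ∞ (φ j)) ∧ (∀ j, HasCompactSupport (φ j)) ∧
      (∀ j, tsupport (φ j) ⊆ ball c R) ∧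
      Tendsto (fun j => eLpNorm (fun x => φ j x - w x) p (volume.restrict Ω)) atTop (𝓝 0) ∧
      Tendsto (fun j => eLpNorm (fun x => gradient (φ j) x - H x) p (volume.restrict Ω))
        atTop (𝓝 0) := by
  have h0 : ∀ j : ℕ, ((j : ℝ≥0∞) + 1)⁻¹ ≠ 0 := fun j => by simp
  have hlim : Tendsto (fun j : ℕ => ((j : ℝ≥0∞) + 1)⁻¹) atTop (𝓝 0) := by
    have := (ENNReal.tendsto_inv_nat_nhds_zero).comp (tendsto_add_atTop_nat 1)
    refine this.congr fun j => by simp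
  choose φ h1 h2 h3 h4 h5 using fun j : ℕ => h.exists_smooth hΩ hp1 hp hrR hsupp (h0 j)
  exact ⟨φ, h1, h2, h3, tendsto_of_tendsto_of_tendsto_of_le_of_le tendsto_const_nhds hlim
    (fun _ => bot_le) h4, tendsto_of_tendsto_of_tendsto_of_le_of_le tendsto_const_nhds hlim
    (fun _ => bot_le) h5⟩

end Density

/-! ### Chain rule and positive parts. -/

section ChainRule
variable {d : ℕ} {Ω : Set (Eu d)}

lemma locallyIntegrableOn_mono (hΩ : IsOpen Ω) {F F' : Type*} [NormedAddCommGroup F]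
    [NormedAddCommGroup F'] {f : Eu d → F} {g : Eu d → F'} (hf : LocallyIntegrableOn f Ω)
    (hg : AEStronglyMeasurable g (volume.restrict Ω)) (hgf : ∀ x, ‖g x‖ ≤ ‖f x‖) :
    LocallyIntegrableOn g Ω := by
  rw [locallyIntegrableOn_iff hΩ.isLocallyClosed]
  intro K hK hKc
  exact Integrable.mono (hf.integrableOn_compact_subset hK hKc)
    (hg.mono_measure (Measure.restrict_mono hK le_rfl)) (ae_of_all _ hgf)

/-- Dominated convergence on both sides of the integration by parts. It carries the chain rule from
the `C^1` functions `smoothPos` over to the positive part. -/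
lemma HasWeakGrad.of_tendsto (hΩ : IsOpen Ω) {u : Eu d → ℝ} {G : Eu d → Eu d}
    {uj : ℕ → Eu d → ℝ} {Gj : ℕ → Eu d → Eu d} (hj : ∀ j, HasWeakGrad Ω (uj j) (Gj j))
    {U : Eu d → ℝ} {B : Eu d → Eu d}
    (hU : LocallyIntegrableOn U Ω) (hB : LocallyIntegrableOn B Ω)
    (huU : ∀ j x, ‖uj j x‖ ≤ ‖U x‖) (hGB : ∀ j x, ‖Gj j x‖ ≤ ‖B x‖)
    (hu : ∀ x, Tendsto (fun j => uj j x) atTop (𝓝 (u x)))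
    (hG : ∀ x, Tendsto (fun j => Gj j x) atTop (𝓝 (G x))) : HasWeakGrad Ω u G where
  locInt := locallyIntegrableOn_mono hΩ hU (aestronglyMeasurable_of_tendsto_ae atTop
      (fun j => (hj j).locInt.aestronglyMeasurable) (ae_of_all _ hu)) fun x =>
        le_of_tendsto (hu x).norm (Eventually.of_forall fun j => huU j x)
  locInt_grad := locallyIntegrableOn_mono hΩ hB (aestronglyMeasurable_of_tendsto_ae atTop
      (fun j => (hj j).locInt_grad.aestronglyMeasurable) (ae_of_all _ hG)) fun x =>
        le_of_tendsto (hG x).norm (Eventually.of_forall fun j => hGB j x)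
  byParts φ hφ hc hs := by
    have l1 : Tendsto (fun j => ∫ x in Ω, uj j x • gradient φ x) atTop
        (𝓝 (∫ x in Ω, u x • gradient φ x)) := by
      refine tendsto_integral_of_dominated_convergence (fun x => ‖U x • gradient φ x‖)
        (fun j => (hj j).locInt.aestronglyMeasurable.smul
          (continuous_gradient hφ one_le_infty).aestronglyMeasurable)
        (integrableOn_smul_of_tsupport' hU hΩ.measurableSet (continuous_gradient hφ one_le_infty)
          (hasCompactSupport_gradient hc) (tsupport_gradient_subset.trans hs)).norm
        (fun j => ae_of_all _ fun x => ?_) (ae_of_all _ fun x => (hu x).smul_const _)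
      rw [norm_smul, norm_smul]
      exact mul_le_mul_of_nonneg_right (huU j x) (norm_nonneg _)
    have l2 : Tendsto (fun j => ∫ x in Ω, φ x • Gj j x) atTop (𝓝 (∫ x in Ω, φ x • G x)) := by
      refine tendsto_integral_of_dominated_convergence (fun x => ‖φ x • B x‖)
        (fun j => hφ.continuous.aestronglyMeasurable.smul
          (hj j).locInt_grad.aestronglyMeasurable)
        (integrableOn_smul_of_tsupport hB hΩ.measurableSet hφ.continuous hc hs).norm
        (fun j => ae_of_all _ fun x => ?_) (ae_of_all _ fun x => (hG x).const_smul _)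
      rw [norm_smul, norm_smul]
      exact mul_le_mul_of_nonneg_left (hGB j x) (norm_nonneg _)
    have l3 := l1.congr fun j => (hj j).byParts φ hφ hc hs
    exact tendsto_nhds_unique l3 l2.neg

/-- Chain rule for `C^1` functions with bounded derivative. -/
lemma HasWeakGrad.comp (hΩ : IsOpen Ω) {u : Eu d → ℝ} {G : Eu d → Eu d} (h : HasWeakGrad Ω u G)
    {Φ : ℝ → ℝ} (hΦ : ContDiff ℝ 1 Φ) (hΦ' : ∀ s, |deriv Φ s| ≤ 1) :
    HasWeakGrad Ω (fun x => Φ (u x)) (fun x => deriv Φ (u x) • G x) := by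
  have hΩm := hΩ.measurableSet
  have hlip : LipschitzWith 1 Φ := lipschitzWith_of_nnnorm_deriv_le (hΦ.differentiable one_ne_zero)
    fun s => by rw [← NNReal.coe_le_coe]; simpa using hΦ' s
  have hΦc : Continuous (deriv Φ) := hΦ.continuous_deriv le_rfl
  have hdΦ : ∀ s t, |Φ s - Φ t| ≤ |s - t| := fun s t => by
    simpa [Real.dist_eq] using hlip.dist_le_mul s t
  have hum := h.locInt.aestronglyMeasurable
  refine ⟨?_, ?_, ?_⟩
  · have h1 : LocallyIntegrableOn (fun x => |Φ 0| + |u x|) Ω :=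
      ((locallyIntegrable_const _).locallyIntegrableOn _).add h.locInt.norm
    refine locallyIntegrableOn_mono hΩ h1 (hΦ.continuous.comp_aestronglyMeasurable hum) fun x => ?_
    have := hdΦ (u x) 0
    rw [sub_zero] at this
    rw [Real.norm_eq_abs, Real.norm_of_nonneg (by positivity)]
    have := abs_sub_abs_le_abs_sub (Φ (u x)) (Φ 0)
    linarith
  · refine locallyIntegrableOn_mono hΩ h.locInt_grad ((hΦc.comp_aestronglyMeasurable hum).smul
      h.locInt_grad.aestronglyMeasurable) fun x => ?_
    rw [norm_smul]
    exact mul_le_of_le_one_left (norm_nonneg _) (hΦ' _)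
  intro φ hφ hc hs
  obtain ⟨ρ, hρ, hρs⟩ := (show IsCompact (tsupport φ) from hc).exists_cthickening_subset_open hΩ hs
  -- Only a compact neighbourhood of the support of `φ` matters. There `u` and `G` are integrable,
  -- the unshifted mollifications (`e = 0`) of their truncations converge in `L¹`, and on the
  -- support of `φ` one is the gradient of the other.
  set K' := cthickening ρ (tsupport φ) with hK'
  have hK'c : IsCompact K' := IsCompact.cthickening hc
  have hK'm : MeasurableSet K' := hK'c.measurableSet
  have hKK' : tsupport φ ⊆ K' := self_subset_cthickening _
  have hu1 : MemLp (K'.indicator u) 1 volume := memLp_one_iff_integrable.2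
    ((integrable_indicator_iff hK'm).2 (h.locInt.integrableOn_compact_subset hρs hK'c))
  have hG1 : MemLp (K'.indicator G) 1 volume := memLp_one_iff_integrable.2
    ((integrable_indicator_iff hK'm).2 (h.locInt_grad.integrableOn_compact_subset hρs hK'c))
  set u0 := K'.indicator u with hu0
  set G0 := K'.indicator G with hG0
  have hε : ∀ j : ℕ, ((j : ℝ≥0∞) + 1)⁻¹ ≠ 0 := fun j => by simp
  have hlim : Tendsto (fun j : ℕ => ((j : ℝ≥0∞) + 1)⁻¹) atTop (𝓝 0) :=
    ((ENNReal.tendsto_inv_nat_nhds_zero).comp (tendsto_add_atTop_nat 1)).congr fun j => by simp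
  have hex : ∀ j : ℕ, ∃ f : Eu d → ℝ, ∃ g : Eu d → Eu d, ContDiff ℝ ∞ f ∧
      AEStronglyMeasurable g volume ∧
      eLpNorm (fun x => f x - u0 x) 1 volume ≤ ((j : ℝ≥0∞) + 1)⁻¹ ∧
      eLpNorm (fun x => g x - G0 x) 1 volume ≤ ((j : ℝ≥0∞) + 1)⁻¹ ∧
      ∀ x ∈ tsupport φ, gradient f x = g x := by
    intro j
    obtain ⟨δ₁, hδ₁, h1⟩ := exists_eLpNorm_mollify_sub_le (0 : Eu d) le_rfl (by simp) hu1 (hε j)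
    obtain ⟨δ₂, hδ₂, h2⟩ := exists_eLpNorm_mollify_sub_le (0 : Eu d) le_rfl (by simp) hG1 (hε j)
    obtain ⟨δ, hδ, hδl⟩ := exists_between (lt_min (lt_min hδ₁ hδ₂) hρ)
    have hl1 : δ < δ₁ := hδl.trans_le ((min_le_left _ _).trans (min_le_left _ _))
    have hl2 : δ < δ₂ := hδl.trans_le ((min_le_left _ _).trans (min_le_right _ _))
    have hl3 : δ < ρ := hδl.trans_le (min_le_right _ _)
    have hu0l : LocallyIntegrable u0 := hu1.locallyIntegrable le_rfl
    have hG0l : LocallyIntegrable G0 := hG1.locallyIntegrable le_rfl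
    have hgr : ∀ x ∈ tsupport φ,
        gradient (mollify 0 hδ u0) x = mollify 0 hδ G0 x := by
      intro x hx
      have hsub : closedBall (x + δ • (0 : Eu d)) (δ / 2) ⊆ K' := by
        rw [smul_zero, add_zero]
        exact (closedBall_subset_closedBall (by linarith)).trans
          (closedBall_subset_cthickening hx ρ)
      exact gradient_mollify 0 hδ hΩ h hK'm (Or.inr hu0l) hsub (hsub.trans hρs)
    refine ⟨mollify 0 hδ u0, K'.indicator (mollify 0 hδ G0), mollify_contDiff 0 hδ hu0l, ?_,
      h1 δ hδ hl1, ?_, fun x hx => ?_⟩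
    · have hc0 : Continuous (mollify 0 hδ G0) := by
        have : mollify 0 hδ G0 = convolution (moll 0 hδ) G0 (ContinuousLinearMap.lsmul ℝ ℝ)
            volume := by
          ext1 x
          rw [convolution_eq_swap]
          rfl
        rw [this]
        exact (moll_hasCompactSupport 0 hδ).continuous_convolution_left _
          (moll_contDiff 0 hδ).continuous hG0l
      exact hc0.aestronglyMeasurable.indicator hK'm
    · refine le_trans (eLpNorm_mono fun x => ?_) (h2 δ hδ hl2)
      by_cases hx : x ∈ K'
      · rw [Set.indicator_of_mem hx]
      · rw [Set.indicator_of_notMem hx, hG0, Set.indicator_of_notMem hx]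
        simp
    · rw [hgr x hx, Set.indicator_of_mem (hKK' hx)]
  choose f g hf hgm hfu hgG hfg using hex
  have tf : Tendsto (fun j => eLpNorm (fun x => f j x - u0 x) 1 volume) atTop (𝓝 0) :=
    tendsto_of_tendsto_of_tendsto_of_le_of_le tendsto_const_nhds hlim (fun _ => bot_le) hfu
  have tg : Tendsto (fun j => eLpNorm (fun x => g j x - G0 x) 1 volume) atTop (𝓝 0) :=
    tendsto_of_tendsto_of_tendsto_of_le_of_le tendsto_const_nhds hlim (fun _ => bot_le) hgG
  obtain ⟨ns, hns, hae⟩ := (tendstoInMeasure_of_tendsto_eLpNorm one_ne_zero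
    (fun j => (hf j).continuous.aestronglyMeasurable) hu1.1 tf).exists_seq_tendsto_ae
  obtain ⟨Cφ, hCφ⟩ := hc.exists_bound_of_continuous hφ.continuous
  obtain ⟨Cg, hCg⟩ := (hasCompactSupport_gradient hc).exists_bound_of_continuous
    (continuous_gradient hφ one_le_infty)
  have hCφ0 : 0 ≤ Cφ := (norm_nonneg _).trans (hCφ 0)
  have hgφ := continuous_gradient hφ one_le_infty
  have hgφc := hasCompactSupport_gradient hc
  have hφ1 : ContDiff ℝ 1 φ := hφ.of_le one_le_infty
  have hf1 : ∀ j, ContDiff ℝ 1 (f j) := fun j => (hf j).of_le one_le_infty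
  -- the identity for the approximations
  have hid : ∀ j, ∫ x, Φ (f j x) • gradient φ x = -∫ x, φ x • deriv Φ (f j x) • g j x := by
    intro j
    refine (integral_smul_gradient (f := fun x => Φ (f j x)) (hΦ.comp (hf1 j)) hφ1 hc).trans ?_
    congr 1
    refine integral_congr_ae (ae_of_all _ fun x => ?_)
    simp only
    by_cases hx : x ∈ tsupport φ
    · rw [gradient_comp (hΦ.differentiable one_ne_zero _) ((hf1 j).differentiable one_ne_zero x),
        hfg j x hx]
    · rw [image_eq_zero_of_notMem_tsupport hx, zero_smul, zero_smul]
  have L1 : Tendsto (fun j => ∫ x, Φ (f (ns j) x) • gradient φ x) atTop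
      (𝓝 (∫ x, Φ (u0 x) • gradient φ x)) := by
    refine tendsto_integral_of_L1 (fun x => Φ (u0 x) • gradient φ x)
      ((hΦ.continuous.comp_aestronglyMeasurable hu1.1).smul hgφ.aestronglyMeasurable)
      (Eventually.of_forall fun j => ?_) ?_
    · exact ((hΦ.continuous.comp (hf (ns j)).continuous).smul hgφ).integrable_of_hasCompactSupport
        (hgφc.mono' fun x hx => subset_tsupport _ fun h => hx (by
          simp only [Pi.smul_apply', h, smul_zero]))
    · refine tendsto_of_tendsto_of_tendsto_of_le_of_le tendsto_const_nhds
        (h := fun j => eLpNorm (fun x => f (ns j) x - u0 x) 1 volume * ENNReal.ofReal Cg) ?_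
        (fun _ => bot_le) fun j => ?_
      · have := ENNReal.Tendsto.mul_const (tf.comp hns.tendsto_atTop)
          (b := ENNReal.ofReal Cg) (Or.inr ENNReal.ofReal_ne_top)
        simpa using this
      · simp only
        rw [eLpNorm_one_eq_lintegral_enorm, ← lintegral_mul_const' _ _ ENNReal.ofReal_ne_top]
        refine lintegral_mono fun x => ?_
        rw [← sub_smul, enorm_smul]
        refine mul_le_mul' ?_ ?_
        · rw [Real.enorm_eq_ofReal_abs, Real.enorm_eq_ofReal_abs]
          exact ENNReal.ofReal_le_ofReal (hdΦ _ _)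
        · rw [← ofReal_norm]
          exact ENNReal.ofReal_le_ofReal (hCg x)
  have hmΦ : ∀ j, Continuous fun x => deriv Φ (f (ns j) x) := fun j =>
    hΦc.comp (hf (ns j)).continuous
  have hG0i : Integrable G0 := memLp_one_iff_integrable.1 hG1
  have hgi : ∀ j, Integrable (g j) := fun j => by
    have h1 : Integrable (fun x => g j x - G0 x) := memLp_one_iff_integrable.1
      ⟨(hgm j).sub hG1.1, (hgG j).trans_lt (by simp)⟩
    have h2 := h1.add hG0i
    rwa [show (fun x => g j x - G0 x) + G0 = g j by ext1 x; simp] at h2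
  have hbd : ∀ (s : ℝ) (x : Eu d), ‖φ x * deriv Φ s‖ ≤ Cφ := fun s x => by
    rw [norm_mul]
    exact (mul_le_of_le_one_right (norm_nonneg _) (hΦ' s)).trans (hCφ x)
  -- `Φ'(f_j) g_j` is split into `Φ'(f_j) G0`, which converges by domination along the almost
  -- everywhere convergent subsequence, and `Φ'(f_j) (g_j - G0)`, which tends to zero in `L¹`
  -- because `|Φ'| ≤ 1`.
  have L2 : Tendsto (fun j => ∫ x, φ x • deriv Φ (f (ns j) x) • G0 x) atTop
      (𝓝 (∫ x, φ x • deriv Φ (u0 x) • G0 x)) := by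
    refine tendsto_integral_of_dominated_convergence (fun x => Cφ * ‖G0 x‖) (fun j => ?_)
      (hG0i.norm.const_mul _) (fun j => ae_of_all _ fun x => ?_) ?_
    · exact hφ.continuous.aestronglyMeasurable.smul ((hmΦ j).aestronglyMeasurable.smul hG1.1)
    · rw [smul_smul, norm_smul]
      exact mul_le_mul_of_nonneg_right (hbd _ _) (norm_nonneg _)
    · filter_upwards [hae] with x hx
      exact (((hΦc.tendsto _).comp hx).smul_const _).const_smul _
  have L3 : Tendsto (fun j => ∫ x, φ x • deriv Φ (f (ns j) x) • (g (ns j) x - G0 x)) atTop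
      (𝓝 0) := by
    have : Tendsto (fun j => ∫ x, φ x • deriv Φ (f (ns j) x) • (g (ns j) x - G0 x)) atTop
        (𝓝 (∫ _ : Eu d, (0 : Eu d))) := by
      refine tendsto_integral_of_L1 _ aestronglyMeasurable_const
        (Eventually.of_forall fun j => ?_) ?_
      · refine Integrable.mono' (((hgi (ns j)).sub hG0i).norm.const_mul Cφ) ?_
          (ae_of_all _ fun x => ?_)
        · exact hφ.continuous.aestronglyMeasurable.smul
            ((hmΦ j).aestronglyMeasurable.smul ((hgm _).sub hG1.1))
        · rw [smul_smul, norm_smul]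
          exact mul_le_mul_of_nonneg_right (hbd _ _) (norm_nonneg _)
      · refine tendsto_of_tendsto_of_tendsto_of_le_of_le tendsto_const_nhds
          (h := fun j => ENNReal.ofReal Cφ * eLpNorm (fun x => g (ns j) x - G0 x) 1 volume) ?_
          (fun _ => bot_le) fun j => ?_
        · have := ENNReal.Tendsto.const_mul (tg.comp hns.tendsto_atTop)
            (a := ENNReal.ofReal Cφ) (Or.inr ENNReal.ofReal_ne_top)
          simpa using this
        · simp only [sub_zero]
          rw [eLpNorm_one_eq_lintegral_enorm, ← lintegral_const_mul' _ _ ENNReal.ofReal_ne_top]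
          refine lintegral_mono fun x => ?_
          rw [smul_smul, enorm_smul]
          refine mul_le_mul' ?_ le_rfl
          rw [← ofReal_norm]
          exact ENNReal.ofReal_le_ofReal (hbd _ _)
    simpa using this
  have L4 : Tendsto (fun j => ∫ x, φ x • deriv Φ (f (ns j) x) • g (ns j) x) atTop
      (𝓝 (∫ x, φ x • deriv Φ (u0 x) • G0 x)) := by
    have := L2.add L3
    rw [add_zero] at this
    refine this.congr fun j => ?_
    rw [← integral_add]
    · refine integral_congr_ae (ae_of_all _ fun x => ?_)
      simp only [smul_sub]
      abel
    · refine Integrable.mono' (hG0i.norm.const_mul Cφ) ?_ (ae_of_all _ fun x => ?_)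
      · exact hφ.continuous.aestronglyMeasurable.smul ((hmΦ j).aestronglyMeasurable.smul hG1.1)
      · rw [smul_smul, norm_smul]
        exact mul_le_mul_of_nonneg_right (hbd _ _) (norm_nonneg _)
    · refine Integrable.mono' (((hgi (ns j)).sub hG0i).norm.const_mul Cφ) ?_
          (ae_of_all _ fun x => ?_)
      · exact hφ.continuous.aestronglyMeasurable.smul
            ((hmΦ j).aestronglyMeasurable.smul ((hgm _).sub hG1.1))
      · rw [smul_smul, norm_smul]
        exact mul_le_mul_of_nonneg_right (hbd _ _) (norm_nonneg _)
  have L5 := tendsto_nhds_unique (L1.congr fun j => hid (ns j)) L4.neg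
  rw [setIntegral_smul_gradient_eq hs, setIntegral_test_smul_eq hs]
  have e1 : ∫ x, Φ (u x) • gradient φ x = ∫ x, Φ (u0 x) • gradient φ x := by
    refine integral_congr_ae (ae_of_all _ fun x => ?_)
    simp only
    by_cases hx : x ∈ tsupport φ
    · rw [hu0, Set.indicator_of_mem (hKK' hx)]
    · rw [gradient_zero_of_notMem_tsupport hx, smul_zero, smul_zero]
  have e2 : ∫ x, φ x • deriv Φ (u x) • G x = ∫ x, φ x • deriv Φ (u0 x) • G0 x := by
    refine integral_congr_ae (ae_of_all _ fun x => ?_)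
    simp only
    by_cases hx : x ∈ tsupport φ
    · rw [hu0, hG0, Set.indicator_of_mem (hKK' hx), Set.indicator_of_mem (hKK' hx)]
    · rw [image_eq_zero_of_notMem_tsupport hx, zero_smul, zero_smul]
  rw [e1, e2, L5]

/-- A `C^1` approximation of the positive part. -/
noncomputable def smoothPos (j : ℕ) (s : ℝ) : ℝ :=
  ∫ t in (0 : ℝ)..s, Real.smoothTransition (j * t)

lemma continuous_smoothTransition_mul (j : ℕ) :
    Continuous fun t : ℝ => Real.smoothTransition (j * t) :=
  Real.smoothTransition.continuous.comp (continuous_const.mul continuous_id)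

lemma hasDerivAt_smoothPos (j : ℕ) (s : ℝ) :
    HasDerivAt (smoothPos j) (Real.smoothTransition (j * s)) s :=
  (continuous_smoothTransition_mul j).integral_hasStrictDerivAt 0 s |>.hasDerivAt

lemma contDiff_smoothPos (j : ℕ) : ContDiff ℝ 1 (smoothPos j) := by
  rw [contDiff_one_iff_deriv]
  refine ⟨fun s => (hasDerivAt_smoothPos j s).differentiableAt, ?_⟩
  rw [show deriv (smoothPos j) = _ from funext fun s => (hasDerivAt_smoothPos j s).deriv]
  exact continuous_smoothTransition_mul j

/-- The limit exists at every `s` and is `0` at `s = 0`. The gradient found for a positive part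
therefore vanishes on the level set, and no separate study of level sets is needed. -/
lemma tendsto_smoothTransition (s : ℝ) :
    Tendsto (fun j : ℕ => Real.smoothTransition (j * s)) atTop (𝓝 (if 0 < s then 1 else 0)) := by
  split_ifs with hs
  · refine tendsto_const_nhds.congr' ?_
    filter_upwards [eventually_ge_atTop ⌈s⁻¹⌉₊] with j hj
    refine (Real.smoothTransition.one_of_one_le ?_).symm
    rw [← inv_mul_cancel₀ hs.ne']
    exact mul_le_mul_of_nonneg_right ((Nat.le_ceil _).trans (by exact_mod_cast hj)) hs.le
  · refine tendsto_const_nhds.congr fun j => ?_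
    exact (Real.smoothTransition.zero_of_nonpos
      (mul_nonpos_of_nonneg_of_nonpos (Nat.cast_nonneg j) (not_lt.1 hs))).symm

lemma abs_smoothPos_le (j : ℕ) (s : ℝ) : |smoothPos j s| ≤ |s| := by
  have := intervalIntegral.norm_integral_le_of_norm_le_const (a := 0) (b := s) (C := 1)
    (f := fun t : ℝ => Real.smoothTransition (j * t)) fun t _ => by
      rw [Real.norm_of_nonneg (Real.smoothTransition.nonneg _)]
      exact Real.smoothTransition.le_one _
  simpa [smoothPos] using this

lemma tendsto_smoothPos (s : ℝ) :
    Tendsto (fun j => smoothPos j s) atTop (𝓝 (max s 0)) := by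
  have h1 : Tendsto (fun j => smoothPos j s) atTop
      (𝓝 (∫ t in (0 : ℝ)..s, if 0 < t then (1 : ℝ) else 0)) := by
    refine intervalIntegral.tendsto_integral_filter_of_dominated_convergence (fun _ => 1)
      (Eventually.of_forall fun j => (continuous_smoothTransition_mul j).aestronglyMeasurable)
      (Eventually.of_forall fun j => ae_of_all _ fun t _ => ?_) (by simp)
      (ae_of_all _ fun t _ => tendsto_smoothTransition t)
    rw [Real.norm_of_nonneg (Real.smoothTransition.nonneg _)]
    exact Real.smoothTransition.le_one _
  convert h1 using 2
  rcases le_total 0 s with hs | hs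
  · rw [max_eq_left hs, intervalIntegral.integral_of_le hs,
      setIntegral_congr_fun measurableSet_Ioc (g := fun _ => (1 : ℝ)) fun t ht => if_pos ht.1]
    simp [hs]
  · rw [max_eq_right hs, intervalIntegral.integral_of_ge hs,
      setIntegral_congr_fun measurableSet_Ioc (g := fun _ => (0 : ℝ)) fun t ht =>
        if_neg (not_lt.2 ht.2)]
    simp

/-- The weak gradient of a positive part. -/
lemma HasWeakGrad.posPart (hΩ : IsOpen Ω) {u : Eu d → ℝ} {G : Eu d → Eu d}
    (h : HasWeakGrad Ω u G) (k : ℝ) :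
    HasWeakGrad Ω (fun x => max (u x - k) 0)
      (fun x => (if 0 < u x - k then (1 : ℝ) else 0) • G x) := by
  have hd : ∀ (j : ℕ) (s : ℝ), HasDerivAt (fun s => smoothPos j (s - k))
      (Real.smoothTransition (j * (s - k))) s := fun j s =>
    (hasDerivAt_smoothPos j (s - k)).comp_sub_const s k
  have h1 : ∀ j : ℕ, HasWeakGrad Ω (fun x => smoothPos j (u x - k))
      (fun x => Real.smoothTransition (j * (u x - k)) • G x) := by
    intro j
    have := h.comp hΩ (Φ := fun s => smoothPos j (s - k))
      ((contDiff_smoothPos j).comp (contDiff_id.sub contDiff_const)) fun s => by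
        rw [(hd j s).deriv, abs_of_nonneg (Real.smoothTransition.nonneg _)]
        exact Real.smoothTransition.le_one _
    simpa only [(hd j _).deriv] using this
  refine HasWeakGrad.of_tendsto hΩ h1 (U := fun x => u x - k) (B := G)
    (h.locInt.sub ((locallyIntegrable_const _).locallyIntegrableOn _)) h.locInt_grad
    (fun j x => abs_smoothPos_le j _) (fun j x => ?_) (fun x => tendsto_smoothPos _)
    (fun x => (tendsto_smoothTransition _).smul_const _)
  rw [norm_smul, Real.norm_of_nonneg (Real.smoothTransition.nonneg _)]
  exact mul_le_of_le_one_left (norm_nonneg _) (Real.smoothTransition.le_one _)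

end ChainRule

/-! ### Square integrals and Cauchy-Schwarz in extended nonnegative form. -/

section LIntegral
variable {α : Type*} [MeasurableSpace α] {F : Type*} [NormedAddCommGroup F]

lemma eLpNorm_two_sq (f : α → F) (ν : Measure α) :
    eLpNorm f 2 ν ^ 2 = ∫⁻ x, ‖f x‖ₑ ^ 2 ∂ν := by
  rw [eLpNorm_eq_lintegral_rpow_enorm_toReal two_ne_zero ENNReal.ofNat_ne_top, ← ENNReal.rpow_natCast,
    ← ENNReal.rpow_mul]
  norm_num

lemma lintegral_enorm_sq_lt_top {f : α → F} {ν : Measure α} (hf : MemLp f 2 ν) :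
    ∫⁻ x, ‖f x‖ₑ ^ 2 ∂ν < ⊤ := by
  rw [← eLpNorm_two_sq]
  exact ENNReal.pow_lt_top hf.2

lemma memLp_two_of_lintegral {f : α → F} {ν : Measure α} (hf : AEStronglyMeasurable f ν)
    (h : ∫⁻ x, ‖f x‖ₑ ^ 2 ∂ν < ⊤) : MemLp f 2 ν := by
  refine ⟨hf, ?_⟩
  rw [← eLpNorm_two_sq] at h
  by_contra hn
  rw [not_lt, top_le_iff] at hn
  simp [hn] at h

/-- Cauchy-Schwarz. -/
lemma lintegral_mul_sq_le {f g : α → ℝ≥0∞} {ν : Measure α} (hf : AEMeasurable f ν)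
    (hg : AEMeasurable g ν) :
    (∫⁻ x, f x * g x ∂ν) ^ 2 ≤ (∫⁻ x, f x ^ 2 ∂ν) * ∫⁻ x, g x ^ 2 ∂ν := by
  have h := ENNReal.lintegral_mul_le_Lp_mul_Lq ν Real.HolderConjugate.two_two hf hg
  have h2 := pow_le_pow_left' h 2
  simp only [Pi.mul_apply] at h2
  refine h2.trans (le_of_eq ?_)
  rw [mul_pow, ← ENNReal.rpow_natCast, ← ENNReal.rpow_natCast, ← ENNReal.rpow_mul,
    ← ENNReal.rpow_mul]
  norm_num

lemma sq_lintegral_le_measure_mul {f : α → ℝ≥0∞} {ν : Measure α} (hf : AEMeasurable f ν) :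
    (∫⁻ x, f x ∂ν) ^ 2 ≤ ν Set.univ * ∫⁻ x, f x ^ 2 ∂ν := by
  have := lintegral_mul_sq_le (f := fun _ => 1) aemeasurable_const hf
  simpa using this

lemma enorm_sq_le_two_mul (a b : ℝ) : ‖a‖ₑ ^ 2 ≤ 2 * ‖b - a‖ₑ ^ 2 + 2 * ‖b‖ₑ ^ 2 := by
  simp only [Real.enorm_eq_ofReal_abs]
  rw [← ENNReal.ofReal_pow (abs_nonneg _), ← ENNReal.ofReal_pow (abs_nonneg _),
    ← ENNReal.ofReal_pow (abs_nonneg _), sq_abs, sq_abs, sq_abs,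
    show (2 : ℝ≥0∞) = ENNReal.ofReal 2 by simp, ← ENNReal.ofReal_mul zero_le_two,
    ← ENNReal.ofReal_mul zero_le_two, ← ENNReal.ofReal_add (by positivity) (by positivity)]
  exact ENNReal.ofReal_le_ofReal (by nlinarith [sq_nonneg (2 * b - a)])

/-- The cross term is kept as a product: integrated over two independent points it becomes the
square of an `L¹` norm, which is what `MemW.nash` exploits. -/
lemma enorm_sq_le_add (a b : ℝ) : ‖a‖ₑ ^ 2 ≤ ‖b - a‖ₑ ^ 2 + 2 * (‖a‖ₑ * ‖b‖ₑ) := by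
  simp only [Real.enorm_eq_ofReal_abs]
  rw [← ENNReal.ofReal_pow (abs_nonneg _), ← ENNReal.ofReal_pow (abs_nonneg _),
    ← ENNReal.ofReal_mul (abs_nonneg _),
    show (2 : ℝ≥0∞) = ENNReal.ofReal 2 by simp, ← ENNReal.ofReal_mul zero_le_two,
    ← ENNReal.ofReal_add (by positivity) (by positivity), sq_abs, sq_abs, ← abs_mul]
  exact ENNReal.ofReal_le_ofReal (by nlinarith [sq_nonneg b, le_abs_self (a * b)])

end LIntegral

/-! ### Nash, averaging and Fefferman-Phong inequalities from translation along the cone. -/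

section Translation
variable {d : ℕ} {Ω : Set (Eu d)} {e : Eu d}

lemma setLIntegral_shift_le {S S' : Set (Eu d)} (hS : MeasurableSet S) (hS' : MeasurableSet S')
    (f : Eu d → ℝ≥0∞) {a : Eu d} (h : ∀ z ∈ S, z + a ∈ S') :
    ∫⁻ z in S, f (z + a) ≤ ∫⁻ z in S', f z := by
  rw [← lintegral_indicator hS, ← lintegral_indicator hS',
    ← lintegral_add_right_eq_self (μ := volume) (fun z => S'.indicator f z) a]
  refine lintegral_mono fun z => ?_
  by_cases hz : z ∈ S
  · rw [Set.indicator_of_mem hz, Set.indicator_of_mem (h z hz)]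
  · rw [Set.indicator_of_notMem hz]
    exact bot_le

/-- Fundamental theorem of calculus along the segment from `z` to `z + h`, followed by
Cauchy-Schwarz in the parameter. -/
lemma enorm_sub_sq_le_lintegral {φ : Eu d → ℝ} (hφ : ContDiff ℝ 1 φ) (z h : Eu d) :
    ‖φ (z + h) - φ z‖ₑ ^ 2
      ≤ ‖h‖ₑ ^ 2 * ∫⁻ s in Set.Ioc (0 : ℝ) 1, ‖gradient φ (z + s • h)‖ₑ ^ 2 := by
  have hc : Continuous fun s : ℝ => fderiv ℝ φ (z + s • h) h :=
    ((hφ.continuous_fderiv one_ne_zero).comp (by fun_prop)).clm_apply continuous_const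
  have h1 : φ (z + h) - φ z = ∫ s in (0 : ℝ)..1, fderiv ℝ φ (z + s • h) h := by
    have hd : ∀ s ∈ Set.uIcc (0 : ℝ) 1, HasDerivAt (fun s : ℝ => φ (z + s • h))
        (fderiv ℝ φ (z + s • h) h) s := by
      intro s _
      have h2 : HasDerivAt (fun s : ℝ => z + s • h) ((1 : ℝ) • h) s :=
        ((hasDerivAt_id s).smul_const h).const_add z
      rw [one_smul] at h2
      exact (hφ.differentiable one_ne_zero _).hasFDerivAt.comp_hasDerivAt s h2
    rw [intervalIntegral.integral_eq_sub_of_hasDerivAt hd (hc.intervalIntegrable _ _)]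
    simp
  have h2 : ‖φ (z + h) - φ z‖ₑ
      ≤ ∫⁻ s in Set.Ioc (0 : ℝ) 1, ‖h‖ₑ * ‖gradient φ (z + s • h)‖ₑ := by
    rw [h1, intervalIntegral.integral_of_le zero_le_one]
    refine (enorm_integral_le_lintegral_enorm _).trans (lintegral_mono fun s => ?_)
    rw [← inner_gradient]
    rw [← ofReal_norm, ← ofReal_norm, ← ofReal_norm, ← ENNReal.ofReal_mul (norm_nonneg _)]
    exact ENNReal.ofReal_le_ofReal (norm_inner_le_norm _ _)
  have hm : Continuous fun s : ℝ => gradient φ (z + s • h) :=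
    (continuous_gradient hφ le_rfl).comp (by fun_prop)
  calc _ ≤ (∫⁻ s in Set.Ioc (0 : ℝ) 1, ‖h‖ₑ * ‖gradient φ (z + s • h)‖ₑ) ^ 2 :=
        pow_le_pow_left' h2 2
    _ ≤ _ := sq_lintegral_le_measure_mul (hm.enorm.measurable.const_mul _).aemeasurable
    _ = _ := by
        simp only [mul_pow]
        rw [lintegral_const_mul' _ _ (by simp)]
        simp

lemma lintegral_translate_smooth_le {φ : Eu d → ℝ} (hφ : ContDiff ℝ 1 φ) {S S' : Set (Eu d)}
    (hS : MeasurableSet S) (hS' : MeasurableSet S') {h : Eu d}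
    (hSS' : ∀ z ∈ S, ∀ s : ℝ, 0 ≤ s → s ≤ 1 → z + s • h ∈ S') :
    ∫⁻ z in S, ‖φ (z + h) - φ z‖ₑ ^ 2 ≤ ‖h‖ₑ ^ 2 * ∫⁻ z in S', ‖gradient φ z‖ₑ ^ 2 := by
  have hg := continuous_gradient hφ le_rfl
  calc _ ≤ ∫⁻ z in S, ‖h‖ₑ ^ 2 * ∫⁻ s in Set.Ioc (0 : ℝ) 1, ‖gradient φ (z + s • h)‖ₑ ^ 2 :=
        lintegral_mono fun z => enorm_sub_sq_le_lintegral hφ z h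
    _ = ‖h‖ₑ ^ 2 * ∫⁻ z in S, ∫⁻ s in Set.Ioc (0 : ℝ) 1, ‖gradient φ (z + s • h)‖ₑ ^ 2 :=
        lintegral_const_mul' _ _ (by simp)
    _ = ‖h‖ₑ ^ 2 * ∫⁻ s in Set.Ioc (0 : ℝ) 1, ∫⁻ z in S, ‖gradient φ (z + s • h)‖ₑ ^ 2 := by
        congr 1
        refine lintegral_lintegral_swap ?_
        exact ((hg.comp (by fun_prop :
          Continuous fun p : Eu d × ℝ => p.1 + p.2 • h)).enorm.measurable.pow_const 2).aemeasurable
    _ ≤ ‖h‖ₑ ^ 2 * ∫⁻ s in Set.Ioc (0 : ℝ) 1, ∫⁻ z in S', ‖gradient φ z‖ₑ ^ 2 := by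
        gcongr 1
        refine setLIntegral_mono' measurableSet_Ioc fun s hs => ?_
        exact setLIntegral_shift_le hS hS' (fun z => ‖gradient φ z‖ₑ ^ 2)
          fun z hz => hSS' z hz s hs.1.le hs.2
    _ = _ := by simp

/-- The `L²` modulus of continuity of a Sobolev function along the cone. -/
lemma MemW.lintegral_translate_le (hΩ : ConeRegion Ω e) {w : Eu d → ℝ} {H : Eu d → Eu d}
    (hw : MemW 2 Ω w H) {c : Eu d} {r : ℝ} (hsupp : ∀ x ∈ Ω, x ∉ closedBall c r → w x = 0)
    {S S' : Set (Eu d)} (hS : MeasurableSet S) (hS' : MeasurableSet S') (hS'Ω : S' ⊆ Ω)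
    {h : Eu d} (hSS' : ∀ z ∈ S, ∀ s : ℝ, 0 ≤ s → s ≤ 1 → z + s • h ∈ S') :
    ∫⁻ z in S, ‖w (z + h) - w z‖ₑ ^ 2 ≤ ‖h‖ₑ ^ 2 * ∫⁻ z in S', ‖H z‖ₑ ^ 2 := by
  obtain ⟨φ, hφ, -, -, t1, t2⟩ := hw.exists_seq_smooth hΩ one_le_two (by simp)
    (lt_add_one r) hsupp
  obtain ⟨ns, hns, hae⟩ := (tendstoInMeasure_of_tendsto_eLpNorm two_ne_zero
    (fun j => (hφ j).continuous.aestronglyMeasurable) hw.memLp.1 t1).exists_seq_tendsto_ae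
  have hSS : S ⊆ S' := fun z hz => by simpa using hSS' z hz 0 le_rfl zero_le_one
  have a1 : ∀ᵐ z ∂(volume.restrict S), Tendsto (fun j => φ (ns j) z) atTop (𝓝 (w z)) :=
    ae_restrict_of_ae_restrict_of_subset (hSS.trans hS'Ω) hae
  have a2 : ∀ᵐ z ∂(volume.restrict S), Tendsto (fun j => φ (ns j) (z + h)) atTop
      (𝓝 (w (z + h))) := by
    rw [ae_restrict_iff' hΩ.isOpen.measurableSet] at hae
    rw [ae_restrict_iff' hS]
    have := (measurePreserving_add_right volume h).quasiMeasurePreserving.ae hae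
    filter_upwards [this] with z hz hzS
    exact hz (hS'Ω (by simpa using hSS' z hzS 1 zero_le_one le_rfl))
  have key : ∀ j, ∫⁻ z in S, ‖φ (ns j) (z + h) - φ (ns j) z‖ₑ ^ 2 ≤ ‖h‖ₑ ^ 2 *
      (eLpNorm (fun x => gradient (φ (ns j)) x - H x) 2 (volume.restrict Ω)
        + eLpNorm H 2 (volume.restrict S')) ^ 2 := by
    intro j
    refine (lintegral_translate_smooth_le ((hφ _).of_le one_le_infty) hS hS' hSS').trans ?_
    rw [← eLpNorm_two_sq]
    have hg : AEStronglyMeasurable (fun x => gradient (φ (ns j)) x - H x)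
        (volume.restrict S') :=
      ((continuous_gradient (hφ _) one_le_infty).aestronglyMeasurable.sub
        hw.memLp_grad.1).mono_measure (Measure.restrict_mono hS'Ω le_rfl)
    gcongr
    calc eLpNorm (gradient (φ (ns j))) 2 (volume.restrict S')
        = eLpNorm ((fun x => gradient (φ (ns j)) x - H x) + H) 2 (volume.restrict S') := by
          congr 1; ext1 x; simp
      _ ≤ _ := eLpNorm_add_le hg
          (hw.memLp_grad.1.mono_measure (Measure.restrict_mono hS'Ω le_rfl)) one_le_two
      _ ≤ _ := by
          gcongr
  have lim : Tendsto (fun j => ‖h‖ₑ ^ 2 *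
      (eLpNorm (fun x => gradient (φ (ns j)) x - H x) 2 (volume.restrict Ω)
        + eLpNorm H 2 (volume.restrict S')) ^ 2) atTop
      (𝓝 (‖h‖ₑ ^ 2 * (0 + eLpNorm H 2 (volume.restrict S')) ^ 2)) := by
    refine ENNReal.Tendsto.const_mul ?_ (Or.inr (by simp))
    exact (ENNReal.continuous_pow 2).continuousAt.tendsto.comp
      ((t2.comp hns.tendsto_atTop).add tendsto_const_nhds)
  rw [zero_add, eLpNorm_two_sq] at lim
  -- Fatou handles the differences, which converge almost everywhere both at `z` and at `z + h`. On
  -- the right the gradients converge in `L²`, so the bound keeps the smaller set `S'`.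
  calc ∫⁻ z in S, ‖w (z + h) - w z‖ₑ ^ 2
      = ∫⁻ z in S, liminf (fun j => ‖φ (ns j) (z + h) - φ (ns j) z‖ₑ ^ 2) atTop := by
        refine lintegral_congr_ae ?_
        filter_upwards [a1, a2] with z h1 h2
        exact (((ENNReal.continuous_pow 2).continuousAt.tendsto.comp
          (h2.sub h1).enorm).liminf_eq).symm
    _ ≤ liminf (fun j => ∫⁻ z in S, ‖φ (ns j) (z + h) - φ (ns j) z‖ₑ ^ 2) atTop := by
        refine lintegral_liminf_le fun j => ?_
        exact ((((hφ (ns j)).continuous.comp (by fun_prop : Continuous fun z => z + h)).sub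
          (hφ (ns j)).continuous).enorm.measurable.pow_const 2)
    _ ≤ liminf (fun j => ‖h‖ₑ ^ 2 *
        (eLpNorm (fun x => gradient (φ (ns j)) x - H x) 2 (volume.restrict Ω)
        + eLpNorm H 2 (volume.restrict S')) ^ 2) atTop :=
        liminf_le_liminf (Eventually.of_forall key)
    _ = _ := lim.liminf_eq

/-- Tonelli in the pair `(z, h)` is applied to `w (z + h)`, for which a Borel representative is
convenient; it is chosen to keep the bounded support. -/
lemma MemW.exists_measurable {p : ℝ≥0∞} {w : Eu d → ℝ} {H : Eu d → Eu d}
    (hw : MemW p Ω w H) {c : Eu d} {r : ℝ} (hΩ : IsOpen Ω)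
    (hsupp : ∀ x ∈ Ω, x ∉ closedBall c r → w x = 0) :
    ∃ w' : Eu d → ℝ, Measurable w' ∧ w =ᵐ[volume.restrict Ω] w' ∧ MemW p Ω w' H ∧
      ∀ x ∈ Ω, x ∉ closedBall c r → w' x = 0 := by
  obtain ⟨w1, h1, h2⟩ := hw.memLp.1
  have h3 : w =ᵐ[volume.restrict Ω] (closedBall c r).indicator w1 := by
    filter_upwards [h2, ae_restrict_mem hΩ.measurableSet] with x hx hxΩ
    by_cases hxc : x ∈ closedBall c r
    · rw [Set.indicator_of_mem hxc, hx]
    · rw [Set.indicator_of_notMem hxc, hsupp x hxΩ hxc]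
  exact ⟨(closedBall c r).indicator w1, h1.measurable.indicator measurableSet_closedBall, h3,
    ⟨hw.weakGrad.congr h3 .rfl, (memLp_congr_ae h3).1 hw.memLp, hw.memLp_grad⟩,
    fun x _ hx => Set.indicator_of_notMem hx _⟩

lemma norm_lt_of_mem_ball_smul {t : ℝ} (ht : 0 < t) {h : Eu d} (hh : h ∈ ball (t • e) t) :
    ‖h‖ < t * (‖e‖ + 1) := by
  rw [mem_ball_iff_norm] at hh
  calc ‖h‖ = ‖(h - t • e) + t • e‖ := by simp
    _ ≤ ‖h - t • e‖ + ‖t • e‖ := norm_add_le _ _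
    _ < t + t * ‖e‖ := by rw [norm_smul, Real.norm_of_nonneg ht.le]; linarith
    _ = _ := by ring

lemma ConeRegion.add_smul_mem (hΩ : ConeRegion Ω e) {t : ℝ} (ht : 0 < t) {h : Eu d}
    (hh : h ∈ ball (t • e) t) {z : Eu d} (hz : z ∈ Ω) {s : ℝ} (hs : 0 ≤ s) : z + s • h ∈ Ω := by
  have h1 := hΩ.shift z hz (t⁻¹ • h) ?_ (s * t) (by positivity)
  · rwa [mul_smul, smul_inv_smul₀ ht.ne'] at h1
  · rw [mem_ball_iff_norm] at hh ⊢
    have : t⁻¹ • h - e = t⁻¹ • (h - t • e) := by rw [smul_sub, inv_smul_smul₀ ht.ne']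
    rw [this, norm_smul, norm_inv, Real.norm_of_nonneg ht.le, inv_mul_lt_iff₀ ht]
    linarith

/-- Admissibility of a pair of regions for averages over `ball (t e) t`. -/
structure ShiftPair (e : Eu d) (t : ℝ) (S S' : Set (Eu d)) : Prop where
  meas : MeasurableSet S
  meas' : MeasurableSet S'
  shift : ∀ h ∈ ball (t • e) t, ∀ z ∈ S, ∀ s : ℝ, 0 ≤ s → s ≤ 1 → z + s • h ∈ S'

lemma ConeRegion.shiftPair (hΩ : ConeRegion Ω e) {t : ℝ} (ht : 0 < t) : ShiftPair e t Ω Ω :=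
  ⟨hΩ.isOpen.measurableSet, hΩ.isOpen.measurableSet,
    fun _ hh _ hz _ hs _ => hΩ.add_smul_mem ht hh hz hs⟩

lemma ConeRegion.shiftPair_ball (hΩ : ConeRegion Ω e) {t : ℝ} (ht : 0 < t) (y : Eu d) (r : ℝ) :
    ShiftPair e t (Ω ∩ ball y r) (Ω ∩ ball y (r + t * (‖e‖ + 1))) := by
  refine ⟨hΩ.isOpen.measurableSet.inter measurableSet_ball,
    hΩ.isOpen.measurableSet.inter measurableSet_ball,
    fun h hh z hz s hs hs1 => ⟨hΩ.add_smul_mem ht hh hz.1 hs, ?_⟩⟩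
  have h1 := hz.2
  rw [mem_ball_iff_norm] at h1 ⊢
  calc ‖z + s • h - y‖ = ‖(z - y) + s • h‖ := by congr 1; abel
    _ ≤ ‖z - y‖ + ‖s • h‖ := norm_add_le _ _
    _ < _ := by
      have h2 := norm_lt_of_mem_ball_smul ht hh
      rw [norm_smul, Real.norm_of_nonneg hs]
      nlinarith [norm_nonneg h]

lemma ShiftPair.add_mem {t : ℝ} {S S' : Set (Eu d)} (hS : ShiftPair e t S S') {h z : Eu d}
    (hh : h ∈ ball (t • e) t) (hz : z ∈ S) : z + h ∈ S' := by
  simpa using hS.shift h hh z hz 1 zero_le_one le_rfl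

/-- Averaged translation estimate. -/
lemma MemW.lintegral_lintegral_translate_le (hΩ : ConeRegion Ω e) {w : Eu d → ℝ}
    {H : Eu d → Eu d} (hw : MemW 2 Ω w H) (hwm : Measurable w) {c : Eu d} {r : ℝ}
    (hsupp : ∀ x ∈ Ω, x ∉ closedBall c r → w x = 0) {t : ℝ} (ht : 0 < t) {S S' : Set (Eu d)}
    (hS : ShiftPair e t S S') (hS'Ω : S' ⊆ Ω) :
    ∫⁻ z in S, ∫⁻ h in ball (t • e) t, ‖w (z + h) - w z‖ₑ ^ 2
      ≤ volume (ball (t • e) t) * (ENNReal.ofReal (t * (‖e‖ + 1)) ^ 2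
        * ∫⁻ z in S', ‖H z‖ₑ ^ 2) := by
  have hm : Measurable fun p : Eu d × Eu d => ‖w (p.1 + p.2) - w p.1‖ₑ ^ 2 := by fun_prop
  rw [lintegral_lintegral_swap hm.aemeasurable, mul_comm, ← setLIntegral_const]
  refine setLIntegral_mono' measurableSet_ball fun h hh => ?_
  refine (hw.lintegral_translate_le hΩ hsupp hS.meas hS.meas' hS'Ω
    fun z hz s hs hs1 => hS.shift h hh z hz s hs hs1).trans ?_
  gcongr
  rw [← ofReal_norm]
  exact ENNReal.ofReal_le_ofReal (norm_lt_of_mem_ball_smul ht hh).le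

/-- Nash / Faber-Krahn inequality. -/
lemma MemW.nash (hΩ : ConeRegion Ω e) {w : Eu d → ℝ} {H : Eu d → Eu d} (hw : MemW 2 Ω w H)
    {c : Eu d} {r : ℝ} (hsupp : ∀ x ∈ Ω, x ∉ closedBall c r → w x = 0) {t : ℝ} (ht : 0 < t)
    (hvol : 4 * volume {x | x ∈ Ω ∧ w x ≠ 0} ≤ volume (ball (0 : Eu d) t)) :
    ∫⁻ z in Ω, ‖w z‖ₑ ^ 2
      ≤ 2 * (ENNReal.ofReal (t * (‖e‖ + 1)) ^ 2 * ∫⁻ z in Ω, ‖H z‖ₑ ^ 2) := by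
  wlog hwm : Measurable w generalizing w with X
  · obtain ⟨w', h1, h2, h3, h4⟩ := hw.exists_measurable hΩ.isOpen hsupp
    rw [lintegral_congr_ae (h2.mono fun x hx => by simp only [hx] :
      (fun z => ‖w z‖ₑ ^ 2) =ᵐ[volume.restrict Ω] fun z => ‖w' z‖ₑ ^ 2)]
    refine X h3 h4 ?_ h1
    refine le_trans (le_of_eq ?_) hvol
    congr 1
    refine measure_congr ?_
    rw [Filter.EventuallyEq, ae_restrict_iff' hΩ.isOpen.measurableSet] at h2
    filter_upwards [h2] with x hx
    refine propext (and_congr_right fun hxΩ => ?_)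
    rw [hx hxΩ]
  set B := ball (t • e) t
  have hvB : volume (ball (0 : Eu d) t) = volume B := by
    rw [Measure.addHaar_ball_center volume (t • e) t]
  have hB0 : volume B ≠ 0 := (measure_ball_pos _ _ ht).ne'
  have hBt : volume B ≠ ⊤ := measure_ball_lt_top.ne
  have hΩm := hΩ.isOpen.measurableSet
  set D := ENNReal.ofReal (t * (‖e‖ + 1)) ^ 2 * ∫⁻ z in Ω, ‖H z‖ₑ ^ 2
  set X := ∫⁻ z in Ω, ‖w z‖ₑ ^ 2 with hX
  have hXt : X ≠ ⊤ := (lintegral_enorm_sq_lt_top hw.memLp).ne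
  have hm1 : Measurable fun z => ‖w z‖ₑ := hwm.enorm
  have hmm : Measurable fun p : Eu d × Eu d => ‖w (p.1 + p.2) - w p.1‖ₑ ^ 2 := by fun_prop
  have hmL : Measurable fun z : Eu d => ∫⁻ h in B, ‖w (z + h) - w z‖ₑ ^ 2 :=
    hmm.lintegral_prod_right'
  -- The inequality `w(z)² ≤ |w(z + h) - w(z)|² + 2 |w(z)| |w(z + h)|` is integrated over `h ∈ B`
  -- and `z ∈ Ω`. For fixed `z ∈ Ω` the set `z + B` lies in `Ω`, so the integral of `|w(z + h)|` is
  -- at most the full `L¹` norm.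
  have h1 : volume B * X ≤ volume B * D + 2 * (∫⁻ z in Ω, ‖w z‖ₑ) ^ 2 := by
    calc volume B * X = ∫⁻ z in Ω, ∫⁻ _ in B, ‖w z‖ₑ ^ 2 := by
          simp only [setLIntegral_const]
          rw [lintegral_mul_const' _ _ hBt, mul_comm]
      _ ≤ ∫⁻ z in Ω, ((∫⁻ h in B, ‖w (z + h) - w z‖ₑ ^ 2)
            + 2 * ‖w z‖ₑ * ∫⁻ h in B, ‖w (z + h)‖ₑ) := by
          refine lintegral_mono fun z => ?_
          have hz : Measurable fun h => ‖w (z + h) - w z‖ₑ ^ 2 :=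
            by fun_prop
          rw [← lintegral_const_mul' _ _ (by finiteness), ← lintegral_add_left hz]
          refine lintegral_mono fun h => ?_
          rw [mul_assoc]
          exact enorm_sq_le_add _ _
      _ = (∫⁻ z in Ω, ∫⁻ h in B, ‖w (z + h) - w z‖ₑ ^ 2)
            + ∫⁻ z in Ω, 2 * ‖w z‖ₑ * ∫⁻ h in B, ‖w (z + h)‖ₑ :=
          lintegral_add_left hmL _
      _ ≤ volume B * D + ∫⁻ z in Ω, 2 * ‖w z‖ₑ * ∫⁻ z in Ω, ‖w z‖ₑ := by
          refine add_le_add (hw.lintegral_lintegral_translate_le hΩ hwm hsupp ht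
            (hΩ.shiftPair ht) le_rfl) (setLIntegral_mono' hΩm fun z hz => ?_)
          gcongr 1
          have := setLIntegral_shift_le (S := B) (S' := Ω) measurableSet_ball hΩm
            (fun z => ‖w z‖ₑ) (a := z) fun h hh => by
              have := (hΩ.shiftPair ht).add_mem hh hz
              rwa [add_comm]
          simpa only [add_comm] using this
      _ = _ := by
          rw [lintegral_mul_const _ (hm1.const_mul 2), lintegral_const_mul _ hm1]
          ring
  -- Cauchy-Schwarz on the set where `w` does not vanish: a small support makes the `L¹` norm small
  -- against the `L²` norm.
  have h2 : (∫⁻ z in Ω, ‖w z‖ₑ) ^ 2 ≤ volume {x | x ∈ Ω ∧ w x ≠ 0} * X := by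
    have hT : MeasurableSet {x | x ∈ Ω ∧ w x ≠ 0} :=
      hΩm.inter (hwm (measurableSet_singleton 0).compl)
    have e1 : ∫⁻ z in Ω, ‖w z‖ₑ = ∫⁻ z in {x | x ∈ Ω ∧ w x ≠ 0}, ‖w z‖ₑ := by
      rw [← lintegral_indicator hΩm, ← lintegral_indicator hT]
      refine lintegral_congr fun z => ?_
      by_cases hz : z ∈ Ω <;> by_cases hw0 : w z = 0 <;> simp [Set.indicator, hz, hw0]
    rw [e1]
    refine (sq_lintegral_le_measure_mul hm1.aemeasurable).trans ?_
    rw [Measure.restrict_apply_univ]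
    gcongr
    exact lintegral_mono_set fun x hx => hx.1
  rw [hvB] at hvol
  -- By the factor `4` in `hvol` the `L¹` term is at most half of `volume B * X`, a finite quantity
  -- that is then absorbed.
  have h3 : 2 * (volume B * X) ≤ 2 * (volume B * D) + volume B * X := by
    calc 2 * (volume B * X) ≤ 2 * (volume B * D + 2 * (volume {x | x ∈ Ω ∧ w x ≠ 0} * X)) := by
          gcongr
          exact h1.trans (by gcongr)
      _ = 2 * (volume B * D) + (4 * volume {x | x ∈ Ω ∧ w x ≠ 0}) * X := by ring
      _ ≤ _ := by gcongr
  rw [two_mul (volume B * X)] at h3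
  have h4 := (ENNReal.add_le_add_iff_right (by finiteness)).1 h3
  rw [show 2 * (volume B * D) = volume B * (2 * D) by ring] at h4
  exact (ENNReal.mul_le_mul_iff_right hB0 hBt).1 h4

/-- Local averaging inequality. -/
lemma MemW.lintegral_sq_le_average (hΩ : ConeRegion Ω e) {w : Eu d → ℝ} {H : Eu d → Eu d}
    (hw : MemW 2 Ω w H) {c : Eu d} {r : ℝ} (hsupp : ∀ x ∈ Ω, x ∉ closedBall c r → w x = 0)
    {t : ℝ} (ht : 0 < t) {S S' : Set (Eu d)} (hS : ShiftPair e t S S') (hS'Ω : S' ⊆ Ω)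
    (hSΩ : S ⊆ Ω) :
    volume (ball (0 : Eu d) t) * ∫⁻ z in S, ‖w z‖ₑ ^ 2
      ≤ 2 * (volume (ball (0 : Eu d) t) * (ENNReal.ofReal (t * (‖e‖ + 1)) ^ 2
        * ∫⁻ z in S', ‖H z‖ₑ ^ 2)) + 2 * (volume S * ∫⁻ z in S', ‖w z‖ₑ ^ 2) := by
  wlog hwm : Measurable w generalizing w with X
  · obtain ⟨w', h1, h2, h3, h4⟩ := hw.exists_measurable hΩ.isOpen hsupp
    have := X h3 h4 h1
    have e : ∀ T ⊆ Ω, ∫⁻ z in T, ‖w z‖ₑ ^ 2 = ∫⁻ z in T, ‖w' z‖ₑ ^ 2 := fun T hT =>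
      lintegral_congr_ae ((ae_restrict_of_ae_restrict_of_subset hT h2).mono fun x hx => by
        simp only [hx])
    rwa [e S hSΩ, e S' hS'Ω]
  set B := ball (t • e) t
  have hvB : volume (ball (0 : Eu d) t) = volume B := by
    rw [Measure.addHaar_ball_center volume (t • e) t]
  have hBt : volume B ≠ ⊤ := measure_ball_lt_top.ne
  have hmm : Measurable fun p : Eu d × Eu d => ‖w (p.1 + p.2) - w p.1‖ₑ ^ 2 := by fun_prop
  have hmL : Measurable fun z : Eu d => ∫⁻ h in B, ‖w (z + h) - w z‖ₑ ^ 2 :=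
    hmm.lintegral_prod_right'
  rw [hvB]
  calc volume B * ∫⁻ z in S, ‖w z‖ₑ ^ 2 = ∫⁻ z in S, ∫⁻ _ in B, ‖w z‖ₑ ^ 2 := by
        simp only [setLIntegral_const]
        rw [lintegral_mul_const' _ _ hBt, mul_comm]
    _ ≤ ∫⁻ z in S, (2 * (∫⁻ h in B, ‖w (z + h) - w z‖ₑ ^ 2)
          + 2 * ∫⁻ h in B, ‖w (z + h)‖ₑ ^ 2) := by
        refine lintegral_mono fun z => ?_
        have hz : Measurable fun h => ‖w (z + h) - w z‖ₑ ^ 2 :=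
          by fun_prop
        rw [← lintegral_const_mul' _ _ (by finiteness), ← lintegral_const_mul' _ _ (by finiteness),
          ← lintegral_add_left (hz.const_mul 2)]
        exact lintegral_mono fun h => enorm_sq_le_two_mul _ _
    _ = 2 * (∫⁻ z in S, ∫⁻ h in B, ‖w (z + h) - w z‖ₑ ^ 2)
          + ∫⁻ z in S, 2 * ∫⁻ h in B, ‖w (z + h)‖ₑ ^ 2 := by
        rw [lintegral_add_left (hmL.const_mul 2),
          lintegral_const_mul' _ _ (by finiteness)]
    _ ≤ _ := by
        refine add_le_add ?_ ?_
        · gcongr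
          exact hw.lintegral_lintegral_translate_le hΩ hwm hsupp ht hS hS'Ω
        -- For each `z ∈ S` the set `z + B` lies in `S'`, so the inner integral is at most the
        -- integral over `S'`, uniformly in `z`; the integration over `z` then costs `volume S`.
        · rw [lintegral_const_mul' _ _ (by finiteness)]
          gcongr
          rw [mul_comm, ← setLIntegral_const]
          refine setLIntegral_mono' hS.meas fun z hz => ?_
          have := setLIntegral_shift_le (S := B) (S' := S') measurableSet_ball hS.meas'
            (fun z => ‖w z‖ₑ ^ 2) (a := z) fun h hh => by
              have := hS.add_mem hh hz
              rwa [add_comm]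
          simpa only [add_comm] using this

/-- Fefferman-Phong inequality: the zeroth order term controls `w` at the scale `t`, if the
averages of the potential over the sets `z + ball (t e) t` are bounded below and comparable to
its supremum. -/
lemma MemW.feffermanPhong (hΩ : ConeRegion Ω e) {w : Eu d → ℝ} {H : Eu d → Eu d}
    (hw : MemW 2 Ω w H) {c : Eu d} {r : ℝ} (hsupp : ∀ x ∈ Ω, x ∉ closedBall c r → w x = 0)
    {t : ℝ} (ht : 0 < t) {S S' : Set (Eu d)} (hS : ShiftPair e t S S') (hS'Ω : S' ⊆ Ω)
    (hSΩ : S ⊆ Ω) {P : Eu d → ℝ≥0∞} (hP : Measurable P) {C α : ℝ≥0∞} (hα : α ≠ 0) (hαt : α ≠ ⊤)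
    (hPα : ∀ z ∈ S, α ≤ ∫⁻ h in ball (t • e) t, P (z + h))
    (hPt : ∀ z ∈ S, ∫⁻ h in ball (t • e) t, P (z + h) ≠ ⊤)
    (hPC : ∀ z ∈ S, ∀ᵐ h ∂(volume.restrict (ball (t • e) t)),
      volume (ball (0 : Eu d) t) * P (z + h) ≤ C * ∫⁻ h in ball (t • e) t, P (z + h)) :
    ∫⁻ z in S, ‖w z‖ₑ ^ 2 ≤ 2 * (C * (ENNReal.ofReal (t * (‖e‖ + 1)) ^ 2
        * ∫⁻ z in S', ‖H z‖ₑ ^ 2))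
      + 2 * (α⁻¹ * (volume (ball (0 : Eu d) t) * ∫⁻ z in S', P z * ‖w z‖ₑ ^ 2)) := by
  wlog hwm : Measurable w generalizing w with X
  · obtain ⟨w', h1, h2, h3, h4⟩ := hw.exists_measurable hΩ.isOpen hsupp
    have := X h3 h4 h1
    have e : ∫⁻ z in S, ‖w z‖ₑ ^ 2 = ∫⁻ z in S, ‖w' z‖ₑ ^ 2 :=
      lintegral_congr_ae ((ae_restrict_of_ae_restrict_of_subset hSΩ h2).mono fun x hx => by
        simp only [hx])
    have e' : ∫⁻ z in S', P z * ‖w z‖ₑ ^ 2 = ∫⁻ z in S', P z * ‖w' z‖ₑ ^ 2 :=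
      lintegral_congr_ae ((ae_restrict_of_ae_restrict_of_subset hS'Ω h2).mono fun x hx => by
        simp only [hx])
    rwa [e, e']
  set B := ball (t • e) t
  have hvB : volume (ball (0 : Eu d) t) = volume B := by
    rw [Measure.addHaar_ball_center volume (t • e) t]
  have hB0 : volume B ≠ 0 := (measure_ball_pos _ _ ht).ne'
  have hBt : volume B ≠ ⊤ := measure_ball_lt_top.ne
  rw [hvB] at hPC ⊢
  have hm1 : Measurable fun z => ‖w z‖ₑ := hwm.enorm
  have hmm : Measurable fun p : Eu d × Eu d => ‖w (p.1 + p.2) - w p.1‖ₑ ^ 2 := by fun_prop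
  have hmL : Measurable fun z : Eu d => ∫⁻ h in B, ‖w (z + h) - w z‖ₑ ^ 2 :=
    hmm.lintegral_prod_right'
  have hmp : Measurable fun p : Eu d × Eu d => P (p.1 + p.2) * ‖w (p.1 + p.2)‖ₑ ^ 2 := by
    fun_prop
  have hmpL : Measurable fun z : Eu d => ∫⁻ h in B, P (z + h) * ‖w (z + h)‖ₑ ^ 2 :=
    hmp.lintegral_prod_right'
  -- The inequality `w(z)² ≤ 2 |w(z + h) - w(z)|² + 2 w(z + h)²` is multiplied by `P(z + h)`,
  -- integrated over `h`, and divided by the mass `a`. In the first term `P` is bounded by `C` times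
  -- its mean over `z + B`, which cancels `a`; in the second, `a⁻¹ ≤ α⁻¹`.
  have key : ∀ z ∈ S, ‖w z‖ₑ ^ 2 ≤ 2 * (C * (volume B)⁻¹) * (∫⁻ h in B, ‖w (z + h) - w z‖ₑ ^ 2)
      + 2 * α⁻¹ * ∫⁻ h in B, P (z + h) * ‖w (z + h)‖ₑ ^ 2 := by
    intro z hz
    set a := ∫⁻ h in B, P (z + h) with ha
    have ha0 : a ≠ 0 := (pos_iff_ne_zero.2 hα |>.trans_le (hPα z hz)).ne'
    have hat : a ≠ ⊤ := hPt z hz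
    have hPz : Measurable fun h => P (z + h) := by fun_prop
    have hz1 : Measurable fun h => ‖w (z + h) - w z‖ₑ ^ 2 :=
      by fun_prop
    rw [← ENNReal.mul_le_mul_iff_right ha0 hat]
    calc a * ‖w z‖ₑ ^ 2 = ∫⁻ h in B, P (z + h) * ‖w z‖ₑ ^ 2 := by
          rw [lintegral_mul_const _ hPz]
      _ ≤ ∫⁻ h in B, (2 * (C * (volume B)⁻¹ * a) * ‖w (z + h) - w z‖ₑ ^ 2
            + 2 * (P (z + h) * ‖w (z + h)‖ₑ ^ 2)) := by
          refine lintegral_mono_ae ?_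
          filter_upwards [hPC z hz] with h hh
          have h5 : P (z + h) ≤ C * (volume B)⁻¹ * a := by
            rw [mul_assoc, mul_comm _ a, ← mul_assoc, ← div_eq_mul_inv,
              ENNReal.le_div_iff_mul_le (Or.inl hB0) (Or.inl hBt), mul_comm]
            exact hh
          calc P (z + h) * ‖w z‖ₑ ^ 2
              ≤ P (z + h) * (2 * ‖w (z + h) - w z‖ₑ ^ 2 + 2 * ‖w (z + h)‖ₑ ^ 2) := by
                gcongr
                exact enorm_sq_le_two_mul _ _
            _ = 2 * P (z + h) * ‖w (z + h) - w z‖ₑ ^ 2 + 2 * (P (z + h) * ‖w (z + h)‖ₑ ^ 2) := by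
                ring
            _ ≤ _ := by gcongr
      _ = 2 * (C * (volume B)⁻¹ * a) * (∫⁻ h in B, ‖w (z + h) - w z‖ₑ ^ 2)
            + 2 * ∫⁻ h in B, P (z + h) * ‖w (z + h)‖ₑ ^ 2 := by
          rw [lintegral_add_left (hz1.const_mul _), lintegral_const_mul _ hz1,
            lintegral_const_mul' _ _ (by finiteness)]
      _ ≤ a * (2 * (C * (volume B)⁻¹) * (∫⁻ h in B, ‖w (z + h) - w z‖ₑ ^ 2))
            + a * (2 * α⁻¹ * ∫⁻ h in B, P (z + h) * ‖w (z + h)‖ₑ ^ 2) := by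
          refine add_le_add (le_of_eq (by ring)) ?_
          have h6 : 1 ≤ a * α⁻¹ := by
            rw [← div_eq_mul_inv, ENNReal.le_div_iff_mul_le (Or.inl hα) (Or.inl hαt), one_mul]
            exact hPα z hz
          calc 2 * ∫⁻ h in B, P (z + h) * ‖w (z + h)‖ₑ ^ 2
              = 1 * (2 * ∫⁻ h in B, P (z + h) * ‖w (z + h)‖ₑ ^ 2) := (one_mul _).symm
            _ ≤ a * α⁻¹ * (2 * ∫⁻ h in B, P (z + h) * ‖w (z + h)‖ₑ ^ 2) := by gcongr
            _ = _ := by ring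
      _ = _ := (mul_add _ _ _).symm
  calc ∫⁻ z in S, ‖w z‖ₑ ^ 2
      ≤ ∫⁻ z in S, (2 * (C * (volume B)⁻¹) * (∫⁻ h in B, ‖w (z + h) - w z‖ₑ ^ 2)
        + 2 * α⁻¹ * ∫⁻ h in B, P (z + h) * ‖w (z + h)‖ₑ ^ 2) :=
        setLIntegral_mono' hS.meas key
    _ = 2 * (C * (volume B)⁻¹) * (∫⁻ z in S, ∫⁻ h in B, ‖w (z + h) - w z‖ₑ ^ 2)
        + 2 * α⁻¹ * ∫⁻ z in S, ∫⁻ h in B, P (z + h) * ‖w (z + h)‖ₑ ^ 2 := by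
        rw [lintegral_add_left (hmL.const_mul _),
          lintegral_const_mul _ hmL,
          lintegral_const_mul _ hmpL]
    _ ≤ 2 * (C * (volume B)⁻¹) * (volume B * (ENNReal.ofReal (t * (‖e‖ + 1)) ^ 2
          * ∫⁻ z in S', ‖H z‖ₑ ^ 2))
        + 2 * α⁻¹ * (volume B * ∫⁻ z in S', P z * ‖w z‖ₑ ^ 2) := by
        gcongr
        · exact hw.lintegral_lintegral_translate_le hΩ hwm hsupp ht hS hS'Ω
        · rw [lintegral_lintegral_swap hmp.aemeasurable, mul_comm, ← setLIntegral_const]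
          refine setLIntegral_mono' measurableSet_ball fun h hh => ?_
          exact setLIntegral_shift_le hS.meas hS.meas' (fun z => P z * ‖w z‖ₑ ^ 2)
            fun z hz => hS.add_mem hh hz
    _ = 2 * (C * ((volume B)⁻¹ * volume B * (ENNReal.ofReal (t * (‖e‖ + 1)) ^ 2
          * ∫⁻ z in S', ‖H z‖ₑ ^ 2)))
        + 2 * (α⁻¹ * (volume B * ∫⁻ z in S', P z * ‖w z‖ₑ ^ 2)) := by ring
    _ = _ := by rw [ENNReal.inv_mul_cancel hB0 hBt, one_mul]

end Translation

/-! ### Smooth cutoff functions with explicit gradient bounds. -/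

section Cutoff

lemma exists_deriv_smoothTransition_le : ∃ L : ℝ, 0 < L ∧
    ∀ s, |deriv Real.smoothTransition s| ≤ L := by
  have hc : Continuous (deriv Real.smoothTransition) :=
    (Real.smoothTransition.contDiff (n := 1)).continuous_deriv le_rfl
  have hs : HasCompactSupport (deriv Real.smoothTransition) := by
    refine HasCompactSupport.intro (isCompact_Icc (a := (0 : ℝ)) (b := 1)) fun s hs => ?_
    rw [Set.mem_Icc, not_and_or, not_le, not_le] at hs
    rcases hs with h | h
    · have : Real.smoothTransition =ᶠ[𝓝 s] fun _ => 0 := by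
        filter_upwards [Iio_mem_nhds h] with t ht
        exact Real.smoothTransition.zero_of_nonpos (le_of_lt ht)
      rw [this.deriv_eq, deriv_const]
    · have : Real.smoothTransition =ᶠ[𝓝 s] fun _ => 1 := by
        filter_upwards [Ioi_mem_nhds h] with t ht
        exact Real.smoothTransition.one_of_one_le (le_of_lt ht)
      rw [this.deriv_eq, deriv_const]
  obtain ⟨C, hC⟩ := hs.exists_bound_of_continuous hc
  exact ⟨max C 1, by positivity, fun s => (hC s).trans (le_max_left _ _)⟩

/-- A smooth cutoff function between concentric balls. -/
structure IsCutoff {d : ℕ} (L : ℝ) (c : Eu d) (a b : ℝ) (η : Eu d → ℝ) : Prop where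
  contDiff : ContDiff ℝ ∞ η
  compact : HasCompactSupport η
  tsupport_subset : tsupport η ⊆ ball c b
  nonneg : ∀ x, 0 ≤ η x
  le_one : ∀ x, η x ≤ 1
  eq_one : ∀ x ∈ ball c a, η x = 1
  gradient_le : ∀ x, ‖gradient η x‖ ≤ L / (b - a)

lemma exists_cutoff : ∃ L : ℝ, 0 < L ∧ ∀ {d : ℕ} (c : Eu d) (a b : ℝ), 0 ≤ a → a < b →
    ∃ η : Eu d → ℝ, IsCutoff L c a b η := by
  obtain ⟨L₀, hL₀, hL⟩ := exists_deriv_smoothTransition_le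
  refine ⟨4 * L₀, by positivity, fun {d} c a b ha hab => ?_⟩
  -- Stopping the transition at the midpoint keeps the closed support inside the open ball of radius
  -- `b`. Using `‖x - c‖ ^ 2` in place of the norm makes `g` smooth at the centre, and costs only a
  -- factor in the constant.
  obtain ⟨m, hm⟩ : ∃ m, m = (a + b) / 2 := ⟨_, rfl⟩
  have ham : a < m := by linarith
  have hmb : m < b := by linarith
  have hD : 0 < m ^ 2 - a ^ 2 := by nlinarith
  obtain ⟨g, hg⟩ : ∃ g : Eu d → ℝ, g = fun x => (m ^ 2 - ‖x - c‖ ^ 2) / (m ^ 2 - a ^ 2) := ⟨_, rfl⟩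
  have hgs : ContDiff ℝ ∞ g := by
    rw [hg]
    exact (contDiff_const.sub ((contDiff_id.sub contDiff_const).norm_sq ℝ)).div_const _
  have hgg : ∀ x, gradient g x = -(2 / (m ^ 2 - a ^ 2)) • (x - c) := by
    intro x
    refine ext_inner_left ℝ fun v => ?_
    have h1 : HasFDerivAt (fun x : Eu d => x - c) (ContinuousLinearMap.id ℝ (Eu d)) x :=
      (hasFDerivAt_id x).sub_const c
    have h2 := ((h1.norm_sq).const_sub (m ^ 2)).mul_const (m ^ 2 - a ^ 2)⁻¹
    rw [inner_gradient, hg, inner_smul_right]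
    simp only [div_eq_mul_inv]
    rw [h2.fderiv, real_inner_comm (x - c) v]
    simp [inner_sub_left]
    ring
  have hsub : Function.support (fun x => Real.smoothTransition (g x)) ⊆ closedBall c m := by
    intro x hx
    by_contra hxc
    rw [mem_closedBall_iff_norm, not_le] at hxc
    refine hx (Real.smoothTransition.zero_of_nonpos ?_)
    rw [hg]
    exact div_nonpos_of_nonpos_of_nonneg (by nlinarith) hD.le
  have hts : tsupport (fun x => Real.smoothTransition (g x)) ⊆ closedBall c m :=
    closure_minimal hsub isClosed_closedBall
  refine ⟨fun x => Real.smoothTransition (g x), ?_, ?_, ?_,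
    fun x => Real.smoothTransition.nonneg _, fun x => Real.smoothTransition.le_one _, ?_, ?_⟩
  · exact Real.smoothTransition.contDiff.comp hgs
  · exact (isCompact_closedBall c m).of_isClosed_subset (isClosed_tsupport _) hts
  · exact hts.trans (closedBall_subset_ball hmb)
  · intro x hx
    rw [mem_ball_iff_norm] at hx
    refine Real.smoothTransition.one_of_one_le ?_
    rw [hg, le_div_iff₀ hD]
    nlinarith [norm_nonneg (x - c)]
  · intro x
    have hba : 0 < b - a := by linarith
    by_cases hx : x ∈ closedBall c m
    · rw [gradient_comp ((Real.smoothTransition.contDiff (n := 1)).differentiable one_ne_zero _)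
        (hgs.differentiable (by simp) x), hgg, norm_smul, norm_smul, norm_neg, Real.norm_eq_abs,
        Real.norm_of_nonneg (div_nonneg zero_le_two hD.le)]
      rw [mem_closedBall_iff_norm] at hx
      calc |deriv Real.smoothTransition (g x)| * (2 / (m ^ 2 - a ^ 2) * ‖x - c‖)
          ≤ L₀ * (2 / (m ^ 2 - a ^ 2) * m) := by
            gcongr
            exact hL _
        _ ≤ L₀ * (2 / (m - a)) := by
            gcongr
            rw [div_mul_eq_mul_div, div_le_div_iff₀ hD (by linarith)]
            nlinarith
        _ = 4 * L₀ / (b - a) := by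
            rw [hm]
            have : (a + b) / 2 - a = (b - a) / 2 := by ring
            rw [this]
            field_simp
            ring
    · rw [gradient_zero_of_notMem_tsupport fun h => hx (hts h), norm_zero]
      positivity

end Cutoff

/-! ### Pairings of square integrable functions. -/

section Pairing
variable {α : Type*} [MeasurableSpace α] {ν : Measure α} {E : Type*} [NormedAddCommGroup E]
  [InnerProductSpace ℝ E]

omit [InnerProductSpace ℝ E] in
lemma lintegral_enorm_mul_le {F' : Type*} [NormedAddCommGroup F'] {f : α → E} {g : α → F'}
    (hf : AEStronglyMeasurable f ν) (hg : AEStronglyMeasurable g ν) :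
    ∫⁻ x, ‖f x‖ₑ * ‖g x‖ₑ ∂ν ≤ eLpNorm f 2 ν * eLpNorm g 2 ν := by
  rw [← ENNReal.pow_le_pow_left_iff two_ne_zero, mul_pow, eLpNorm_two_sq, eLpNorm_two_sq]
  exact lintegral_mul_sq_le hf.enorm hg.enorm

lemma MemLp.integrable_inner_two {f g : α → E} (hf : MemLp f 2 ν) (hg : MemLp g 2 ν) :
    Integrable (fun x => ⟪f x, g x⟫) ν := by
  refine ⟨hf.1.inner hg.1, ?_⟩
  refine lt_of_le_of_lt (lintegral_mono fun x => ?_)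
    ((lintegral_enorm_mul_le hf.1 hg.1).trans_lt (ENNReal.mul_lt_top hf.2 hg.2))
  rw [← ofReal_norm, ← ofReal_norm, ← ofReal_norm, ← ENNReal.ofReal_mul (norm_nonneg _)]
  exact ENNReal.ofReal_le_ofReal (norm_inner_le_norm _ _)

lemma tendsto_integral_inner {f g : α → E} {gj : ℕ → α → E} (hf : MemLp f 2 ν)
    (hg : MemLp g 2 ν) (hgj : ∀ j, MemLp (gj j) 2 ν)
    (h : Tendsto (fun j => eLpNorm (fun x => gj j x - g x) 2 ν) atTop (𝓝 0)) :
    Tendsto (fun j => ∫ x, ⟪f x, gj j x⟫ ∂ν) atTop (𝓝 (∫ x, ⟪f x, g x⟫ ∂ν)) := by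
  refine tendsto_integral_of_L1 _ (hf.1.inner hg.1)
    (Eventually.of_forall fun j => MemLp.integrable_inner_two hf (hgj j)) ?_
  refine tendsto_of_tendsto_of_tendsto_of_le_of_le tendsto_const_nhds
    (h := fun j => eLpNorm f 2 ν * eLpNorm (fun x => gj j x - g x) 2 ν) ?_
    (fun _ => bot_le) fun j => ?_
  · have := ENNReal.Tendsto.const_mul h (a := eLpNorm f 2 ν) (Or.inr hf.2.ne)
    simpa only [mul_zero] using this
  · refine (lintegral_mono fun x => ?_).trans (lintegral_enorm_mul_le hf.1 ((hgj j).1.sub hg.1))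
    rw [← inner_sub_right, ← ofReal_norm, ← ofReal_norm, ← ofReal_norm,
      ← ENNReal.ofReal_mul (norm_nonneg _)]
    exact ENNReal.ofReal_le_ofReal (norm_inner_le_norm _ _)

end Pairing

/-! ### The vector field `A ∇u` under ellipticity and boundedness. -/

section Flux
variable {d : ℕ}

/-- Uniform ellipticity and boundedness of a measurable coefficient matrix. -/
structure IsElliptic (μ : ℝ) (A : Eu d → Matrix (Fin d) (Fin d) ℝ) : Prop where
  measurable : ∀ i j, Measurable fun x => A x i j
  elliptic : ∀ᵐ x, ∀ ξ : Eu d, μ * ‖ξ‖ ^ 2 ≤ ∑ i, ∑ j, A x i j * ξ i * ξ j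
  bounded : ∀ᵐ x, ∀ ξ ζ : Eu d, |∑ i, ∑ j, A x i j * ξ i * ζ j| ≤ μ⁻¹ * ‖ξ‖ * ‖ζ‖

/-- The vector `A ξ`. -/
noncomputable def flux (A : Matrix (Fin d) (Fin d) ℝ) (ξ : Eu d) : Eu d :=
  WithLp.toLp 2 fun i => ∑ j, A i j * ξ j

lemma inner_flux (A : Matrix (Fin d) (Fin d) ℝ) (ξ ζ : Eu d) :
    ⟪flux A ξ, ζ⟫ = ∑ i, ∑ j, A i j * ξ j * ζ i := by
  simp only [flux, PiLp.inner_apply, RCLike.inner_apply, conj_trivial]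
  refine Finset.sum_congr rfl fun i _ => ?_
  rw [Finset.mul_sum]
  exact Finset.sum_congr rfl fun j _ => by ring

lemma inner_flux' (A : Matrix (Fin d) (Fin d) ℝ) (ξ ζ : Eu d) :
    ⟪flux A ξ, ζ⟫ = ∑ i, ∑ j, A i j * ζ i * ξ j := by
  rw [inner_flux]
  exact Finset.sum_congr rfl fun i _ => Finset.sum_congr rfl fun j _ => by ring

variable {μ : ℝ} {A : Eu d → Matrix (Fin d) (Fin d) ℝ}

lemma IsElliptic.le_inner_flux (hA : IsElliptic μ A) :
    ∀ᵐ x, ∀ ξ : Eu d, μ * ‖ξ‖ ^ 2 ≤ ⟪flux (A x) ξ, ξ⟫ := by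
  filter_upwards [hA.elliptic] with x hx ξ
  rw [inner_flux']
  exact hx ξ

lemma IsElliptic.abs_inner_flux_le (hA : IsElliptic μ A) :
    ∀ᵐ x, ∀ ξ ζ : Eu d, |⟪flux (A x) ξ, ζ⟫| ≤ μ⁻¹ * ‖ξ‖ * ‖ζ‖ := by
  filter_upwards [hA.bounded] with x hx ξ ζ
  rw [inner_flux']
  exact (hx ζ ξ).trans (le_of_eq (by ring))

lemma IsElliptic.norm_flux_le (hA : IsElliptic μ A) :
    ∀ᵐ x, ∀ ξ : Eu d, ‖flux (A x) ξ‖ ≤ μ⁻¹ * ‖ξ‖ := by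
  filter_upwards [hA.abs_inner_flux_le] with x hx ξ
  have h := hx ξ (flux (A x) ξ)
  rw [real_inner_self_eq_norm_sq, abs_of_nonneg (by positivity), sq] at h
  rcases (norm_nonneg (flux (A x) ξ)).eq_or_lt with h0 | h0
  · rw [← h0]
    by_contra hn
    rw [not_le] at hn
    have := hx ξ ξ
    have h2 : 0 ≤ μ⁻¹ * ‖ξ‖ * ‖ξ‖ := (abs_nonneg _).trans this
    rcases (norm_nonneg ξ).eq_or_lt with h3 | h3
    · rw [← h3, mul_zero] at hn
      exact lt_irrefl _ hn
    · nlinarith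
  · exact le_of_mul_le_mul_right h h0

lemma aestronglyMeasurable_flux (hA : IsElliptic μ A) {ν : Measure (Eu d)} {G : Eu d → Eu d}
    (hG : AEStronglyMeasurable G ν) : AEStronglyMeasurable (fun x => flux (A x) (G x)) ν := by
  refine AEMeasurable.aestronglyMeasurable ?_
  have : (fun x => flux (A x) (G x))
      = (WithLp.toLp 2) ∘ fun x => fun i => ∑ j, A x i j * G x j := rfl
  rw [this]
  refine (WithLp.measurable_toLp 2 (Fin d → ℝ)).comp_aemeasurable
    (aemeasurable_pi_lambda _ fun i => Finset.aemeasurable_fun_sum _ fun j _ =>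
      (hA.measurable i j).aemeasurable.mul ?_)
  exact ((measurable_pi_apply j).comp (WithLp.measurable_ofLp 2 (Fin d → ℝ))).comp_aemeasurable
    hG.aemeasurable

lemma memLp_flux (hA : IsElliptic μ A) {S : Set (Eu d)} {G : Eu d → Eu d}
    (hG : MemLp G 2 (volume.restrict S)) :
    MemLp (fun x => flux (A x) (G x)) 2 (volume.restrict S) := by
  refine MemLp.of_le_mul (c := μ⁻¹) hG (aestronglyMeasurable_flux hA hG.1) ?_
  exact (ae_restrict_of_ae hA.norm_flux_le).mono fun x hx => hx _

lemma form_eq (V : Eu d → ℝ) (Ω : Set (Eu d)) (u : Eu d → ℝ) (G : Eu d → Eu d) (φ : Eu d → ℝ)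
    (H : Eu d → Eu d) :
    form A V Ω u G φ H = ∫ x in Ω, (⟪flux (A x) (G x), H x⟫ + V x * u x * φ x) := by
  simp only [form, inner_flux]

end Flux

/-! ### Local Neumann solutions and the Caccioppoli inequality. -/

section LocalSolution
variable {d : ℕ} {μ : ℝ} {A : Eu d → Matrix (Fin d) (Fin d) ℝ} {V : Eu d → ℝ} {Ω : Set (Eu d)}
  {e : Eu d}

/-- `u` solves the homogeneous Neumann problem in `Ω ∩ ball c R`. -/
structure LocalSol (A : Eu d → Matrix (Fin d) (Fin d) ℝ) (V : Eu d → ℝ) (Ω : Set (Eu d))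
    (c : Eu d) (R : ℝ) (u : Eu d → ℝ) (G : Eu d → Eu d) : Prop where
  weakGrad : HasWeakGrad Ω u G
  memLp : MemLp u 2 (volume.restrict (Ω ∩ ball c R))
  memLp_grad : MemLp G 2 (volume.restrict (Ω ∩ ball c R))
  eq_zero : ∀ φ : Eu d → ℝ, ContDiff ℝ ∞ φ → HasCompactSupport φ → tsupport φ ⊆ ball c R →
    form A V Ω u G φ (gradient φ) = 0

lemma LocalSol.neg {c : Eu d} {R : ℝ} {u : Eu d → ℝ} {G : Eu d → Eu d}
    (h : LocalSol A V Ω c R u G) : LocalSol A V Ω c R (fun x => -u x) (fun x => -G x) where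
  weakGrad := h.weakGrad.neg
  memLp := h.memLp.neg
  memLp_grad := h.memLp_grad.neg
  eq_zero φ h1 h2 h3 := by
    have h4 := h.eq_zero φ h1 h2 h3
    rw [form_eq] at h4 ⊢
    rw [← neg_eq_zero, ← integral_neg] at h4
    rw [← h4]
    refine integral_congr_ae (ae_of_all _ fun x => ?_)
    simp only [inner_flux, PiLp.neg_apply, mul_neg, neg_mul, Finset.sum_neg_distrib]
    ring

lemma memLp_potential_mul {c : Eu d} {R : ℝ} {u : Eu d → ℝ}
    (hV : MemLp V ⊤ (volume.restrict (ball c R)))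
    (hu : MemLp u 2 (volume.restrict (Ω ∩ ball c R))) :
    MemLp (fun x => V x * u x) 2 (volume.restrict (Ω ∩ ball c R)) :=
  hu.mul (hV.mono_measure (Measure.restrict_mono Set.inter_subset_right le_rfl))

lemma form_eq_inter {c : Eu d} {R : ℝ} {u : Eu d → ℝ} {G : Eu d → Eu d} (hΩ : MeasurableSet Ω)
    {φ : Eu d → ℝ} {H : Eu d → Eu d} (hφ : ∀ x ∉ ball c R, φ x = 0)
    (hH : ∀ x ∉ ball c R, H x = 0) :
    form A V Ω u G φ H
      = ∫ x in Ω ∩ ball c R, (⟪flux (A x) (G x), H x⟫ + V x * u x * φ x) := by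
  rw [form_eq]
  refine setIntegral_eq_of_subset_of_forall_sdiff_eq_zero hΩ Set.inter_subset_left fun x hx => ?_
  have hx' : x ∉ ball c R := fun h => hx.2 ⟨hx.1, h⟩
  rw [hφ x hx', hH x hx', inner_zero_right, mul_zero, add_zero]

/-- The weak formulation extends to Sobolev test functions. -/
lemma LocalSol.form_eq_zero (hA : IsElliptic μ A) (hΩ : ConeRegion Ω e) {c : Eu d} {R : ℝ}
    (hV : MemLp V ⊤ (volume.restrict (ball c R))) {u : Eu d → ℝ} {G : Eu d → Eu d}
    (h : LocalSol A V Ω c R u G) {φ : Eu d → ℝ} {H : Eu d → Eu d} (hφ : MemW 2 Ω φ H) {r : ℝ}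
    (hr : r < R) (hφs : ∀ x, x ∉ closedBall c r → φ x = 0)
    (hHs : ∀ x, x ∉ closedBall c r → H x = 0) : form A V Ω u G φ H = 0 := by
  obtain ⟨f, hf, hfc, hfs, t1, t2⟩ := hφ.exists_seq_smooth hΩ one_le_two (by simp) hr
    fun x _ hx => hφs x hx
  have hsub : closedBall c r ⊆ ball c R := closedBall_subset_ball hr
  rw [form_eq_inter hΩ.isOpen.measurableSet (fun x hx => hφs x fun h => hx (hsub h))
    (fun x hx => hHs x fun h => hx (hsub h))]
  set ν := volume.restrict (Ω ∩ ball c R) with hν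
  have hνle : ν ≤ volume.restrict Ω := Measure.restrict_mono Set.inter_subset_left le_rfl
  have hF := memLp_flux hA h.memLp_grad
  have hVu := memLp_potential_mul (Ω := Ω) hV h.memLp
  have m1 : ∀ j, MemLp (f j) 2 ν := fun j =>
    ((hf j).continuous.memLp_of_hasCompactSupport (hfc j) (μ := volume)).restrict _
  have m2 : ∀ j, MemLp (gradient (f j)) 2 ν := fun j =>
    ((continuous_gradient (hf j) one_le_infty).memLp_of_hasCompactSupport
      (hasCompactSupport_gradient (hfc j)) (μ := volume)).restrict _
  have hφν := hφ.memLp.mono_measure hνle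
  have hHν := hφ.memLp_grad.mono_measure hνle
  have l1 := tendsto_integral_inner hVu hφν m1 (tendsto_of_tendsto_of_tendsto_of_le_of_le
    tendsto_const_nhds t1 (fun _ => bot_le) fun j => eLpNorm_mono_measure _ hνle)
  have l2 := tendsto_integral_inner hF hHν m2 (tendsto_of_tendsto_of_tendsto_of_le_of_le
    tendsto_const_nhds t2 (fun _ => bot_le) fun j => eLpNorm_mono_measure _ hνle)
  have l3 := l2.add l1
  have e0 : ∀ j, (∫ x, ⟪flux (A x) (G x), gradient (f j) x⟫ ∂ν)
      + ∫ x, ⟪V x * u x, f j x⟫ ∂ν = 0 := by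
    intro j
    rw [← integral_add (MemLp.integrable_inner_two hF (m2 j))
      (MemLp.integrable_inner_two hVu (m1 j)), ← h.eq_zero (f j) (hf j) (hfc j) (hfs j),
      form_eq_inter hΩ.isOpen.measurableSet
        (fun x hx => image_eq_zero_of_notMem_tsupport fun h => hx (hfs j h))
        (fun x hx => gradient_zero_of_notMem_tsupport fun h => hx (hfs j h))]
    refine integral_congr_ae (ae_of_all _ fun x => ?_)
    simp [mul_comm]
  have l4 := tendsto_nhds_unique (l3.congr e0) tendsto_const_nhds
  rw [← l4, ← integral_add (MemLp.integrable_inner_two hF hHν)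
    (MemLp.integrable_inner_two hVu hφν)]
  refine integral_congr_ae (ae_of_all _ fun x => ?_)
  simp [mul_comm]

lemma memLp_smul_of_tsupport {F : Type*} [NormedAddCommGroup F] [NormedSpace ℝ F] {c : Eu d}
    {R : ℝ} {f : Eu d → F}
    (hf : MemLp f 2 (volume.restrict (Ω ∩ ball c R))) {η : Eu d → ℝ} (hη : Continuous η)
    (hc : HasCompactSupport η) (hs : tsupport η ⊆ ball c R) :
    MemLp (fun x => η x • f x) 2 (volume.restrict Ω) := by
  obtain ⟨C, hC⟩ := hc.exists_bound_of_continuous hη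
  have h1 : MemLp (fun x => η x • f x) 2 (volume.restrict (Ω ∩ ball c R)) := by
    refine hf.of_le_mul (c := C) (hη.aestronglyMeasurable.smul hf.1) (ae_of_all _ fun x => ?_)
    rw [norm_smul]
    exact mul_le_mul_of_nonneg_right (hC x) (norm_nonneg _)
  rw [Set.inter_comm, ← Measure.restrict_restrict measurableSet_ball,
    ← memLp_indicator_iff_restrict measurableSet_ball] at h1
  refine (memLp_congr_ae (ae_of_all _ fun x => ?_)).1 h1
  by_cases hx : x ∈ ball c R
  · rw [Set.indicator_of_mem hx]
  · rw [Set.indicator_of_notMem hx, image_eq_zero_of_notMem_tsupport fun h => hx (hs h), zero_smul]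

lemma memLp_smul_of_tsupport' {c : Eu d}
    {R : ℝ} {f : Eu d → ℝ} (hf : MemLp f 2 (volume.restrict (Ω ∩ ball c R))) {H : Eu d → Eu d}
    (hη : Continuous H)
    (hc : HasCompactSupport H) (hs : tsupport H ⊆ ball c R) :
    MemLp (fun x => f x • H x) 2 (volume.restrict Ω) := by
  obtain ⟨C, hC⟩ := hc.exists_bound_of_continuous hη
  have h1 : MemLp (fun x => f x • H x) 2 (volume.restrict (Ω ∩ ball c R)) := by
    refine hf.of_le_mul (c := C) (hf.1.smul hη.aestronglyMeasurable) (ae_of_all _ fun x => ?_)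
    rw [norm_smul, mul_comm]
    exact mul_le_mul_of_nonneg_right (hC x) (norm_nonneg _)
  rw [Set.inter_comm, ← Measure.restrict_restrict measurableSet_ball,
    ← memLp_indicator_iff_restrict measurableSet_ball] at h1
  refine (memLp_congr_ae (ae_of_all _ fun x => ?_)).1 h1
  by_cases hx : x ∈ ball c R
  · rw [Set.indicator_of_mem hx]
  · rw [Set.indicator_of_notMem hx, image_eq_zero_of_notMem_tsupport fun h => hx (hs h), smul_zero]

/-- Localisation of a Sobolev function by a smooth cutoff. -/
lemma HasWeakGrad.memW_cutoff (hΩ : IsOpen Ω) {c : Eu d} {R : ℝ} {w : Eu d → ℝ} {W : Eu d → Eu d}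
    (h : HasWeakGrad Ω w W) (hw : MemLp w 2 (volume.restrict (Ω ∩ ball c R)))
    (hW : MemLp W 2 (volume.restrict (Ω ∩ ball c R))) {η : Eu d → ℝ} (hη : ContDiff ℝ ∞ η)
    (hc : HasCompactSupport η) (hs : tsupport η ⊆ ball c R) :
    MemW 2 Ω (fun x => η x * w x) (fun x => η x • W x + w x • gradient η x) where
  weakGrad := h.smooth_mul hΩ hη
  memLp := memLp_smul_of_tsupport hw hη.continuous hc hs
  memLp_grad := (memLp_smul_of_tsupport hW hη.continuous hc hs).add
    (memLp_smul_of_tsupport' hw (continuous_gradient hη one_le_infty)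
      (hasCompactSupport_gradient hc) (tsupport_gradient_subset.trans hs))

/-- The constant in the Caccioppoli inequality. -/
noncomputable def caccConst (μ : ℝ) : ℝ := (2 * μ⁻¹ ^ 3 + μ / 2) / min (μ / 4) 1

lemma caccConst_pos (hμ : 0 < μ) : 0 < caccConst μ := by
  have : 0 < min (μ / 4) 1 := lt_min (by positivity) one_pos
  unfold caccConst
  positivity

/-- This is the integrand of the weak formulation tested with `η² (u - k)₊`; `t` and `D` stand for
the values of `η` and `∇η`. Ellipticity provides `μ t² |W|²`. One half absorbs the cross term `2 t w
⟨A W, D⟩` at the cost `2 μ⁻³ w² |D|²`; the other half dominates `μ / 4 |t W + w D|²` up to `μ / 2 w²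
|D|²`, whence `caccConst`. Since `k ≥ 0`, one has `w ≤ u` where `w > 0`, so the potential term has
the right sign. -/
lemma caccioppoli_pointwise (hμ : 0 < μ) {M : Matrix (Fin d) (Fin d) ℝ}
    (h1 : ∀ ξ : Eu d, μ * ‖ξ‖ ^ 2 ≤ ⟪flux M ξ, ξ⟫)
    (h2 : ∀ ξ ζ : Eu d, |⟪flux M ξ, ζ⟫| ≤ μ⁻¹ * ‖ξ‖ * ‖ζ‖) {v u w t k : ℝ} (hv : 0 ≤ v)
    (hk : 0 ≤ k) (hw : w = max (u - k) 0) (g W D : Eu d)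
    (hW : W = (if 0 < u - k then (1 : ℝ) else 0) • g) :
    min (μ / 4) 1 * (‖t • W + w • D‖ ^ 2 + v * (t * w) ^ 2)
      ≤ (⟪flux M g, (t * t) • W + w • (t • D + t • D)⟫ + v * u * ((t * t) * w))
        + (2 * μ⁻¹ ^ 3 + μ / 2) * (w ^ 2 * ‖D‖ ^ 2) := by
  have hm : min (μ / 4) 1 * (‖t • W + w • D‖ ^ 2 + v * (t * w) ^ 2)
      ≤ μ / 4 * ‖t • W + w • D‖ ^ 2 + v * (t * w) ^ 2 := by
    have a1 := min_le_left (μ / 4) 1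
    have a2 := min_le_right (μ / 4) 1
    have a3 : 0 ≤ v * (t * w) ^ 2 := by positivity
    nlinarith [sq_nonneg ‖t • W + w • D‖]
  refine hm.trans ?_
  have hn : ‖t • W + w • D‖ ^ 2 ≤ 2 * (t ^ 2 * ‖W‖ ^ 2) + 2 * (w ^ 2 * ‖D‖ ^ 2) := by
    have b1 := norm_add_le (t • W) (w • D)
    rw [norm_smul, norm_smul, Real.norm_eq_abs, Real.norm_eq_abs] at b1
    have b2 := sq_abs t
    have b3 := sq_abs w
    calc ‖t • W + w • D‖ ^ 2 ≤ (|t| * ‖W‖ + |w| * ‖D‖) ^ 2 :=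
          pow_le_pow_left₀ (norm_nonneg _) b1 2
      _ ≤ 2 * (|t| ^ 2 * ‖W‖ ^ 2) + 2 * (|w| ^ 2 * ‖D‖ ^ 2) := by
          nlinarith [sq_nonneg (|t| * ‖W‖ - |w| * ‖D‖)]
      _ = _ := by rw [b2, b3]
  by_cases hu : 0 < u - k
  · rw [if_pos hu, one_smul] at hW
    rw [max_eq_left hu.le] at hw
    subst hW
    have hin : ⟪flux M W, (t * t) • W + w • (t • D + t • D)⟫
        = t ^ 2 * ⟪flux M W, W⟫ + 2 * (t * w * ⟪flux M W, D⟫) := by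
      rw [inner_add_right, inner_smul_right, inner_smul_right, inner_add_right, inner_smul_right]
      ring
    rw [hin]
    have c1 := h1 W
    have c2 := h2 W D
    have c3 : -(|t| * |w| * (μ⁻¹ * ‖W‖ * ‖D‖)) ≤ t * w * ⟪flux M W, D⟫ := by
      refine le_trans ?_ (neg_abs_le _)
      rw [abs_mul, abs_mul]
      gcongr
    have c4 : 2 * (|t| * |w| * (μ⁻¹ * ‖W‖ * ‖D‖))
        ≤ μ / 2 * (t ^ 2 * ‖W‖ ^ 2) + 2 * μ⁻¹ ^ 3 * (w ^ 2 * ‖D‖ ^ 2) := by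
      obtain ⟨m, hm⟩ : ∃ m, m = μ⁻¹ := ⟨_, rfl⟩
      have hm0 : 0 < m := by rw [hm]; positivity
      have hμm : μ = m⁻¹ := by rw [hm, inv_inv]
      have key : 0 ≤ m⁻¹ / 2 * (|t| * ‖W‖ - 2 * m ^ 2 * (|w| * ‖D‖)) ^ 2 := by positivity
      have ex : m⁻¹ / 2 * (|t| * ‖W‖ - 2 * m ^ 2 * (|w| * ‖D‖)) ^ 2
          = m⁻¹ / 2 * (|t| ^ 2 * ‖W‖ ^ 2) - 2 * (|t| * |w| * (m * ‖W‖ * ‖D‖))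
            + 2 * m ^ 3 * (|w| ^ 2 * ‖D‖ ^ 2) := by
        field_simp
        ring
      rw [ex, sq_abs, sq_abs] at key
      rw [hμm, inv_inv]
      linarith
    have c5 : v * (t * w) ^ 2 ≤ v * u * (t * t * w) := by
      have : w ≤ u := by linarith
      have hw0 : 0 < w := hw ▸ hu
      have : v * (t * w) ^ 2 = v * w * (t * t * w) := by ring
      rw [this]
      gcongr
      exact mul_nonneg (mul_self_nonneg t) hw0.le
    have c6 : t ^ 2 * (μ * ‖W‖ ^ 2) ≤ t ^ 2 * ⟪flux M W, W⟫ := by gcongr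
    nlinarith
  · rw [if_neg hu, zero_smul] at hW
    rw [max_eq_right (not_lt.1 hu)] at hw
    subst hW hw
    simp

/-- Nonnegative subsolutions: all truncations satisfy the Caccioppoli inequality. -/
structure SubSol (C₀ : ℝ≥0∞) (P : Eu d → ℝ≥0∞) (Ω : Set (Eu d)) (c : Eu d) (R : ℝ)
    (w : Eu d → ℝ) : Prop where
  nonneg : ∀ x, 0 ≤ w x
  memLp : MemLp w 2 (volume.restrict (Ω ∩ ball c R))
  cacc : ∀ k : ℝ, 0 ≤ k → ∀ η : Eu d → ℝ, ContDiff ℝ ∞ η → HasCompactSupport η →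
    tsupport η ⊆ ball c R → ∃ Q : Eu d → Eu d, MemW 2 Ω (fun x => η x * max (w x - k) 0) Q ∧
      (∫⁻ x in Ω, ‖Q x‖ₑ ^ 2) + ∫⁻ x in Ω, P x * ‖η x * max (w x - k) 0‖ₑ ^ 2
        ≤ C₀ * ∫⁻ x in Ω, ‖max (w x - k) 0‖ₑ ^ 2 * ‖gradient η x‖ₑ ^ 2

lemma setLIntegral_eq_inter_ball {c : Eu d} {R : ℝ} {f : Eu d → ℝ≥0∞}
    (hf : ∀ x ∉ ball c R, f x = 0) : ∫⁻ x in Ω, f x = ∫⁻ x in Ω ∩ ball c R, f x := by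
  rw [Set.inter_comm, ← setLIntegral_indicator measurableSet_ball]
  congr 1
  ext1 x
  by_cases hx : x ∈ ball c R
  · rw [Set.indicator_of_mem hx]
  · rw [Set.indicator_of_notMem hx, hf x hx]

/-- The test function is `η² (u - k)₊`, and for `k ≥ 0` truncating the positive part of `u` at `k`
is the same as truncating `u`. From here on only the Caccioppoli inequalities recorded in `SubSol`
are used in the local estimates. -/
lemma LocalSol.subSol (hμ : 0 < μ) (hA : IsElliptic μ A) (hΩ : ConeRegion Ω e) {c : Eu d} {R : ℝ}
    (hV : MemLp V ⊤ (volume.restrict (ball c R))) (hV0 : ∀ᵐ x, 0 ≤ V x) {P : Eu d → ℝ≥0∞}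
    (hP : ∀ᵐ x, P x = ENNReal.ofReal (V x)) {u : Eu d → ℝ} {G : Eu d → Eu d}
    (h : LocalSol A V Ω c R u G) :
    SubSol (ENNReal.ofReal (caccConst μ)) P Ω c R (fun x => max (u x) 0) := by
  refine ⟨fun x => le_max_right _ _, ?_, ?_⟩
  · refine h.memLp.mono (h.memLp.1.sup aestronglyMeasurable_const) (ae_of_all _ fun x => ?_)
    rw [Real.norm_of_nonneg (le_max_right _ _), Real.norm_eq_abs]
    exact max_le (le_abs_self _) (abs_nonneg _)
  intro k hk η hη hc hs
  have hmax : ∀ x, max (max (u x) 0 - k) 0 = max (u x - k) 0 := fun x => by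
    rcases le_total (u x) 0 with h0 | h0
    · rw [max_eq_right h0, max_eq_right (by linarith), max_eq_right (by linarith)]
    · rw [max_eq_left h0]
  simp only [hmax]
  obtain ⟨w, hw⟩ : ∃ w : Eu d → ℝ, w = fun x => max (u x - k) 0 := ⟨_, rfl⟩
  obtain ⟨W, hW⟩ : ∃ W : Eu d → Eu d, W = fun x => (if 0 < u x - k then (1 : ℝ) else 0) • G x :=
    ⟨_, rfl⟩
  have hgw : HasWeakGrad Ω w W := by
    rw [hw, hW]
    exact h.weakGrad.posPart hΩ.isOpen k
  have hwle : ∀ x, ‖w x‖ ≤ ‖u x‖ := fun x => by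
    rw [hw, Real.norm_of_nonneg (le_max_right _ _), Real.norm_eq_abs]
    exact max_le (by linarith [le_abs_self (u x)]) (abs_nonneg _)
  have hWle : ∀ x, ‖W x‖ ≤ ‖G x‖ := fun x => by
    rw [hW, norm_smul]
    refine mul_le_of_le_one_left (norm_nonneg _) ?_
    split_ifs <;> simp
  set ν := volume.restrict (Ω ∩ ball c R) with hν
  have hνle : ν ≤ volume.restrict Ω := Measure.restrict_mono Set.inter_subset_left le_rfl
  have hwL : MemLp w 2 ν := h.memLp.mono (hgw.locInt.aestronglyMeasurable.mono_measure hνle)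
    (ae_of_all _ hwle)
  have hWL : MemLp W 2 ν := h.memLp_grad.mono
    (hgw.locInt_grad.aestronglyMeasurable.mono_measure hνle) (ae_of_all _ hWle)
  have hQ : MemW 2 Ω (fun x => η x * w x) (fun x => η x • W x + w x • gradient η x) :=
    hgw.memW_cutoff hΩ.isOpen hwL hWL hη hc hs
  have hgηη : ∀ x, gradient (fun x => η x * η x) x = η x • gradient η x + η x • gradient η x :=
    fun x => gradient_mul (hη.differentiable (by simp) x) (hη.differentiable (by simp) x)
  have hT : MemW 2 Ω (fun x => η x * η x * w x)
      (fun x => (η x * η x) • W x + w x • (η x • gradient η x + η x • gradient η x)) := by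
    have := hgw.memW_cutoff hΩ.isOpen hwL hWL (hη.mul hη) hc.mul_left
      (tsupport_mul_subset_left.trans hs)
    simpa only [hgηη] using this
  obtain ⟨r, hr, hsr⟩ := exists_lt_subset_ball (isClosed_tsupport η) hs
  have hη0 : ∀ x, x ∉ closedBall c r → η x = 0 := fun x hx =>
    image_eq_zero_of_notMem_tsupport fun h => hx (ball_subset_closedBall (hsr h))
  have hη1 : ∀ x, x ∉ closedBall c r → gradient η x = 0 := fun x hx =>
    gradient_zero_of_notMem_tsupport fun h => hx (ball_subset_closedBall (hsr h))
  have hsub : closedBall c r ⊆ ball c R := closedBall_subset_ball hr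
  have hform := h.form_eq_zero hA hΩ hV hT hr (fun x hx => by simp [hη0 x hx])
    (fun x hx => by simp [hη0 x hx])
  rw [form_eq_inter (c := c) (R := R) hΩ.isOpen.measurableSet
    (fun x hx => by simp [hη0 x fun h => hx (hsub h)])
    (fun x hx => by simp [hη0 x fun h => hx (hsub h)])] at hform
  have hF := memLp_flux hA h.memLp_grad
  have hVu := memLp_potential_mul (Ω := Ω) hV h.memLp
  have hiT : Integrable (fun x => ⟪flux (A x) (G x),
      (η x * η x) • W x + w x • (η x • gradient η x + η x • gradient η x)⟫
        + V x * u x * (η x * η x * w x)) ν := by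
    refine (MemLp.integrable_inner_two hF (hT.memLp_grad.mono_measure hνle)).add ?_
    refine (MemLp.integrable_inner_two hVu (hT.memLp.mono_measure hνle)).congr
      (ae_of_all _ fun x => ?_)
    simp [mul_comm]
  have hQν := hQ.memLp_grad.mono_measure hνle
  have hQν' := hQ.memLp.mono_measure hνle
  have hi1 : Integrable (fun x => ‖η x • W x + w x • gradient η x‖ ^ 2
      + V x * (η x * w x) ^ 2) ν := by
    refine Integrable.add ?_ ?_
    · refine (MemLp.integrable_inner_two hQν hQν).congr (ae_of_all _ fun x => ?_)
      simp only [real_inner_self_eq_norm_sq]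
    · refine (MemLp.integrable_inner_two (memLp_potential_mul (Ω := Ω) hV hQν') hQν').congr
        (ae_of_all _ fun x => ?_)
      simp only [RCLike.inner_apply, conj_trivial]
      ring
  have hwD : MemLp (fun x => w x • gradient η x) 2 ν :=
    (memLp_smul_of_tsupport' hwL (continuous_gradient hη one_le_infty)
      (hasCompactSupport_gradient hc) (tsupport_gradient_subset.trans hs)).mono_measure hνle
  have hi2 : Integrable (fun x => w x ^ 2 * ‖gradient η x‖ ^ 2) ν := by
    refine (MemLp.integrable_inner_two hwD hwD).congr (ae_of_all _ fun x => ?_)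
    simp only [real_inner_self_eq_norm_sq, norm_smul, mul_pow, Real.norm_eq_abs, sq_abs]
  have hmin : 0 < min (μ / 4) 1 := lt_min (by positivity) one_pos
  have hreal : ∫ x, (‖η x • W x + w x • gradient η x‖ ^ 2 + V x * (η x * w x) ^ 2) ∂ν
      ≤ caccConst μ * ∫ x, w x ^ 2 * ‖gradient η x‖ ^ 2 ∂ν := by
    rw [caccConst, div_mul_eq_mul_div, le_div_iff₀ hmin, mul_comm]
    rw [← integral_const_mul, ← integral_const_mul]
    refine le_of_le_of_eq ?_ ((integral_add hiT (hi2.const_mul (2 * μ⁻¹ ^ 3 + μ / 2))).trans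
      (by rw [hform, zero_add]))
    refine integral_mono_ae (hi1.const_mul _) (hiT.add (hi2.const_mul _)) ?_
    filter_upwards [ae_restrict_of_ae hA.le_inner_flux, ae_restrict_of_ae hA.abs_inner_flux_le,
      ae_restrict_of_ae hV0] with x h1 h2 h3
    exact caccioppoli_pointwise hμ h1 h2 h3 hk (by rw [hw]) (G x) (W x) (gradient η x) (by rw [hW])
  have hQ' : MemW 2 Ω (fun x => η x * max (u x - k) 0)
      (fun x => η x • W x + w x • gradient η x) := by
    simpa only [hw] using hQ
  refine ⟨_, hQ', ?_⟩
  have e1 : (∫⁻ x in Ω, ‖η x • W x + w x • gradient η x‖ₑ ^ 2)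
      + ∫⁻ x in Ω, P x * ‖η x * w x‖ₑ ^ 2
      = ∫⁻ x, ENNReal.ofReal (‖η x • W x + w x • gradient η x‖ ^ 2
        + V x * (η x * w x) ^ 2) ∂ν := by
    have e1a : ∫⁻ x in Ω, ‖η x • W x + w x • gradient η x‖ₑ ^ 2
        = ∫⁻ x, ‖η x • W x + w x • gradient η x‖ₑ ^ 2 ∂ν :=
      setLIntegral_eq_inter_ball fun x hx => by
        simp [hη0 x fun h => hx (hsub h), hη1 x fun h => hx (hsub h)]
    have e1b : ∫⁻ x in Ω, P x * ‖η x * w x‖ₑ ^ 2 = ∫⁻ x, P x * ‖η x * w x‖ₑ ^ 2 ∂ν :=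
      setLIntegral_eq_inter_ball fun x hx => by simp [hη0 x fun h => hx (hsub h)]
    rw [e1a, e1b, ← lintegral_add_left' (hQν.1.enorm.pow_const 2)]
    refine lintegral_congr_ae ?_
    filter_upwards [ae_restrict_of_ae hV0, ae_restrict_of_ae hP] with x h3 h4
    rw [ENNReal.ofReal_add (by positivity) (by positivity), ENNReal.ofReal_mul h3, h4,
      ENNReal.ofReal_pow (norm_nonneg _), ofReal_norm, ← sq_abs (η x * w x),
      ENNReal.ofReal_pow (abs_nonneg _), ← Real.enorm_eq_ofReal_abs]
  have e2 : ENNReal.ofReal (∫ x, w x ^ 2 * ‖gradient η x‖ ^ 2 ∂ν)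
      ≤ ∫⁻ x in Ω, ‖max (u x - k) 0‖ₑ ^ 2 * ‖gradient η x‖ₑ ^ 2 := by
    rw [ofReal_integral_eq_lintegral_ofReal hi2 (ae_of_all _ fun x => by positivity)]
    refine (lintegral_mono fun x => le_of_eq ?_).trans (lintegral_mono' hνle le_rfl)
    rw [ENNReal.ofReal_mul (by positivity), ENNReal.ofReal_pow (norm_nonneg _), ofReal_norm,
      ← sq_abs (w x), ENNReal.ofReal_pow (abs_nonneg _), ← Real.enorm_eq_ofReal_abs, hw]
  have e3 : ∫⁻ x in Ω, P x * ‖η x * max (u x - k) 0‖ₑ ^ 2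
      = ∫⁻ x in Ω, P x * ‖η x * w x‖ₑ ^ 2 := by rw [hw]
  rw [e3, e1, ← ofReal_integral_eq_lintegral_ofReal hi1]
  · refine (ENNReal.ofReal_le_ofReal hreal).trans ?_
    rw [ENNReal.ofReal_mul (caccConst_pos hμ).le]
    gcongr
  · filter_upwards [ae_restrict_of_ae hV0] with x h3
    positivity

end LocalSolution

/-! ### De Giorgi iteration up to the boundary. -/

section DeGiorgi
variable {d : ℕ} {Ω : Set (Eu d)} {e : Eu d}

/-- An absolute constant bounding the gradients of cutoff functions. -/
noncomputable def cutoffConst : ℝ := exists_cutoff.choose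

lemma cutoffConst_pos : 0 < cutoffConst := exists_cutoff.choose_spec.1

lemma exists_isCutoff (c : Eu d) {a b : ℝ} (ha : 0 ≤ a) (hab : a < b) :
    ∃ η : Eu d → ℝ, IsCutoff cutoffConst c a b η := exists_cutoff.choose_spec.2 c a b ha hab

lemma IsCutoff.lintegral_mul_gradient_le {L a b : ℝ} {c : Eu d} {η : Eu d → ℝ}
    (hη : IsCutoff L c a b η) (f : Eu d → ℝ≥0∞) :
    ∫⁻ x in Ω, f x * ‖gradient η x‖ₑ ^ 2
      ≤ ENNReal.ofReal (L / (b - a)) ^ 2 * ∫⁻ x in Ω ∩ ball c b, f x := by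
  rw [setLIntegral_eq_inter_ball (c := c) (R := b) fun x hx => by
    rw [gradient_zero_of_notMem_tsupport fun h => hx (hη.tsupport_subset h)]; simp]
  rw [← lintegral_const_mul' _ _ (by finiteness)]
  refine lintegral_mono fun x => ?_
  rw [mul_comm]
  gcongr
  rw [← ofReal_norm]
  exact ENNReal.ofReal_le_ofReal (hη.gradient_le x)

/-- By Chebyshev, the set where `η (w - k')₊` does not vanish has volume at most `(k' - k)^{-2}`
times the integral of `(w - k)₊²`. Hypothesis `hY` makes it small enough for `MemW.nash` at scale
`t`, and the gradient produced there is bounded by Caccioppoli's inequality at level `k'`. -/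
lemma SubSol.step {C₀ : ℝ≥0∞} {P : Eu d → ℝ≥0∞} {c : Eu d} {R : ℝ} {w : Eu d → ℝ}
    (hΩ : ConeRegion Ω e) (h : SubSol C₀ P Ω c R w) {a b : ℝ} (ha : 0 ≤ a) (hab : a < b)
    (hb : b ≤ R) {k k' : ℝ} (hk : 0 ≤ k) (hkk : k < k') {t : ℝ} (ht : 0 < t)
    (hY : 4 * ∫⁻ x in Ω ∩ ball c b, ‖max (w x - k) 0‖ₑ ^ 2
      ≤ ENNReal.ofReal ((k' - k) ^ 2) * volume (ball (0 : Eu d) t)) :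
    ∫⁻ x in Ω ∩ ball c a, ‖max (w x - k') 0‖ₑ ^ 2
      ≤ 2 * (ENNReal.ofReal (t * (‖e‖ + 1)) ^ 2 * (C₀ * (ENNReal.ofReal (cutoffConst / (b - a)) ^ 2
        * ∫⁻ x in Ω ∩ ball c b, ‖max (w x - k) 0‖ₑ ^ 2))) := by
  obtain ⟨η, hη⟩ := exists_isCutoff c ha hab
  obtain ⟨Q, hQ, hle⟩ := h.cacc k' (hk.trans hkk.le) η hη.contDiff hη.compact
    (hη.tsupport_subset.trans (ball_subset_ball hb))
  have hmon : ∀ x, ‖max (w x - k') 0‖ₑ ≤ ‖max (w x - k) 0‖ₑ := fun x => by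
    rw [Real.enorm_of_nonneg (le_max_right _ _), Real.enorm_of_nonneg (le_max_right _ _)]
    gcongr
  have hη0 : ∀ x, x ∉ ball c b → η x = 0 := fun x hx =>
    image_eq_zero_of_notMem_tsupport fun h => hx (hη.tsupport_subset h)
  have hnash := hQ.nash hΩ (c := c) (r := b)
    (fun x _ hx => by rw [hη0 x fun h => hx (ball_subset_closedBall h), zero_mul]) ht ?_
  · calc ∫⁻ x in Ω ∩ ball c a, ‖max (w x - k') 0‖ₑ ^ 2
        = ∫⁻ x in Ω ∩ ball c a, ‖η x * max (w x - k') 0‖ₑ ^ 2 :=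
          setLIntegral_congr_fun (hΩ.isOpen.measurableSet.inter measurableSet_ball) fun x hx => by
            simp only [hη.eq_one x hx.2, one_mul]
      _ ≤ ∫⁻ x in Ω, ‖η x * max (w x - k') 0‖ₑ ^ 2 := lintegral_mono_set Set.inter_subset_left
      _ ≤ _ := hnash
      _ ≤ _ := by
        gcongr
        refine (le_self_add.trans hle).trans ?_
        gcongr
        refine (hη.lintegral_mul_gradient_le _).trans ?_
        gcongr
        exact hmon _
  · have hm : AEMeasurable (fun x => ‖max (w x - k) 0‖ₑ ^ 2) (volume.restrict (Ω ∩ ball c b)) := by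
      have h1 : AEMeasurable w (volume.restrict (Ω ∩ ball c b)) := (h.memLp.1.mono_measure
        (Measure.restrict_mono (Set.inter_subset_inter_right _ (ball_subset_ball hb))
          le_rfl)).aemeasurable
      exact (((h1.sub_const k).max aemeasurable_const).enorm.pow_const 2)
    have hε0 : ENNReal.ofReal ((k' - k) ^ 2) ≠ 0 := by
      rw [Ne, ENNReal.ofReal_eq_zero, not_le]
      have : 0 < k' - k := by linarith
      positivity
    have hch := mul_meas_ge_le_lintegral₀ hm (ENNReal.ofReal ((k' - k) ^ 2))
    have hsub : volume {x | x ∈ Ω ∧ η x * max (w x - k') 0 ≠ 0}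
        ≤ (volume.restrict (Ω ∩ ball c b)) {x | ENNReal.ofReal ((k' - k) ^ 2)
          ≤ ‖max (w x - k) 0‖ₑ ^ 2} := by
      refine le_trans (measure_mono ?_) (Measure.le_restrict_apply _ _)
      rintro x ⟨hx, hne⟩
      refine ⟨?_, hx, ?_⟩
      · have h1 : max (w x - k') 0 ≠ 0 := right_ne_zero_of_mul hne
        have h2 : 0 < w x - k' := by
          by_contra hn
          exact h1 (max_eq_right (not_lt.1 hn))
        rw [Set.mem_ofPred_eq, Real.enorm_of_nonneg (le_max_right _ _),
          ← ENNReal.ofReal_pow (le_max_right _ _), max_eq_left (by linarith)]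
        refine ENNReal.ofReal_le_ofReal ?_
        have : 0 < k' - k := by linarith
        gcongr
        linarith
      · by_contra hn
        exact hne (by rw [hη0 x hn, zero_mul])
    rw [← ENNReal.mul_le_mul_iff_right hε0 ENNReal.ofReal_ne_top]
    refine le_trans ?_ hY
    rw [mul_left_comm]
    gcongr
    exact (mul_le_mul_right hsub _).trans hch

/-- De Giorgi's local boundedness estimate. -/
lemma SubSol.ae_le {c₀ : ℝ} {P : Eu d → ℝ≥0∞} {c : Eu d} {R : ℝ} {w : Eu d → ℝ}
    (hΩ : ConeRegion Ω e) (hc₀ : 0 ≤ c₀) (h : SubSol (ENNReal.ofReal c₀) P Ω c R w) (hR : 0 < R)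
    {τ κ : ℝ} (hτ : 0 < τ) (hκ : 0 < κ)
    (hτe : 32 * τ ^ 2 * (‖e‖ + 1) ^ 2 * c₀ * cutoffConst ^ 2 ≤ (1 / 2) ^ (d + 2))
    (hY : 16 * ∫⁻ x in Ω ∩ ball c R, ‖w x‖ₑ ^ 2
      ≤ ENNReal.ofReal (κ ^ 2) * volume (ball (0 : Eu d) (τ * R))) :
    ∀ᵐ x ∂(volume.restrict (Ω ∩ ball c (R / 2))), w x ≤ κ := by
  -- Radii decrease from `R` to `R / 2`, levels increase from `0` to `κ`, and the Nash inequality is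
  -- used at the scale `τ R 2^{-j}`.
  obtain ⟨Y, hYdef⟩ : ∃ Y : ℕ → ℝ≥0∞, Y = fun j =>
      ∫⁻ x in Ω ∩ ball c (R * (1 / 2 + (1 / 2) ^ (j + 1))), ‖max (w x - κ * (1 - (1 / 2) ^ j)) 0‖ₑ ^ 2 :=
    ⟨_, rfl⟩
  have hp : ∀ j : ℕ, 0 < ((1 : ℝ) / 2) ^ j := fun j => by positivity
  have hp1 : ∀ j : ℕ, ((1 : ℝ) / 2) ^ j ≤ 1 := fun j => pow_le_one₀ (by norm_num) (by norm_num)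
  have hY0 : Y 0 = ∫⁻ x in Ω ∩ ball c R, ‖w x‖ₑ ^ 2 := by
    have h1 : R * (1 / 2 + (1 / 2) ^ (0 + 1)) = R := by norm_num
    rw [hYdef]
    simp only [h1, pow_zero, sub_self, mul_zero, sub_zero, max_eq_left (h.nonneg _)]
  have hY0t : Y 0 ≠ ⊤ := by
    rw [hY0]
    exact (lintegral_enorm_sq_lt_top h.memLp).ne
  have hvol : ∀ s : ℝ, 0 < s → volume (ball (0 : Eu d) (τ * R * s))
      = ENNReal.ofReal (s ^ d) * volume (ball (0 : Eu d) (τ * R)) := fun s hs => by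
    rw [mul_comm, Measure.addHaar_ball_mul_of_pos _ _ hs, finrank_euclideanSpace_fin]
  -- Both `t` and the gap of the radii are proportional to `R 2^{-j}`, so `j` cancels in the gain
  -- and `hτe` gives the fixed ratio `2^{-(d+2)}`. This exponent is what the induction needs: `d`
  -- for the volume of the ball of radius `τ R 2^{-j}`, and `2` for `(k' - k)² = κ² 4^{-j} / 4`. The
  -- `16` in `hY` is the `4` required by `SubSol.step` times this other `4`.
  have main : ∀ j, Y j ≤ ENNReal.ofReal (((1 / 2) ^ (d + 2)) ^ j) * Y 0 := by
    intro j
    induction j with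
    | zero => simp
    | succ j ih =>
      have hs := h.step hΩ (a := R * (1 / 2 + (1 / 2) ^ (j + 1 + 1)))
        (b := R * (1 / 2 + (1 / 2) ^ (j + 1))) (by positivity)
        (by
          have := hp j
          rw [pow_succ _ (j + 1), pow_succ _ j]
          nlinarith)
        (by
          have := hp1 j
          rw [pow_succ _ j]
          nlinarith)
        (k := κ * (1 - (1 / 2) ^ j)) (k' := κ * (1 - (1 / 2) ^ (j + 1)))
        (mul_nonneg hκ.le (by linarith [hp1 j]))
        (by
          have := hp j
          rw [pow_succ _ j]
          nlinarith)
        (t := τ * R * (1 / 2) ^ j) (by positivity) ?_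
      · have hYj : ∫⁻ x in Ω ∩ ball c (R * (1 / 2 + (1 / 2) ^ (j + 1))),
          ‖max (w x - κ * (1 - (1 / 2) ^ j)) 0‖ₑ ^ 2 = Y j := by rw [hYdef]
        have hYj1 : ∫⁻ x in Ω ∩ ball c (R * (1 / 2 + (1 / 2) ^ (j + 1 + 1))),
          ‖max (w x - κ * (1 - (1 / 2) ^ (j + 1))) 0‖ₑ ^ 2 = Y (j + 1) := by rw [hYdef]
        rw [hYj, hYj1] at hs
        have hq : 2 * ENNReal.ofReal (τ * R * (1 / 2) ^ j * (‖e‖ + 1)) ^ 2 * ENNReal.ofReal c₀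
            * ENNReal.ofReal (cutoffConst / (R * (1 / 2 + (1 / 2) ^ (j + 1))
              - R * (1 / 2 + (1 / 2) ^ (j + 1 + 1)))) ^ 2
            ≤ ENNReal.ofReal ((1 / 2) ^ (d + 2)) := by
          have e1 : R * (1 / 2 + (1 / 2) ^ (j + 1)) - R * (1 / 2 + (1 / 2) ^ (j + 1 + 1))
              = R * (1 / 2) ^ j / 4 := by ring
          have hL := cutoffConst_pos
          have hj := hp j
          have hK0 : 0 ≤ ‖e‖ + 1 := by positivity
          rw [e1]
          generalize ‖e‖ + 1 = K at hτe hK0 ⊢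
          rw [show (2 : ℝ≥0∞) = ENNReal.ofReal 2 by simp, ← ENNReal.ofReal_pow (by positivity),
            ← ENNReal.ofReal_pow (by positivity), ← ENNReal.ofReal_mul (by positivity),
            ← ENNReal.ofReal_mul (by positivity), ← ENNReal.ofReal_mul (by positivity)]
          refine ENNReal.ofReal_le_ofReal (le_trans (le_of_eq ?_) hτe)
          field_simp
          ring
        calc Y (j + 1) ≤ _ := hs
          _ = 2 * ENNReal.ofReal (τ * R * (1 / 2) ^ j * (‖e‖ + 1)) ^ 2 * ENNReal.ofReal c₀
            * ENNReal.ofReal (cutoffConst / (R * (1 / 2 + (1 / 2) ^ (j + 1))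
              - R * (1 / 2 + (1 / 2) ^ (j + 1 + 1)))) ^ 2 * Y j := by ring
          _ ≤ ENNReal.ofReal ((1 / 2) ^ (d + 2))
              * (ENNReal.ofReal (((1 / 2) ^ (d + 2)) ^ j) * Y 0) := mul_le_mul' hq ih
          _ = _ := by
            rw [← mul_assoc, ← ENNReal.ofReal_mul (by positivity), pow_succ' _ j]
      · have hYj : ∫⁻ x in Ω ∩ ball c (R * (1 / 2 + (1 / 2) ^ (j + 1))),
          ‖max (w x - κ * (1 - (1 / 2) ^ j)) 0‖ₑ ^ 2 = Y j := by rw [hYdef]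
        rw [hYj, hvol _ (hp j)]
        rw [← hY0] at hY
        have e2 : (κ * (1 - (1 / 2) ^ (j + 1)) - κ * (1 - (1 / 2) ^ j)) ^ 2
            = κ ^ 2 * (1 / 4 * ((1 / 2) ^ j) ^ 2) := by ring
        rw [e2, ENNReal.ofReal_mul (sq_nonneg _)]
        calc 4 * Y j ≤ 4 * (ENNReal.ofReal (((1 / 2) ^ (d + 2)) ^ j) * Y 0) := by gcongr
          _ = ENNReal.ofReal (1 / 4 * ((1 / 2) ^ (d + 2)) ^ j) * (16 * Y 0) := by
            rw [ENNReal.ofReal_mul (by norm_num), show (16 : ℝ≥0∞) = 4 * 4 by norm_num]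
            have : ENNReal.ofReal (1 / 4) * 4 = 1 := by
              rw [show (4 : ℝ≥0∞) = ENNReal.ofReal 4 by simp, ← ENNReal.ofReal_mul (by norm_num)]
              norm_num
            calc _ = 1 * (4 * (ENNReal.ofReal (((1 / 2) ^ (d + 2)) ^ j) * Y 0)) := (one_mul _).symm
              _ = _ := by
                rw [← this]
                ring
          _ ≤ ENNReal.ofReal (1 / 4 * ((1 / 2) ^ (d + 2)) ^ j)
              * (ENNReal.ofReal (κ ^ 2) * volume (ball (0 : Eu d) (τ * R))) := by gcongr
          _ = _ := by
            rw [show (1 : ℝ) / 4 * ((1 / 2) ^ (d + 2)) ^ j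
              = 1 / 4 * ((1 / 2) ^ j) ^ 2 * ((1 / 2) ^ j) ^ d by
                rw [← pow_mul, ← pow_mul, ← pow_mul, mul_assoc, ← pow_add]
                congr 2
                ring,
              ENNReal.ofReal_mul (by positivity)]
            ring
  have hlim : Tendsto (fun j => ENNReal.ofReal (((1 / 2) ^ (d + 2)) ^ j) * Y 0) atTop (𝓝 0) := by
    have h1 : Tendsto (fun j => (((1 : ℝ) / 2) ^ (d + 2)) ^ j) atTop (𝓝 0) :=
      tendsto_pow_atTop_nhds_zero_of_lt_one (by positivity)
        (pow_lt_one₀ (by norm_num) (by norm_num) (by omega))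
    have h2 := ENNReal.Tendsto.mul_const (ENNReal.tendsto_ofReal h1) (Or.inr hY0t)
    simpa using h2
  have hzero : ∫⁻ x in Ω ∩ ball c (R / 2), ‖max (w x - κ) 0‖ₑ ^ 2 = 0 := by
    refine le_antisymm (ge_of_tendsto' hlim fun j => le_trans ?_ (main j)) bot_le
    rw [hYdef]
    refine lintegral_mono' (Measure.restrict_mono (Set.inter_subset_inter_right _
      (ball_subset_ball ?_)) le_rfl) fun x => ?_
    · have := hp (j + 1)
      nlinarith
    · dsimp only
      gcongr
      rw [Real.enorm_of_nonneg (le_max_right _ _), Real.enorm_of_nonneg (le_max_right _ _)]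
      have := hp j
      gcongr
      nlinarith
  have hm : AEMeasurable (fun x => ‖max (w x - κ) 0‖ₑ ^ 2)
      (volume.restrict (Ω ∩ ball c (R / 2))) := by
    have h1 : AEMeasurable w (volume.restrict (Ω ∩ ball c (R / 2))) := (h.memLp.1.mono_measure
      (Measure.restrict_mono (Set.inter_subset_inter_right _ (ball_subset_ball (by linarith)))
        le_rfl)).aemeasurable
    exact (((h1.sub_const κ).max aemeasurable_const).enorm.pow_const 2)
  rw [lintegral_eq_zero_iff' hm] at hzero
  filter_upwards [hzero] with x hx
  simp only [Pi.zero_apply, ne_eq, OfNat.ofNat_ne_zero, not_false_eq_true, pow_eq_zero_iff,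
    enorm_eq_zero] at hx
  have := le_max_left (w x - κ) 0
  linarith

end DeGiorgi

/-! ### Potentials of class `B_∞`: doubling, mass bounds and the maximal function. -/

section Potential
variable {d : ℕ} {C : ℝ} {P : Eu d → ℝ≥0∞}

/-- A measurable potential in the reverse Hölder class `B_∞`. -/
structure IsPotential (C : ℝ) (P : Eu d → ℝ≥0∞) : Prop where
  measurable : Measurable P
  pos : ∀ᵐ x, 0 < P x
  finite : ∀ (x : Eu d) (r : ℝ), ∫⁻ z in ball x r, P z ≠ ⊤
  reverse : ∀ (x : Eu d) (r : ℝ), 0 < r → ∀ᵐ z ∂(volume.restrict (ball x r)),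
    volume (ball x r) * P z ≤ ENNReal.ofReal C * ∫⁻ z in ball x r, P z

/-- The measure with density `P` is doubling. -/
def IsDoubling (D : ℝ) (P : Eu d → ℝ≥0∞) : Prop := ∀ (i : ℕ) (x : Eu d) (r : ℝ), 0 < r →
  ∫⁻ z in ball x (2 ^ i * r), P z ≤ ENNReal.ofReal (D ^ i) * ∫⁻ z in ball x r, P z

lemma IsBInfty.aestronglyMeasurable {V : Eu d → ℝ} (hV : IsBInfty C V) :
    AEStronglyMeasurable V volume := by
  have h : AEStronglyMeasurable V
      (volume.restrict (⋃ n : ℕ, ball (0 : Eu d) (n + 1))) :=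
    aestronglyMeasurable_iUnion_iff.2 fun n => (hV.locBounded 0 (n + 1) (by positivity)).1
  have hU : (⋃ n : ℕ, ball (0 : Eu d) (n + 1)) = Set.univ := by
    refine Set.eq_univ_of_forall fun x => Set.mem_iUnion.2 ?_
    obtain ⟨n, hn⟩ := exists_nat_gt ‖x‖
    exact ⟨n, by rw [mem_ball_zero_iff]; linarith⟩
  rwa [hU, Measure.restrict_univ] at h

/-- A Borel representative with values in `[0, ∞]` removes integrability questions from the mass
estimates. The constant is raised to at least `1`, as they assume. -/
lemma IsBInfty.exists_potential {V : Eu d → ℝ} (hV : IsBInfty C V) :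
    ∃ P : Eu d → ℝ≥0∞, (∀ᵐ x, P x = ENNReal.ofReal (V x)) ∧ IsPotential (max C 1) P := by
  have hm := hV.aestronglyMeasurable.aemeasurable
  have hae : ∀ᵐ x, ENNReal.ofReal (hm.mk V x) = ENNReal.ofReal (V x) := by
    filter_upwards [hm.ae_eq_mk] with x hx
    rw [hx]
  have hint : ∀ x r, 0 < r → IntegrableOn V (ball x r) := fun x r hr =>
    haveI : IsFiniteMeasure (volume.restrict (ball x r)) :=
      ⟨by rw [Measure.restrict_apply_univ]; exact measure_ball_lt_top⟩
    (hV.locBounded x r hr).integrable le_top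
  have hof : ∀ x r, 0 < r → ∫⁻ z in ball x r, ENNReal.ofReal (hm.mk V z)
      = ENNReal.ofReal (∫ z in ball x r, V z) := fun x r hr => by
    rw [ofReal_integral_eq_lintegral_ofReal (hint x r hr)
      (ae_restrict_of_ae (hV.pos.mono fun x hx => hx.le))]
    exact lintegral_congr_ae (ae_restrict_of_ae hae)
  refine ⟨fun x => ENNReal.ofReal (hm.mk V x), hae, ?_, ?_, fun x r => ?_, fun x r hr => ?_⟩
  · exact hm.measurable_mk.ennreal_ofReal
  · filter_upwards [hae, hV.pos] with x h1 h2
    rw [h1]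
    exact ENNReal.ofReal_pos.2 h2
  · rcases le_or_gt r 0 with h | h
    · simp [ball_eq_empty.2 h]
    · rw [hof x r h]
      exact ENNReal.ofReal_ne_top
  · rw [hof x r hr, ← ENNReal.ofReal_mul (by positivity)]
    have hB0 : volume (ball x r) ≠ 0 := (measure_ball_pos _ _ hr).ne'
    have hBt : volume (ball x r) ≠ ⊤ := measure_ball_lt_top.ne
    have hVB : 0 ≤ ∫ z in ball x r, V z :=
      integral_nonneg_of_ae (ae_restrict_of_ae (hV.pos.mono fun x hx => hx.le))
    have hle := hV.reverse x r hr
    rw [eLpNorm_exponent_top] at hle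
    filter_upwards [ae_le_eLpNormEssSup (f := V) (μ := volume.restrict (ball x r)),
      ae_restrict_of_ae hae] with z h1 h2
    rw [h2]
    calc volume (ball x r) * ENNReal.ofReal (V z)
        ≤ volume (ball x r) * ‖V z‖ₑ := by
          gcongr
          rw [← ofReal_norm]
          exact ENNReal.ofReal_le_ofReal (le_abs_self _)
      _ ≤ volume (ball x r) * ENNReal.ofReal (C * ⨍ y in ball x r, V y) := by
          gcongr
          exact h1.trans hle
      _ = ENNReal.ofReal (volume.real (ball x r) * (C * ⨍ y in ball x r, V y)) := by
          rw [ENNReal.ofReal_mul measureReal_nonneg, ofReal_measureReal hBt]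
      _ = ENNReal.ofReal (C * ∫ z in ball x r, V z) := by
          rw [setAverage_eq, smul_eq_mul]
          have : volume.real (ball x r) ≠ 0 := by
            rw [Measure.real, ENNReal.toReal_ne_zero]
            exact ⟨hB0, hBt⟩
          field_simp
      _ ≤ _ := ENNReal.ofReal_le_ofReal (by gcongr; exact le_max_left _ _)

lemma IsPotential.lintegral_le (hP : IsPotential C P) {x : Eu d} {r : ℝ} (hr : 0 < r)
    {E : Set (Eu d)} (hE : E ⊆ ball x r) :
    volume (ball x r) * ∫⁻ z in E, P z
      ≤ ENNReal.ofReal C * (volume E * ∫⁻ z in ball x r, P z) := by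
  rw [← lintegral_const_mul' _ _ measure_ball_lt_top.ne]
  calc ∫⁻ z in E, volume (ball x r) * P z
      ≤ ∫⁻ z in E, ENNReal.ofReal C * ∫⁻ z in ball x r, P z :=
        lintegral_mono_ae (ae_restrict_of_ae_restrict_of_subset hE (hP.reverse x r hr))
    _ = _ := by
      rw [setLIntegral_const]
      ring

lemma volume_ball_scale (x : Eu d) {s : ℝ} (hs : 0 < s) (r : ℝ) :
    volume (ball x (s * r)) = ENNReal.ofReal (s ^ d) * volume (ball x r) := by
  rw [Measure.addHaar_ball_mul_of_pos _ _ hs, finrank_euclideanSpace_fin,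
    Measure.addHaar_ball_center volume x r]

lemma IsPotential.scale_le (hP : IsPotential C P) (hC : 0 ≤ C) (x : Eu d) {r s : ℝ} (hr : 0 < r)
    (hs : 0 < s)
    (hs1 : s ≤ 1) :
    ∫⁻ z in ball x (s * r), P z ≤ ENNReal.ofReal (C * s ^ d) * ∫⁻ z in ball x r, P z := by
  have hB0 : volume (ball x r) ≠ 0 := (measure_ball_pos _ _ hr).ne'
  have hBt : volume (ball x r) ≠ ⊤ := measure_ball_lt_top.ne
  have h := hP.lintegral_le hr (ball_subset_ball (x := x) (by nlinarith : s * r ≤ r))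
  rw [volume_ball_scale x hs] at h
  rw [← ENNReal.mul_le_mul_iff_right hB0 hBt]
  refine h.trans (le_of_eq ?_)
  rw [ENNReal.ofReal_mul hC]
  ring

/-- The `B_∞` bound turns fractions of volume into fractions of mass up to the factor `C`. The
annulus has volume fraction `1 - s ^ d`, hence at most half of the mass. -/
lemma IsPotential.annulus_le (hP : IsPotential C P) (hC : 0 ≤ C) {s : ℝ} (hs : 0 < s) (hs1 : s ≤ 1)
    (hCs : C * (1 - s ^ d) ≤ 1 / 2) (x : Eu d) {r : ℝ} (hr : 0 < r) :
    ∫⁻ z in ball x r, P z ≤ 2 * ∫⁻ z in ball x (s * r), P z := by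
  have hB0 : volume (ball x r) ≠ 0 := (measure_ball_pos _ _ hr).ne'
  have hBt : volume (ball x r) ≠ ⊤ := measure_ball_lt_top.ne
  have hsub : ball x (s * r) ⊆ ball x r := ball_subset_ball (by nlinarith)
  have hvol : volume (ball x r \ ball x (s * r))
      = ENNReal.ofReal (1 - s ^ d) * volume (ball x r) := by
    rw [measure_sdiff hsub measurableSet_ball.nullMeasurableSet
      measure_ball_lt_top.ne, volume_ball_scale x hs, ENNReal.ofReal_sub _ (by positivity),
      ENNReal.sub_mul (fun _ _ => hBt), ENNReal.ofReal_one, one_mul]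
  have h1 := hP.lintegral_le hr (Set.sdiff_subset : ball x r \ ball x (s * r) ⊆ ball x r)
  rw [hvol] at h1
  have h2 : ∫⁻ z in ball x r \ ball x (s * r), P z
      ≤ ENNReal.ofReal (1 / 2) * ∫⁻ z in ball x r, P z := by
    rw [← ENNReal.mul_le_mul_iff_right hB0 hBt]
    refine (h1.trans (le_of_eq ?_)).trans (mul_le_mul_right (mul_le_mul_left
      (ENNReal.ofReal_le_ofReal hCs) _) _)
    rw [ENNReal.ofReal_mul hC]
    ring
  have h3 : ∫⁻ z in ball x r, P z = (∫⁻ z in ball x (s * r), P z)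
      + ∫⁻ z in ball x r \ ball x (s * r), P z := by
    rw [← lintegral_inter_add_sdiff P (ball x r) (measurableSet_ball (x := x) (ε := s * r)),
      Set.inter_eq_right.2 hsub]
  set X := ∫⁻ z in ball x r, P z with hX
  have hXt : X ≠ ⊤ := hP.finite x r
  have h4 : X + X ≤ 2 * (∫⁻ z in ball x (s * r), P z) + X := by
    calc X + X = 2 * X := (two_mul X).symm
      _ ≤ 2 * ((∫⁻ z in ball x (s * r), P z) + ENNReal.ofReal (1 / 2) * X) := by
        gcongr
        conv_lhs => rw [h3]
        gcongr
      _ = 2 * (∫⁻ z in ball x (s * r), P z) + (2 * ENNReal.ofReal (1 / 2)) * X := by ring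
      _ = _ := by
        have : (2 : ℝ≥0∞) * ENNReal.ofReal (1 / 2) = 1 := by
          rw [show (2 : ℝ≥0∞) = ENNReal.ofReal 2 by simp, ← ENNReal.ofReal_mul (by norm_num)]
          norm_num
        rw [this, one_mul]
  exact (ENNReal.add_le_add_iff_right hXt).1 h4

/-- Potentials of class `B_∞` are doubling. -/
lemma exists_doubling (d : ℕ) {C : ℝ} (hC : 1 ≤ C) : ∃ D : ℝ, 2 ≤ D ∧
    ∀ P : Eu d → ℝ≥0∞, IsPotential C P → IsDoubling D P := by
  -- Shrinking the radius by a factor `s` close to `1` loses at most half of the mass; `N + 1` such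
  -- steps shrink it by more than `2`, so the doubling constant is `2 ^ (N + 1)`.
  obtain ⟨s, hs0, hs1, hsC⟩ : ∃ s : ℝ, 0 < s ∧ s < 1 ∧ C * (1 - s ^ d) ≤ 1 / 2 := by
    have hcont : Tendsto (fun s : ℝ => C * (1 - s ^ d)) (𝓝 1) (𝓝 (C * (1 - 1 ^ d))) :=
      Continuous.tendsto (by fun_prop) 1
    rw [one_pow, sub_self, mul_zero] at hcont
    have h1 := (hcont.eventually_le_const (by norm_num : (0 : ℝ) < 1 / 2)).filter_mono
      (nhdsWithin_le_nhds (s := Set.Iio 1))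
    have h2 : ∀ᶠ s : ℝ in 𝓝[<] 1, 0 < s :=
      (eventually_gt_nhds one_pos).filter_mono nhdsWithin_le_nhds
    obtain ⟨s, hs⟩ := (h1.and (h2.and (eventually_mem_nhdsWithin (s := Set.Iio (1 : ℝ))))).exists
    exact ⟨s, hs.2.1, hs.2.2, hs.1⟩
  obtain ⟨N, hN⟩ := exists_pow_lt_of_lt_one (by norm_num : (0 : ℝ) < 1 / 2) hs1
  refine ⟨2 ^ (N + 1), ?_, fun P hP => ?_⟩
  · rw [pow_succ]
    have := one_le_pow₀ (one_le_two : (1 : ℝ) ≤ 2) (n := N)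
    linarith
  have hN' : ∀ (m : ℕ) (x : Eu d) (r : ℝ), 0 < r →
      ∫⁻ z in ball x r, P z ≤ ENNReal.ofReal (2 ^ m) * ∫⁻ z in ball x (s ^ m * r), P z := by
    intro m
    induction m with
    | zero => intro x r _; simp
    | succ m ih =>
      intro x r hr
      refine (ih x r hr).trans ?_
      rw [pow_succ, pow_succ' s, ENNReal.ofReal_mul (by positivity), mul_assoc, mul_assoc s]
      gcongr
      refine (hP.annulus_le (by linarith) hs0 hs1.le hsC x (by positivity)).trans (le_of_eq ?_)
      simp
  have hhalf : ∀ (x : Eu d) (r : ℝ), 0 < r →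
      ∫⁻ z in ball x (2 * r), P z ≤ ENNReal.ofReal (2 ^ (N + 1)) * ∫⁻ z in ball x r, P z := by
    intro x r hr
    refine (hN' (N + 1) x (2 * r) (by positivity)).trans ?_
    refine mul_le_mul_right (lintegral_mono_set (ball_subset_ball ?_)) _
    have : s ^ (N + 1) ≤ 1 / 2 := by
      rw [pow_succ]
      have := pow_pos hs0 N
      nlinarith
    nlinarith
  intro i
  induction i with
  | zero => intro x r _; simp
  | succ i ih =>
    intro x r hr
    have h1 := hhalf x (2 ^ i * r) (by positivity)
    rw [← mul_assoc, ← pow_succ'] at h1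
    refine h1.trans ?_
    rw [pow_succ' _ i, ENNReal.ofReal_mul (by positivity), mul_assoc]
    gcongr
    exact ih x r hr

/-- Lower bound for the mass of a ball in terms of the maximal function. -/
lemma IsPotential.le_mass {D : ℝ} (hd : 2 ≤ d) (hC : 1 ≤ C) (hP : IsPotential C P) (hD : 2 ≤ D)
    (hPD : IsDoubling D P)
    {V : Eu d → ℝ} (hVP : ∀ᵐ x, P x = ENNReal.ofReal (V x)) (hV0 : ∀ᵐ x, 0 < V x) (y : Eu d) {R : ℝ}
    (hR : 0 < R) (h1 : 1 ≤ R * fpsMax V y) :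
    ENNReal.ofReal ((D * C)⁻¹ * ((R * fpsMax V y) ^ 2 * R ^ (d - 2))) ≤ ∫⁻ z in ball y R, P z := by
  obtain ⟨m, hm⟩ : ∃ m, m = fpsMax V y := ⟨_, rfl⟩
  rw [← hm] at h1 ⊢
  have hm0 : 0 < m := pos_of_mul_pos_right (by linarith) hR.le
  have hr0 : 0 < 2 / m := by positivity
  -- If `ψ(y, 2 / m) ≤ 1`, then `m / 2` would compete in the infimum defining `m`. The factor `2`
  -- avoids asking whether the infimum is attained.
  have hψ : 1 < psi V y (2 / m) := by
    by_contra hn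
    rw [not_lt] at hn
    have hmem : m / 2 ∈ {s : ℝ | ∃ r : ℝ, 0 < r ∧ psi V y r ≤ 1 ∧ s = 1 / r} :=
      ⟨2 / m, hr0, hn, by rw [one_div_div]⟩
    have hb : BddBelow {s : ℝ | ∃ r : ℝ, 0 < r ∧ psi V y r ≤ 1 ∧ s = 1 / r} := by
      refine ⟨0, ?_⟩
      rintro s ⟨r, hr, _, rfl⟩
      positivity
    have := csInf_le hb hmem
    rw [fpsMax] at hm
    rw [← hm] at this
    linarith
  have hmass : ENNReal.ofReal ((2 / m) ^ (d - 2)) ≤ ∫⁻ z in ball y (2 / m), P z := by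
    have e1 : ∫⁻ z in ball y (2 / m), P z = ENNReal.ofReal (∫ z in ball y (2 / m), V z) := by
      have hint : IntegrableOn V (ball y (2 / m)) := by
        -- If `V` were not integrable on this ball, its integral would be `0` by convention,
        -- contrary to `ψ > 1`.
        by_contra hn
        rw [psi, integral_undef hn, mul_zero] at hψ
        linarith
      rw [ofReal_integral_eq_lintegral_ofReal hint
        (ae_restrict_of_ae (hV0.mono fun x hx => hx.le))]
      exact lintegral_congr_ae (ae_restrict_of_ae hVP)
    rw [e1]
    refine ENNReal.ofReal_le_ofReal ?_
    rw [psi, one_div_mul_eq_div, one_lt_div (by positivity)] at hψ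
    exact hψ.le
  -- From radius `2 / m` to radius `2 R` the mass grows at least by `(R m)^d / C`; one doubling
  -- returns to `R`. Comparing with `2 R` leaves room for `R m ≥ 1` only.
  have hs : 0 < (R * m)⁻¹ := by positivity
  have h2 := hP.scale_le (by linarith) y (r := 2 * R) (by positivity) hs
    (inv_le_one_of_one_le₀ h1)
  rw [show (R * m)⁻¹ * (2 * R) = 2 / m by field_simp] at h2
  have h3 := hPD 1 y R hR
  rw [pow_one, pow_one] at h3
  have h4 := (hmass.trans h2).trans (mul_le_mul_right h3 _)
  rw [← mul_assoc, ← ENNReal.ofReal_mul (by positivity)] at h4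
  have h5 : 0 < C * (R * m)⁻¹ ^ d * D := by positivity
  calc ENNReal.ofReal ((D * C)⁻¹ * ((R * m) ^ 2 * R ^ (d - 2)))
      ≤ ENNReal.ofReal ((C * (R * m)⁻¹ ^ d * D)⁻¹ * (2 / m) ^ (d - 2)) := by
        refine ENNReal.ofReal_le_ofReal ?_
        obtain ⟨n, rfl⟩ := Nat.exists_eq_add_of_le hd
        rw [Nat.add_sub_cancel_left, div_pow]
        have : (1 : ℝ) ≤ 2 ^ n := one_le_pow₀ one_le_two
        have e2 : (C * (R * m)⁻¹ ^ (2 + n) * D)⁻¹ * (2 ^ n / m ^ n)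
          = 2 ^ n * ((D * C)⁻¹ * ((R * m) ^ 2 * R ^ n)) := by
          rw [inv_pow, mul_pow R m (2 + n)]
          field_simp
          ring
        rw [e2]
        exact le_mul_of_one_le_left (by positivity) this
    _ ≤ ENNReal.ofReal ((C * (R * m)⁻¹ ^ d * D)⁻¹)
        * (ENNReal.ofReal (C * (R * m)⁻¹ ^ d * D) * ∫⁻ z in ball y R, P z) := by
        rw [ENNReal.ofReal_mul (by positivity)]
        gcongr
    _ = _ := by
        rw [← mul_assoc, ← ENNReal.ofReal_mul (by positivity), inv_mul_cancel₀ h5.ne',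
          ENNReal.ofReal_one, one_mul]

/-- Mass of small nearby balls. -/
lemma mass_nearby_le {D : ℝ}
    (hPD : IsDoubling D P)
    {e : Eu d} {j : ℕ} (hj : 2 + ‖e‖ ≤ 2 ^ j) {y z : Eu d} {R : ℝ} (hR : 0 < R) (hz : z ∈ ball y R)
    (i : ℕ) {t : ℝ} (hi : 2 ^ i * t = R) :
    ∫⁻ x in ball y R, P x ≤ ENNReal.ofReal (D ^ (i + j)) * ∫⁻ x in ball (z + t • e) t, P x := by
  have ht : 0 < t := by
    have : (0 : ℝ) < 2 ^ i := by positivity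
    exact pos_of_mul_pos_right (by rw [hi]; exact hR) this.le
  have htR : t ≤ R := by
    have : (1 : ℝ) ≤ 2 ^ i := one_le_pow₀ one_le_two
    nlinarith
  refine le_trans (lintegral_mono_set ?_) (hPD (i + j) (z + t • e) t ht)
  have e1 : (2 : ℝ) ^ (i + j) * t = 2 ^ j * R := by rw [← hi]; ring
  rw [e1]
  refine ball_subset_ball' ?_
  have h1 : dist y (z + t • e) ≤ R + R * ‖e‖ := by
    rw [mem_ball, dist_comm] at hz
    calc dist y (z + t • e) ≤ dist y z + dist z (z + t • e) := dist_triangle _ _ _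
      _ ≤ R + R * ‖e‖ := by
        gcongr
        rw [dist_self_add_right, norm_smul, Real.norm_of_nonneg ht.le]
        gcongr
  nlinarith

lemma setLIntegral_ball_add (P : Eu d → ℝ≥0∞) (z a : Eu d) (t : ℝ) :
    ∫⁻ h in ball a t, P (z + h) = ∫⁻ x in ball (z + a) t, P x := by
  rw [← lintegral_indicator measurableSet_ball, ← lintegral_indicator measurableSet_ball,
    ← lintegral_add_left_eq_self ((ball (z + a) t).indicator P) z]
  congr 1
  ext1 h
  have : z + h ∈ ball (z + a) t ↔ h ∈ ball a t := by
    rw [mem_ball, mem_ball, dist_add_left]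
  by_cases hh : h ∈ ball a t
  · rw [Set.indicator_of_mem hh, Set.indicator_of_mem (this.2 hh)]
  · rw [Set.indicator_of_notMem hh, Set.indicator_of_notMem fun h' => hh (this.1 h')]

/-- Fefferman-Phong inequality with explicit scaling. -/
lemma IsPotential.feffermanPhong {Ω : Set (Eu d)} {e : Eu d} (hd : 2 ≤ d)
    (hΩ : ConeRegion Ω e) (hC : 1 ≤ C) (hP : IsPotential C P) {w : Eu d → ℝ} {H : Eu d → Eu d} (hw : MemW 2 Ω w H) {c : Eu d}
    {r : ℝ} (hsupp : ∀ x ∈ Ω, x ∉ closedBall c r → w x = 0) {t : ℝ} (ht : 0 < t) {S S' : Set (Eu d)}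
    (hS : ShiftPair e t S S') (hS'Ω : S' ⊆ Ω) (hSΩ : S ⊆ Ω) {c₀ : ℝ} (hc₀ : 0 < c₀)
    (hmass : ∀ z ∈ S, ENNReal.ofReal (c₀ * t ^ (d - 2)) ≤ ∫⁻ x in ball (z + t • e) t, P x) :
    ∫⁻ z in S, ‖w z‖ₑ ^ 2 ≤ ENNReal.ofReal
        ((2 * C * (‖e‖ + 1) ^ 2 + 2 * (c₀⁻¹ * volume.real (ball (0 : Eu d) 1))) * t ^ 2)
      * ((∫⁻ z in S', ‖H z‖ₑ ^ 2) + ∫⁻ z in S', P z * ‖w z‖ₑ ^ 2) := by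
  -- A mass of order `t^{d-2}` on a ball of volume of order `t^d` means that the potential is of
  -- size `t^{-2}` on average, so both terms carry the same factor `t²`.
  have hα : 0 < c₀ * t ^ (d - 2) := by positivity
  have h := hw.feffermanPhong hΩ hsupp ht hS hS'Ω hSΩ hP.measurable (C := ENNReal.ofReal C)
    (α := ENNReal.ofReal (c₀ * t ^ (d - 2))) (ENNReal.ofReal_pos.2 hα).ne' ENNReal.ofReal_ne_top
    (fun z hz => by rw [setLIntegral_ball_add]; exact hmass z hz)
    (fun z _ => by rw [setLIntegral_ball_add]; exact hP.finite _ _) (fun z _ => ?_)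
  · refine h.trans ?_
    set X := ∫⁻ z in S', ‖H z‖ₑ ^ 2
    set Y := ∫⁻ z in S', P z * ‖w z‖ₑ ^ 2
    have hv : volume (ball (0 : Eu d) t)
        = ENNReal.ofReal (t ^ d * volume.real (ball (0 : Eu d) 1)) := by
      rw [ENNReal.ofReal_mul (by positivity), ofReal_measureReal measure_ball_lt_top.ne,
        ← volume_ball_scale _ ht, mul_one]
    rw [hv, ← ENNReal.ofReal_inv_of_pos hα, ← ENNReal.ofReal_pow (by positivity)]
    have e1 : 2 * (ENNReal.ofReal C * (ENNReal.ofReal ((t * (‖e‖ + 1)) ^ 2) * X))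
        = ENNReal.ofReal (2 * C * (‖e‖ + 1) ^ 2 * t ^ 2) * X := by
      rw [show 2 * C * (‖e‖ + 1) ^ 2 * t ^ 2 = 2 * (C * (t * (‖e‖ + 1)) ^ 2) by ring,
        ENNReal.ofReal_mul zero_le_two, ENNReal.ofReal_mul (by positivity), ENNReal.ofReal_ofNat]
      ring
    have e2 : 2 * (ENNReal.ofReal ((c₀ * t ^ (d - 2))⁻¹)
          * (ENNReal.ofReal (t ^ d * volume.real (ball (0 : Eu d) 1)) * Y))
        = ENNReal.ofReal (2 * (c₀⁻¹ * volume.real (ball (0 : Eu d) 1)) * t ^ 2) * Y := by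
      have : 2 * (c₀⁻¹ * volume.real (ball (0 : Eu d) 1)) * t ^ 2
          = 2 * ((c₀ * t ^ (d - 2))⁻¹ * (t ^ d * volume.real (ball (0 : Eu d) 1))) := by
        obtain ⟨n, rfl⟩ := Nat.exists_eq_add_of_le hd
        rw [Nat.add_sub_cancel_left]
        field_simp
        ring
      rw [this, ENNReal.ofReal_mul zero_le_two, ENNReal.ofReal_mul (inv_nonneg.2 hα.le),
        ENNReal.ofReal_ofNat, mul_assoc, mul_assoc]
    rw [e1, e2, mul_add]
    have hv0 : 0 ≤ volume.real (ball (0 : Eu d) 1) := measureReal_nonneg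
    gcongr
    · refine le_add_of_nonneg_right (by positivity)
    · refine le_add_of_nonneg_left (by positivity)
  · rw [setLIntegral_ball_add]
    have h1 := hP.reverse (z + t • e) t ht
    rw [Measure.addHaar_ball_center] at h1
    rw [ae_restrict_iff' measurableSet_ball] at h1 ⊢
    have h2 := (measurePreserving_add_left volume z).quasiMeasurePreserving.ae h1
    filter_upwards [h2] with h hh hm
    refine hh ?_
    rwa [mem_ball, dist_add_left]

end Potential

/-! ### Decay of subsolutions at distances beyond the critical radius. -/

section Decay
variable {d : ℕ} {e : Eu d}

lemma ShiftPair.mono {t : ℝ} {S S' T : Set (Eu d)} (h : ShiftPair e t S S') (hT : MeasurableSet T)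
    (hTS : T ⊆ S) : ShiftPair e t T S' :=
  ⟨hT, h.meas', fun a ha z hz => h.shift a ha z (hTS hz)⟩

lemma volume_real_ball_pos (d : ℕ) : 0 < volume.real (ball (0 : Eu d) 1) := by
  rw [Measure.real, ENNReal.toReal_pos_iff]
  exact ⟨measure_ball_pos _ _ one_pos, measure_ball_lt_top⟩

/-- The local boundedness estimate with an unspecified constant. -/
lemma exists_sup_bound (e : Eu d) {c₀ : ℝ} (hc₀ : 0 < c₀) : ∃ K : ℝ, 0 < K ∧
    ∀ (Ω : Set (Eu d)), ConeRegion Ω e → ∀ (P : Eu d → ℝ≥0∞) (c : Eu d) (R : ℝ) (w : Eu d → ℝ),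
      0 < R → SubSol (ENNReal.ofReal c₀) P Ω c R w → ∀ κ : ℝ, 0 < κ →
      ENNReal.ofReal K * ∫⁻ x in Ω ∩ ball c R, ‖w x‖ₑ ^ 2 ≤ ENNReal.ofReal (κ ^ 2 * R ^ d) →
      ∀ᵐ x ∂(volume.restrict (Ω ∩ ball c (R / 2))), w x ≤ κ := by
  obtain ⟨B, hB⟩ : ∃ B, B = 32 * (‖e‖ + 1) ^ 2 * c₀ * cutoffConst ^ 2 := ⟨_, rfl⟩
  have hB0 : 0 < B := by
    have := cutoffConst_pos
    rw [hB]
    positivity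
  obtain ⟨τ, hτ, hτB⟩ : ∃ τ : ℝ, 0 < τ ∧ B * τ ^ 2 ≤ (1 / 2) ^ (d + 2) := by
    refine ⟨√((1 / 2) ^ (d + 2) / B), by positivity, ?_⟩
    rw [Real.sq_sqrt (by positivity), mul_div_cancel₀ _ hB0.ne']
  have hv := volume_real_ball_pos d
  obtain ⟨v, hv'⟩ : ∃ v, v = τ ^ d * volume.real (ball (0 : Eu d) 1) := ⟨_, rfl⟩
  have hv0 : 0 < v := by rw [hv']; positivity
  refine ⟨16 * v⁻¹, by positivity, fun Ω hΩ P c R w hR h κ hκ hle => ?_⟩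
  refine h.ae_le hΩ hc₀.le hR hτ hκ (le_trans (le_of_eq ?_) hτB) ?_
  · rw [hB]
    ring
  · have e1 : volume (ball (0 : Eu d) (τ * R)) = ENNReal.ofReal (v * R ^ d) := by
      rw [hv', show τ ^ d * volume.real (ball (0 : Eu d) 1) * R ^ d
        = (τ * R) ^ d * volume.real (ball (0 : Eu d) 1) by ring,
        ENNReal.ofReal_mul (by positivity), ofReal_measureReal measure_ball_lt_top.ne,
        ← volume_ball_scale _ (by positivity), mul_one]
    rw [e1, ← ENNReal.ofReal_mul (sq_nonneg _),
      show κ ^ 2 * (v * R ^ d) = v * (κ ^ 2 * R ^ d) by ring, ENNReal.ofReal_mul hv0.le]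
    refine le_trans (le_of_eq ?_) (mul_le_mul_right hle _)
    rw [← mul_assoc, ← ENNReal.ofReal_mul hv0.le, mul_left_comm, mul_inv_cancel₀ hv0.ne', mul_one,
      ENNReal.ofReal_ofNat]

/-- Fefferman-Phong at scale `t` for `η w`, then Caccioppoli across the annulus of width `b - a`:
the gain is of order `(t / (b - a))²`. -/
lemma SubSol.lintegral_le_of_mass {Ω : Set (Eu d)} {C c₀ c₁ : ℝ} {P : Eu d → ℝ≥0∞} {c : Eu d}
    {R : ℝ} {w : Eu d → ℝ} (hd : 2 ≤ d) (hΩ : ConeRegion Ω e) (hC : 1 ≤ C) (hP : IsPotential C P)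
    (hc₀ : 0 < c₀) (hc₁ : 0 < c₁) (h : SubSol (ENNReal.ofReal c₀) P Ω c R w) {a b t : ℝ}
    (ha : 0 ≤ a) (hab : a < b) (hb : b ≤ R) (ht : 0 < t)
    (hmass : ∀ z ∈ Ω ∩ ball c b,
      ENNReal.ofReal (c₁ * t ^ (d - 2)) ≤ ∫⁻ x in ball (z + t • e) t, P x) :
    ∫⁻ x in Ω ∩ ball c a, ‖w x‖ₑ ^ 2 ≤ ENNReal.ofReal
      ((2 * C * (‖e‖ + 1) ^ 2 + 2 * (c₁⁻¹ * volume.real (ball (0 : Eu d) 1))) * t ^ 2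
        * (c₀ * (cutoffConst / (b - a)) ^ 2)) * ∫⁻ x in Ω ∩ ball c b, ‖w x‖ₑ ^ 2 := by
  obtain ⟨η, hη⟩ := exists_isCutoff c ha hab
  obtain ⟨Q, hQ, hle⟩ := h.cacc 0 le_rfl η hη.contDiff hη.compact
    (hη.tsupport_subset.trans (ball_subset_ball hb))
  have hw0 : ∀ x, max (w x - 0) 0 = w x := fun x => by
    rw [sub_zero, max_eq_left (h.nonneg x)]
  simp only [hw0] at hQ hle
  have hη0 : ∀ x, x ∉ ball c b → η x = 0 := fun x hx =>
    image_eq_zero_of_notMem_tsupport fun h => hx (hη.tsupport_subset h)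
  have hmeas : MeasurableSet (Ω ∩ ball c b) := hΩ.isOpen.measurableSet.inter measurableSet_ball
  have hFP := hP.feffermanPhong hd hΩ hC hQ (c := c) (r := b)
    (fun x _ hx => by rw [hη0 x fun h => hx (ball_subset_closedBall h), zero_mul]) ht
    ((hΩ.shiftPair ht).mono hmeas Set.inter_subset_left) subset_rfl Set.inter_subset_left hc₁ hmass
  have hL := cutoffConst_pos
  have hba : 0 < b - a := by linarith
  calc ∫⁻ x in Ω ∩ ball c a, ‖w x‖ₑ ^ 2
      = ∫⁻ x in Ω ∩ ball c a, ‖η x * w x‖ₑ ^ 2 :=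
        setLIntegral_congr_fun (hΩ.isOpen.measurableSet.inter measurableSet_ball) fun x hx => by
          simp only [hη.eq_one x hx.2, one_mul]
    _ ≤ ∫⁻ x in Ω ∩ ball c b, ‖η x * w x‖ₑ ^ 2 :=
        lintegral_mono_set (Set.inter_subset_inter_right _ (ball_subset_ball hab.le))
    _ ≤ _ := hFP
    _ ≤ _ := by
      have hv := volume_real_ball_pos d
      rw [ENNReal.ofReal_mul (p := (2 * C * (‖e‖ + 1) ^ 2
        + 2 * (c₁⁻¹ * volume.real (ball (0 : Eu d) 1))) * t ^ 2) (by positivity)]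
      refine le_of_le_of_eq (mul_le_mul_right (hle.trans ?_) _) (mul_assoc _ _ _).symm
      rw [ENNReal.ofReal_mul hc₀.le, mul_assoc]
      gcongr
      rw [ENNReal.ofReal_pow (by positivity)]
      exact hη.lintegral_mul_gradient_le _

/-- Decay of subsolutions in balls which are large compared to the critical radius. -/
lemma exists_decay (hd : 2 ≤ d) (e : Eu d) {C D c₀ : ℝ} (hC : 1 ≤ C) (hD : 2 ≤ D) (hc₀ : 0 < c₀)
    (k : ℕ) : ∃ (J : ℕ) (K : ℝ), 0 < K ∧
    ∀ (Ω : Set (Eu d)), ConeRegion Ω e → ∀ (P : Eu d → ℝ≥0∞), IsPotential C P → IsDoubling D P →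
    ∀ V : Eu d → ℝ, (∀ᵐ x, P x = ENNReal.ofReal (V x)) → (∀ᵐ x, 0 < V x) →
    ∀ (y : Eu d) (R : ℝ) (w : Eu d → ℝ), 0 < R → 1 ≤ R * fpsMax V y →
      SubSol (ENNReal.ofReal c₀) P Ω y R w →
      ∫⁻ x in Ω ∩ ball y (R * (1 / 2) ^ J), ‖w x‖ₑ ^ 2
        ≤ ENNReal.ofReal (K / (R * fpsMax V y) ^ (2 * k)) * ∫⁻ x in Ω ∩ ball y R, ‖w x‖ₑ ^ 2 := by
  obtain ⟨j, hj⟩ : ∃ j : ℕ, 2 + ‖e‖ ≤ 2 ^ j := by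
    obtain ⟨j, hj⟩ := pow_unbounded_of_one_lt (2 + ‖e‖) (one_lt_two)
    exact ⟨j, hj.le⟩
  -- Each of the `J` steps gains `4^{-i}`, where `D^i` is comparable to `(R m)²`; so `4^J ≥ D^k`
  -- suffices for the power `2 k`.
  obtain ⟨J, hJ⟩ : ∃ J : ℕ, D ^ k ≤ 4 ^ J := by
    obtain ⟨J, hJ⟩ := pow_unbounded_of_one_lt (D ^ k) (by norm_num : (1 : ℝ) < 4)
    exact ⟨J, hJ.le⟩
  have hv := volume_real_ball_pos d
  have hL := cutoffConst_pos
  have hD0 : 0 < D := by linarith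
  have hC0 : 0 < C := by linarith
  obtain ⟨c₁, hc₁⟩ : ∃ c₁, c₁ = (D ^ j)⁻¹ * (D * C)⁻¹ := ⟨_, rfl⟩
  have hc₁0 : 0 < c₁ := by rw [hc₁]; positivity
  obtain ⟨K₁, hK₁⟩ : ∃ K₁, K₁ = (2 * C * (‖e‖ + 1) ^ 2
    + 2 * (c₁⁻¹ * volume.real (ball (0 : Eu d) 1))) * c₀ * cutoffConst ^ 2 * 4 ^ J := ⟨_, rfl⟩
  have hK₁0 : 0 < K₁ := by rw [hK₁]; positivity
  refine ⟨J, K₁ ^ J * D ^ k, by positivity, fun Ω hΩ P hP hPD V hVP hV0 y R w hR h1 h => ?_⟩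
  obtain ⟨l, hl⟩ : ∃ l, l = R * fpsMax V y := ⟨_, rfl⟩
  have hmassR := hP.le_mass hd hC hD hPD hVP hV0 y hR h1
  rw [← hl] at h1 hmassR ⊢
  -- The ball of radius `R` has mass at least `(D C)⁻¹ l² R^{d-2}`, and passing to a nearby ball of
  -- radius `R 2^{-i}` loses at most `D^{i+j}`. As long as `D^i ≤ l²` the factor `l²` pays for the
  -- loss, leaving the constant `c₁`; the largest such `i` is taken.
  obtain ⟨i, hi1, hi2⟩ := exists_nat_pow_near (one_le_pow₀ h1 : 1 ≤ l ^ 2) (by linarith : 1 < D)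
  obtain ⟨t, ht⟩ : ∃ t, t = R * (1 / 2) ^ i := ⟨_, rfl⟩
  have ht0 : 0 < t := by rw [ht]; positivity
  have hit : 2 ^ i * t = R := by
    rw [ht, mul_left_comm, ← mul_pow]
    norm_num
  have htR : t ≤ R := by
    rw [ht]
    exact mul_le_of_le_one_right hR.le (pow_le_one₀ (by norm_num) (by norm_num))
  have hmass : ∀ z ∈ ball y R,
      ENNReal.ofReal (c₁ * t ^ (d - 2)) ≤ ∫⁻ x in ball (z + t • e) t, P x := by
    intro z hz
    have h2 := hmassR.trans (mass_nearby_le hPD hj hR hz i hit)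
    have h3 : 0 < D ^ (i + j) := by positivity
    have h4 : ENNReal.ofReal (D ^ (i + j)) ≠ 0 := (ENNReal.ofReal_pos.2 h3).ne'
    rw [← ENNReal.mul_le_mul_iff_right h4 ENNReal.ofReal_ne_top]
    refine le_trans ?_ h2
    rw [← ENNReal.ofReal_mul h3.le]
    refine ENNReal.ofReal_le_ofReal ?_
    rw [hc₁]
    calc D ^ (i + j) * ((D ^ j)⁻¹ * (D * C)⁻¹ * t ^ (d - 2))
        = (D * C)⁻¹ * (D ^ i * t ^ (d - 2)) := by
          rw [pow_add]
          field_simp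
      _ ≤ (D * C)⁻¹ * (l ^ 2 * R ^ (d - 2)) := by gcongr
  -- Up to a constant, a step costs `4^{m+1} / R²` from the cutoff, with `4^{m+1} ≤ 4^J`, and gains
  -- `t² = R² 4^{-i}`. The scale `t` stays fixed while the balls shrink.
  have main : ∀ m ≤ J, ∫⁻ x in Ω ∩ ball y (R * (1 / 2) ^ m), ‖w x‖ₑ ^ 2
      ≤ ENNReal.ofReal ((K₁ * (1 / 4) ^ i) ^ m) * ∫⁻ x in Ω ∩ ball y R, ‖w x‖ₑ ^ 2 := by
    intro m
    induction m with
    | zero => intro _; simp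
    | succ m ih =>
      intro hm
      have hm1 : (1 / 2 : ℝ) ^ m ≤ 1 := pow_le_one₀ (by norm_num) (by norm_num)
      have hs := h.lintegral_le_of_mass hd hΩ hC hP hc₀ hc₁0 (a := R * (1 / 2) ^ (m + 1))
        (b := R * (1 / 2) ^ m) (by positivity)
        (by
          rw [pow_succ]
          have : 0 < R * (1 / 2) ^ m := by positivity
          nlinarith) (mul_le_of_le_one_right hR.le hm1) ht0
        (fun z hz => hmass z (ball_subset_ball (mul_le_of_le_one_right hR.le hm1) hz.2))
      refine hs.trans ((mul_le_mul_right (ih (by omega)) _).trans ?_)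
      rw [← mul_assoc, ← ENNReal.ofReal_mul (by positivity)]
      refine mul_le_mul_left (ENNReal.ofReal_le_ofReal ?_) _
      rw [pow_succ' (K₁ * (1 / 4) ^ i) m]
      refine mul_le_mul_of_nonneg_right ?_ (by positivity)
      rw [hK₁, ht]
      have e1 : R * (1 / 2) ^ m - R * (1 / 2) ^ (m + 1) = R * (1 / 2) ^ (m + 1) := by ring
      have e2 : ((1 : ℝ) / 4) ^ i = ((1 / 2) ^ i) ^ 2 := by
        rw [← pow_mul, mul_comm, pow_mul]
        norm_num
      have e3 : (cutoffConst / (R * (1 / 2) ^ (m + 1))) ^ 2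
          = cutoffConst ^ 2 * 4 ^ (m + 1) / R ^ 2 := by
        have : ((1 : ℝ) / 2) ^ (m + 1) = (2 ^ (m + 1))⁻¹ := by rw [one_div, inv_pow]
        rw [this, div_pow, mul_pow, inv_pow, ← pow_mul, mul_comm (m + 1) 2, pow_mul]
        norm_num
        field_simp
      rw [e1, e2, e3]
      calc _ = (2 * C * (‖e‖ + 1) ^ 2 + 2 * (c₁⁻¹ * volume.real (ball (0 : Eu d) 1))) * c₀
            * cutoffConst ^ 2 * 4 ^ (m + 1) * ((1 / 2) ^ i) ^ 2 := by
            field_simp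
        _ ≤ _ := by
            gcongr
            norm_num
  refine (main J le_rfl).trans ?_
  gcongr
  rw [mul_pow, mul_div_assoc]
  gcongr
  rw [le_div_iff₀ (by positivity)]
  -- The maximality `l² < D^{i+1}` bounds `l^{2k}` by `D^{(i+1)k}`, and `D^k ≤ 4^J` cancels
  -- everything except one factor `D^k`.
  calc ((1 / 4 : ℝ) ^ i) ^ J * l ^ (2 * k) ≤ ((1 / 4 : ℝ) ^ i) ^ J * (D ^ (i + 1)) ^ k := by
        rw [pow_mul]
        gcongr
    _ = ((1 / 4 : ℝ) ^ J) ^ i * (D ^ k) ^ i * D ^ k := by ring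
    _ ≤ ((1 / 4 : ℝ) ^ J) ^ i * (4 ^ J) ^ i * D ^ k := by gcongr
    _ = D ^ k := by
      rw [← mul_pow, ← mul_pow]
      norm_num

end Decay

/-! ### Local square integrability of functions of finite energy. -/

section Energy
variable {d : ℕ} {e : Eu d}

/-- A function which is locally in `H¹` agrees on each ball with a function in `H¹`. -/
lemma HasWeakGrad.exists_memW {Ω : Set (Eu d)} (hΩ : IsOpen Ω) {v : Eu d → ℝ} {G : Eu d → Eu d}
    (h : HasWeakGrad Ω v G) (c : Eu d) {b : ℝ} (hb : 0 < b)
    (hv : MemLp v 2 (volume.restrict (Ω ∩ ball c (b + 1))))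
    (hG : MemLp G 2 (volume.restrict (Ω ∩ ball c (b + 1)))) :
    ∃ (w : Eu d → ℝ) (H : Eu d → Eu d), MemW 2 Ω w H ∧ (∀ x ∈ ball c b, w x = v x) ∧
      (∀ x ∈ ball c b, H x = G x) ∧ ∀ x ∈ Ω, x ∉ closedBall c (b + 1) → w x = 0 := by
  obtain ⟨η, hη⟩ := exists_isCutoff c hb.le (lt_add_one b)
  refine ⟨_, _, h.memW_cutoff hΩ hv hG hη.contDiff hη.compact hη.tsupport_subset, ?_, ?_, ?_⟩
  · intro x hx
    simp only [hη.eq_one x hx, one_mul]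
  · intro x hx
    have hg : gradient η x = 0 := by
      have : η =ᶠ[𝓝 x] fun _ => 1 :=
        (isOpen_ball.mem_nhds hx |> fun h => by filter_upwards [h] with z hz using hη.eq_one z hz)
      rw [this.gradient_eq]
      simp
    simp only [hη.eq_one x hx, one_smul, hg, smul_zero, add_zero]
  · intro x _ hx
    simp only [image_eq_zero_of_notMem_tsupport fun h => hx
      (ball_subset_closedBall (hη.tsupport_subset h)), zero_mul]

/-- Balls of large radius are large compared to the critical radius. -/
lemma IsPotential.exists_large_radius {C D : ℝ} {P : Eu d → ℝ≥0∞} (hd : 2 ≤ d) (hC : 1 ≤ C)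
    (hD : 2 ≤ D) (hP : IsPotential C P) (hPD : IsDoubling D P) (e y : Eu d) :
    ∃ R₀ : ℝ, 0 < R₀ ∧ ∀ R, R₀ ≤ R → ∀ z ∈ ball y R,
      ENNReal.ofReal (1 * R ^ (d - 2)) ≤ ∫⁻ x in ball (z + R • e) R, P x := by
  obtain ⟨j, hj⟩ : ∃ j : ℕ, 2 + ‖e‖ ≤ 2 ^ j := by
    obtain ⟨j, hj⟩ := pow_unbounded_of_one_lt (2 + ‖e‖) (one_lt_two)
    exact ⟨j, hj.le⟩
  have hD0 : 0 < D := by linarith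
  have hC0 : 0 < C := by linarith
  set β := (∫⁻ x in ball y 1, P x).toReal with hβ
  have hβ0 : 0 < β := by
    refine ENNReal.toReal_pos ?_ (hP.finite y 1)
    rw [Ne, lintegral_eq_zero_iff' hP.measurable.aemeasurable]
    intro h0
    have hfalse : ∀ᵐ x ∂(volume.restrict (ball y 1)), False := by
      filter_upwards [h0, ae_restrict_of_ae hP.pos] with x h1 h2
      rw [h1] at h2
      exact lt_irrefl _ h2
    rw [eventually_false_iff_eq_bot, ae_eq_bot, Measure.restrict_eq_zero] at hfalse
    exact (measure_ball_pos volume y one_pos).ne' hfalse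
  have hβe : ∫⁻ x in ball y 1, P x = ENNReal.ofReal β :=
    (ENNReal.ofReal_toReal (hP.finite y 1)).symm
  -- The mass of `B(y, R)` is at least `R^d β / C`, and moving to the nearby ball loses `D^j`. This
  -- exceeds `R^{d-2}` once `R² ≥ D^j C / β`, which follows from the two lower bounds on `R`.
  refine ⟨max 1 (D ^ j * C / β), by positivity, fun R hR z hz => ?_⟩
  have hR1 : 1 ≤ R := (le_max_left _ _).trans hR
  have hR0 : 0 < R := by linarith
  have hR2 : D ^ j * C / β ≤ R := (le_max_right _ _).trans hR
  have h1 := hP.scale_le hC0.le y hR0 (inv_pos.2 hR0) (inv_le_one_of_one_le₀ hR1)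
  rw [inv_mul_cancel₀ hR0.ne', hβe] at h1
  have h2 := h1.trans (mul_le_mul_right (mass_nearby_le hPD hj hR0 hz 0 (t := R) (by simp)) _)
  rw [zero_add, ← mul_assoc, ← ENNReal.ofReal_mul (by positivity)] at h2
  have h3 : 0 < C * R⁻¹ ^ d * D ^ j := by positivity
  rw [← ENNReal.mul_le_mul_iff_right (ENNReal.ofReal_pos.2 h3).ne' ENNReal.ofReal_ne_top]
  refine le_trans ?_ h2
  rw [← ENNReal.ofReal_mul h3.le]
  refine ENNReal.ofReal_le_ofReal ?_
  obtain ⟨n, rfl⟩ := Nat.exists_eq_add_of_le hd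
  rw [Nat.add_sub_cancel_left, inv_pow]
  rw [div_le_iff₀ hβ0] at hR2
  rw [show C * (R ^ (2 + n))⁻¹ * D ^ j * (1 * R ^ n) = D ^ j * C / R ^ 2 by
    rw [pow_add]; field_simp, div_le_iff₀ (by positivity)]
  nlinarith [mul_pos hβ0 hR0]

/-- At very large radii the bound is the Fefferman-Phong inequality; the threshold depends on `P`
and `y`, but the constant does not. The averaging inequality at scale `l r` then brings the bound
from radius `Λ r` down to `r` with the same constant, and finitely many such steps reach every
radius. -/
lemma exists_local_bound_of_memLp (hd : 3 ≤ d) (e : Eu d) {C D : ℝ} (hC : 1 ≤ C) (hD : 2 ≤ D) :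
    ∃ K : ℝ, 0 < K ∧ ∀ (Ω : Set (Eu d)), ConeRegion Ω e → ∀ (P : Eu d → ℝ≥0∞), IsPotential C P →
    IsDoubling D P → ∀ (v : Eu d → ℝ) (G : Eu d → Eu d), HasWeakGrad Ω v G →
    MemLp G 2 (volume.restrict Ω) → (∀ c r, MemLp v 2 (volume.restrict (Ω ∩ ball c r))) →
    ∀ (y : Eu d) (r : ℝ), 0 < r → ∫⁻ x in Ω ∩ ball y r, ‖v x‖ₑ ^ 2
      ≤ ENNReal.ofReal (K * r ^ 2) * ((∫⁻ x in Ω, ‖G x‖ₑ ^ 2) + ∫⁻ x in Ω, P x * ‖v x‖ₑ ^ 2) := by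
  have hv := volume_real_ball_pos d
  obtain ⟨k, hk⟩ : ∃ k, k = ‖e‖ := ⟨_, rfl⟩
  have hk0 : 0 ≤ k := by rw [hk]; positivity
  -- With this choice `Λ² ≤ l² (k + 2)² = l³ / 4 ≤ l^d / 4`. So the volume ratio `l^{-d}` beats the
  -- growth `Λ²` of the bound, which uses `d ≥ 3`.
  obtain ⟨l, hl⟩ : ∃ l, l = 4 * (k + 2) ^ 2 := ⟨_, rfl⟩
  have hl1 : 1 ≤ l := by rw [hl]; nlinarith
  have hl0 : 0 < l := by linarith
  obtain ⟨Λ, hΛ⟩ : ∃ Λ, Λ = 1 + l * (k + 1) := ⟨_, rfl⟩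
  have hΛ1 : 1 < Λ := by
    have : 0 < l * (k + 1) := by positivity
    linarith
  have hΛle : Λ ≤ l * (k + 2) := by linarith
  obtain ⟨K, hK⟩ : ∃ K, K = (2 * C * (k + 1) ^ 2
    + 2 * (1⁻¹ * volume.real (ball (0 : Eu d) 1))) + 4 * (l * (k + 1)) ^ 2 := ⟨_, rfl⟩
  have hC0 : 0 < C := by linarith
  have hK0 : 0 < K := by rw [hK]; positivity
  refine ⟨K, hK0, fun Ω hΩ P hP hPD v G h hG hvL y r hr => ?_⟩
  set E₁ := ∫⁻ x in Ω, ‖G x‖ₑ ^ 2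
  set E₂ := ∫⁻ x in Ω, P x * ‖v x‖ₑ ^ 2
  have hGL : ∀ c r, MemLp G 2 (volume.restrict (Ω ∩ ball c r)) := fun c r =>
    hG.mono_measure (Measure.restrict_mono Set.inter_subset_left le_rfl)
  have hmeas : ∀ r, MeasurableSet (Ω ∩ ball y r) := fun r =>
    hΩ.isOpen.measurableSet.inter measurableSet_ball
  have large : ∃ R₀ : ℝ, 0 < R₀ ∧ ∀ R, R₀ ≤ R → ∫⁻ x in Ω ∩ ball y R, ‖v x‖ₑ ^ 2
      ≤ ENNReal.ofReal (K * R ^ 2) * (E₁ + E₂) := by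
    obtain ⟨R₀, hR₀, hm⟩ := hP.exists_large_radius (by omega) hC hD hPD e y
    refine ⟨R₀, hR₀, fun R hR => ?_⟩
    have hRp : 0 < R := by linarith
    have hb : 0 < R + R * (‖e‖ + 1) := by positivity
    obtain ⟨w, H, hw, hwv, hHG, hsupp⟩ := h.exists_memW hΩ.isOpen y hb (hvL _ _) (hGL _ _)
    have hFP := hP.feffermanPhong (by omega) hΩ hC hw hsupp hRp (hΩ.shiftPair_ball hRp y R)
      Set.inter_subset_left Set.inter_subset_left one_pos fun z hz => hm R hR z hz.2
    rw [setLIntegral_congr_fun (hmeas R) (f := fun x => ‖w x‖ₑ ^ 2)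
        (g := fun x => ‖v x‖ₑ ^ 2) fun x hx => by
        simp only [hwv x (ball_subset_ball (by nlinarith [norm_nonneg e]) hx.2)],
      setLIntegral_congr_fun (hmeas (R + R * (‖e‖ + 1))) (f := fun x => ‖H x‖ₑ ^ 2)
        (g := fun x => ‖G x‖ₑ ^ 2) fun x hx => by
        simp only [hHG x hx.2],
      setLIntegral_congr_fun (hmeas (R + R * (‖e‖ + 1))) (f := fun x => P x * ‖w x‖ₑ ^ 2)
        (g := fun x => P x * ‖v x‖ₑ ^ 2)
        fun x hx => by simp only [hwv x hx.2]] at hFP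
    refine hFP.trans ?_
    refine mul_le_mul' (ENNReal.ofReal_le_ofReal ?_) (add_le_add
      (lintegral_mono_set Set.inter_subset_left) (lintegral_mono_set Set.inter_subset_left))
    rw [hK, hk]
    exact mul_le_mul_of_nonneg_right (le_add_of_nonneg_right (by positivity)) (by positivity)
  have step : ∀ r, 0 < r → ∫⁻ x in Ω ∩ ball y (Λ * r), ‖v x‖ₑ ^ 2
      ≤ ENNReal.ofReal (K * (Λ * r) ^ 2) * (E₁ + E₂) → ∫⁻ x in Ω ∩ ball y r, ‖v x‖ₑ ^ 2
      ≤ ENNReal.ofReal (K * r ^ 2) * (E₁ + E₂) := by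
    intro r hr hle
    have ht : 0 < l * r := by positivity
    have hb : 0 < r + l * r * (‖e‖ + 1) := by positivity
    obtain ⟨w, H, hw, hwv, hHG, hsupp⟩ := h.exists_memW hΩ.isOpen y hb (hvL _ _) (hGL _ _)
    have hav := hw.lintegral_sq_le_average hΩ hsupp ht (hΩ.shiftPair_ball ht y r)
      Set.inter_subset_left Set.inter_subset_left
    rw [setLIntegral_congr_fun (hmeas r) (f := fun x => ‖w x‖ₑ ^ 2)
        (g := fun x => ‖v x‖ₑ ^ 2) fun x hx => by
        simp only [hwv x (ball_subset_ball (le_add_of_nonneg_right (by positivity)) hx.2)],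
      setLIntegral_congr_fun (hmeas (r + l * r * (‖e‖ + 1))) (f := fun x => ‖H x‖ₑ ^ 2)
        (g := fun x => ‖G x‖ₑ ^ 2)
        fun x hx => by simp only [hHG x hx.2],
      setLIntegral_congr_fun (hmeas (r + l * r * (‖e‖ + 1))) (f := fun x => ‖w x‖ₑ ^ 2)
        (g := fun x => ‖v x‖ₑ ^ 2)
        fun x hx => by simp only [hwv x hx.2]] at hav
    rw [show r + l * r * (‖e‖ + 1) = Λ * r by rw [hΛ, hk]; ring, ← hk] at hav
    have hB0 : volume (ball (0 : Eu d) (l * r)) ≠ 0 := (measure_ball_pos _ _ ht).ne'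
    have hBt : volume (ball (0 : Eu d) (l * r)) ≠ ⊤ := measure_ball_lt_top.ne
    rw [← ENNReal.mul_le_mul_iff_right hB0 hBt]
    refine hav.trans ?_
    have hvolS : volume (Ω ∩ ball y r)
        ≤ volume (ball (0 : Eu d) (l * r)) * ENNReal.ofReal ((l ^ d)⁻¹) := by
      refine (measure_mono Set.inter_subset_right).trans (le_of_eq ?_)
      rw [volume_ball_scale 0 hl0, mul_right_comm, ← ENNReal.ofReal_mul (by positivity),
        mul_inv_cancel₀ (by positivity), ENNReal.ofReal_one, one_mul,
        Measure.addHaar_ball_center]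
    have hG1 : ∫⁻ x in Ω ∩ ball y (Λ * r), ‖G x‖ₑ ^ 2 ≤ E₁ + E₂ :=
      (lintegral_mono_set Set.inter_subset_left).trans le_self_add
    set B := volume (ball (0 : Eu d) (l * r))
    set E := E₁ + E₂
    calc 2 * (B * (ENNReal.ofReal (l * r * (k + 1)) ^ 2 * ∫⁻ x in Ω ∩ ball y (Λ * r), ‖G x‖ₑ ^ 2))
          + 2 * (volume (Ω ∩ ball y r) * ∫⁻ x in Ω ∩ ball y (Λ * r), ‖v x‖ₑ ^ 2)
        ≤ 2 * (B * (ENNReal.ofReal (l * r * (k + 1)) ^ 2 * E))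
          + 2 * ((B * ENNReal.ofReal ((l ^ d)⁻¹)) * (ENNReal.ofReal (K * (Λ * r) ^ 2) * E)) := by
          gcongr
      _ = B * ((2 * ENNReal.ofReal (l * r * (k + 1)) ^ 2
          + 2 * (ENNReal.ofReal ((l ^ d)⁻¹) * ENNReal.ofReal (K * (Λ * r) ^ 2))) * E) := by ring
      _ = B * (ENNReal.ofReal (2 * (l * r * (k + 1)) ^ 2
          + 2 * ((l ^ d)⁻¹ * (K * (Λ * r) ^ 2))) * E) := by
          rw [ENNReal.ofReal_add (by positivity) (by positivity), ENNReal.ofReal_mul zero_le_two,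
            ENNReal.ofReal_mul zero_le_two, ENNReal.ofReal_mul (by positivity : 0 ≤ (l ^ d)⁻¹),
            ENNReal.ofReal_ofNat, ENNReal.ofReal_pow (by positivity)]
      _ ≤ _ := by
          refine mul_le_mul_right (mul_le_mul_left (ENNReal.ofReal_le_ofReal ?_) _) _
          have h1 : (l ^ d)⁻¹ * Λ ^ 2 ≤ 1 / 4 := by
            obtain ⟨n, rfl⟩ := Nat.exists_eq_add_of_le hd
            have h2 : Λ ^ 2 ≤ (l * (k + 2)) ^ 2 := by gcongr
            have h3 : (1 : ℝ) ≤ l ^ n := one_le_pow₀ hl1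
            rw [inv_mul_le_iff₀ (by positivity)]
            calc Λ ^ 2 ≤ (l * (k + 2)) ^ 2 := h2
              _ = l ^ 3 * 1 * (1 / 4) := by rw [mul_pow, pow_succ l 2, hl]; ring
              _ ≤ l ^ 3 * l ^ n * (1 / 4) := by gcongr
              _ = _ := by rw [pow_add]
          have h4 : 4 * (l * (k + 1)) ^ 2 ≤ K := by
            rw [hK]
            exact le_add_of_nonneg_left (by positivity)
          calc 2 * (l * r * (k + 1)) ^ 2 + 2 * ((l ^ d)⁻¹ * (K * (Λ * r) ^ 2))
              = (4 * (l * (k + 1)) ^ 2) * r ^ 2 / 2 + 2 * (((l ^ d)⁻¹ * Λ ^ 2) * (K * r ^ 2)) := by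
                ring
            _ ≤ K * r ^ 2 / 2 + 2 * (1 / 4 * (K * r ^ 2)) := by gcongr
            _ = _ := by ring
  obtain ⟨R₀, hR₀, hlarge⟩ := large
  have down : ∀ (m : ℕ) (r : ℝ), 0 < r → R₀ ≤ Λ ^ m * r → ∫⁻ x in Ω ∩ ball y r, ‖v x‖ₑ ^ 2
      ≤ ENNReal.ofReal (K * r ^ 2) * (E₁ + E₂) := by
    intro m
    induction m with
    | zero =>
      intro r _ hm
      exact hlarge r (by simpa using hm)
    | succ m ih =>
      intro r hr hm
      exact step r hr (ih _ (by positivity) (by rwa [← mul_assoc, ← pow_succ]))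
  obtain ⟨m, hm⟩ := pow_unbounded_of_one_lt (R₀ / r) hΛ1
  exact down m r hr (by rw [div_lt_iff₀ hr] at hm; exact hm.le)

lemma abs_arctan_le (s : ℝ) : |Real.arctan s| ≤ |s| := by
  have h := Convex.norm_image_sub_le_of_norm_deriv_le (f := Real.arctan) (s := Set.univ) (C := 1)
    (x := 0) (y := s) (fun x _ => Real.differentiableAt_arctan x) (fun x _ => ?_) convex_univ
    (Set.mem_univ _) (Set.mem_univ _)
  · simpa using h
  · rw [Real.deriv_arctan, Real.norm_of_nonneg (by positivity), div_le_one (by positivity)]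
    nlinarith [sq_nonneg x]

lemma tendsto_mul_arctan (s : ℝ) :
    Tendsto (fun k : ℕ => ((k : ℝ) + 1) * Real.arctan (((k : ℝ) + 1)⁻¹ * s)) atTop (𝓝 s) := by
  have h1 : HasDerivAt (fun t : ℝ => Real.arctan (t * s)) s 0 := by
    have := ((hasDerivAt_id (0 : ℝ)).mul_const s).arctan
    simpa using this
  rw [hasDerivAt_iff_tendsto_slope_zero] at h1
  have h2 : Tendsto (fun k : ℕ => ((k : ℝ) + 1)⁻¹) atTop (𝓝[≠] 0) := by
    refine tendsto_nhdsWithin_iff.2 ⟨?_, Eventually.of_forall fun k => ?_⟩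
    · simpa using tendsto_one_div_add_atTop_nhds_zero_nat (𝕜 := ℝ)
    · have : ((k : ℝ) + 1)⁻¹ ≠ 0 := by positivity
      exact this
  have h3 := h1.comp h2
  simpa [Function.comp_def] using h3

/-- Functions of finite energy are locally square integrable, with a scale invariant bound. -/
lemma exists_local_bound (hd : 3 ≤ d) (e : Eu d) {C D : ℝ} (hC : 1 ≤ C) (hD : 2 ≤ D) :
    ∃ K : ℝ, 0 < K ∧ ∀ (Ω : Set (Eu d)), ConeRegion Ω e → ∀ (P : Eu d → ℝ≥0∞), IsPotential C P →
    IsDoubling D P → ∀ (u : Eu d → ℝ) (G : Eu d → Eu d), HasWeakGrad Ω u G →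
    MemLp G 2 (volume.restrict Ω) → ∀ (y : Eu d) (r : ℝ), 0 < r → ∫⁻ x in Ω ∩ ball y r, ‖u x‖ₑ ^ 2
      ≤ ENNReal.ofReal (K * r ^ 2) * ((∫⁻ x in Ω, ‖G x‖ₑ ^ 2) + ∫⁻ x in Ω, P x * ‖u x‖ₑ ^ 2) := by
  obtain ⟨K, hK, h⟩ := exists_local_bound_of_memLp hd e hC hD
  refine ⟨K, hK, fun Ω hΩ P hP hPD u G hu hG y r hr => ?_⟩
  -- Finite energy does not say beforehand that `u` is square integrable near the boundary. These
  -- truncations are bounded, and since `|Φ'| ≤ 1` and `|Φ(s)| ≤ |s|` they do not increase the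
  -- energy; Fatou removes them at the end.
  obtain ⟨Φ, hΦ⟩ : ∃ Φ : ℕ → ℝ → ℝ,
      Φ = fun (k : ℕ) s => ((k : ℝ) + 1) * Real.arctan (((k : ℝ) + 1)⁻¹ * s) := ⟨_, rfl⟩
  have hd1 : ∀ k s, HasDerivAt (Φ k) (1 / (1 + (((k : ℝ) + 1)⁻¹ * s) ^ 2)) s := by
    intro k s
    have h1 := ((((hasDerivAt_id s).const_mul ((k : ℝ) + 1)⁻¹).arctan).const_mul ((k : ℝ) + 1))
    rw [hΦ]
    have hk : (k : ℝ) + 1 ≠ 0 := by positivity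
    refine h1.congr_deriv ?_
    rw [mul_one, mul_left_comm, mul_inv_cancel₀ hk, mul_one]
    rfl
  have hsm : ∀ k, ContDiff ℝ 1 (Φ k) := by
    intro k
    rw [hΦ]
    exact contDiff_const.mul ((contDiff_const.mul contDiff_id).arctan)
  have hder : ∀ k s, |deriv (Φ k) s| ≤ 1 := by
    intro k s
    rw [(hd1 k s).deriv, abs_of_nonneg (by positivity), div_le_one (by positivity)]
    nlinarith [sq_nonneg (((k : ℝ) + 1)⁻¹ * s)]
  have hle : ∀ k s, |Φ k s| ≤ |s| := by
    intro k s
    have hk : (0 : ℝ) < k + 1 := by positivity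
    rw [hΦ]
    dsimp only
    rw [abs_mul, abs_of_pos hk]
    calc ((k : ℝ) + 1) * |Real.arctan (((k : ℝ) + 1)⁻¹ * s)|
        ≤ ((k : ℝ) + 1) * |((k : ℝ) + 1)⁻¹ * s| := mul_le_mul_of_nonneg_left (abs_arctan_le _) hk.le
      _ = |s| := by rw [abs_mul, abs_of_pos (inv_pos.2 hk), mul_inv_cancel_left₀ hk.ne']
  have hbd : ∀ k s, |Φ k s| ≤ ((k : ℝ) + 1) * (Real.pi / 2) := by
    intro k s
    have hk : (0 : ℝ) < k + 1 := by positivity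
    rw [hΦ]
    dsimp only
    rw [abs_mul, abs_of_pos hk]
    gcongr
    exact abs_le.2 ⟨(Real.neg_pi_div_two_lt_arctan _).le, (Real.arctan_lt_pi_div_two _).le⟩
  have hcomp : ∀ k, HasWeakGrad Ω (fun x => Φ k (u x)) (fun x => deriv (Φ k) (u x) • G x) :=
    fun k => hu.comp hΩ.isOpen (hsm k) (hder k)
  have hGle : ∀ k x, ‖deriv (Φ k) (u x) • G x‖ ≤ ‖G x‖ := fun k x => by
    rw [norm_smul]
    exact mul_le_of_le_one_left (norm_nonneg _) (hder k _)
  set X := ENNReal.ofReal (K * r ^ 2) * ((∫⁻ x in Ω, ‖G x‖ₑ ^ 2) + ∫⁻ x in Ω, P x * ‖u x‖ₑ ^ 2)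
  have hk : ∀ k, ∫⁻ x in Ω ∩ ball y r, ‖Φ k (u x)‖ₑ ^ 2 ≤ X := by
    intro k
    refine (h Ω hΩ P hP hPD _ _ (hcomp k) ?_ ?_ y r hr).trans ?_
    · exact hG.mono (hcomp k).locInt_grad.aestronglyMeasurable (ae_of_all _ (hGle k))
    · intro c ρ
      have : IsFiniteMeasure (volume.restrict (Ω ∩ ball c ρ)) := ⟨by
        rw [Measure.restrict_apply_univ]
        exact (measure_mono Set.inter_subset_right).trans_lt measure_ball_lt_top⟩
      refine MemLp.of_bound ((hcomp k).locInt.aestronglyMeasurable.mono_measure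
        (Measure.restrict_mono Set.inter_subset_left le_rfl)) (((k : ℝ) + 1) * (Real.pi / 2))
        (ae_of_all _ fun x => hbd k _)
    · have e1 : ∀ x, ‖deriv (Φ k) (u x) • G x‖ₑ ≤ ‖G x‖ₑ := fun x => by
        rw [← ofReal_norm, ← ofReal_norm]
        exact ENNReal.ofReal_le_ofReal (hGle k x)
      have e2 : ∀ x, ‖Φ k (u x)‖ₑ ≤ ‖u x‖ₑ := fun x => by
        rw [← ofReal_norm, ← ofReal_norm]
        exact ENNReal.ofReal_le_ofReal (hle k _)
      refine mul_le_mul_right (add_le_add (lintegral_mono fun x => ?_)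
        (lintegral_mono fun x => ?_)) _
      · exact pow_le_pow_left' (e1 x) 2
      · exact mul_le_mul_right (pow_le_pow_left' (e2 x) 2) _
  have hlim : ∀ x, Tendsto (fun k => ‖Φ k (u x)‖ₑ ^ 2) atTop (𝓝 (‖u x‖ₑ ^ 2)) := by
    intro x
    have h1 : Tendsto (fun k => Φ k (u x)) atTop (𝓝 (u x)) := by
      rw [hΦ]
      exact tendsto_mul_arctan _
    exact ENNReal.Tendsto.pow h1.enorm
  calc ∫⁻ x in Ω ∩ ball y r, ‖u x‖ₑ ^ 2
      = ∫⁻ x in Ω ∩ ball y r, liminf (fun k => ‖Φ k (u x)‖ₑ ^ 2) atTop :=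
        lintegral_congr fun x => (hlim x).liminf_eq.symm
    _ ≤ liminf (fun k => ∫⁻ x in Ω ∩ ball y r, ‖Φ k (u x)‖ₑ ^ 2) atTop := by
        refine lintegral_liminf_le' fun k => ?_
        exact (((hcomp k).locInt.aestronglyMeasurable.mono_measure
          (Measure.restrict_mono Set.inter_subset_left le_rfl)).aemeasurable.enorm.pow_const 2)
    _ ≤ X := liminf_le_of_le (by isBoundedDefault) fun b hb => by
        obtain ⟨k, hk'⟩ := hb.exists
        exact hk'.trans (hk k)

end Energy

/-! ### The energy estimate for the Neumann problem. -/

section EnergyEstimate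
variable {d : ℕ} {e : Eu d}

lemma lintegral_potential_eq {S : Set (Eu d)} {P : Eu d → ℝ≥0∞} {V u : Eu d → ℝ}
    (hVP : ∀ᵐ x, P x = ENNReal.ofReal (V x)) (hV0 : ∀ᵐ x, 0 < V x) :
    ∫⁻ x in S, P x * ‖u x‖ₑ ^ 2 = ∫⁻ x in S, ‖√(V x) * u x‖ₑ ^ 2 := by
  refine lintegral_congr_ae ?_
  filter_upwards [ae_restrict_of_ae hVP, ae_restrict_of_ae hV0] with x h1 h2
  rw [h1, enorm_mul, mul_pow, Real.enorm_of_nonneg (Real.sqrt_nonneg _),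
    ← ENNReal.ofReal_pow (Real.sqrt_nonneg _), Real.sq_sqrt h2.le]

lemma energy_le_form {μ : ℝ} (hμ : 0 < μ) {A : Eu d → Matrix (Fin d) (Fin d) ℝ}
    (hA : IsElliptic μ A) {Ω : Set (Eu d)} {P : Eu d → ℝ≥0∞} {V u : Eu d → ℝ} {G : Eu d → Eu d}
    (hVP : ∀ᵐ x, P x = ENNReal.ofReal (V x)) (hV0 : ∀ᵐ x, 0 < V x)
    (hE : FiniteEnergyOn V Ω u G) :
    ENNReal.ofReal (min μ 1) * ((∫⁻ x in Ω, ‖G x‖ₑ ^ 2) + ∫⁻ x in Ω, P x * ‖u x‖ₑ ^ 2)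
      ≤ ENNReal.ofReal (form A V Ω u G u G) := by
  obtain ⟨hG, hu⟩ := hE
  have hm0 : 0 < min μ 1 := lt_min hμ one_pos
  rw [lintegral_potential_eq hVP hV0, form_eq, ← lintegral_add_left' (hG.1.enorm.pow_const 2),
    ← lintegral_const_mul' _ _ ENNReal.ofReal_ne_top]
  have hi1 := MemLp.integrable_inner_two (memLp_flux hA hG) hG
  have hi2 : Integrable (fun x => V x * u x * u x) (volume.restrict Ω) := by
    refine (MemLp.integrable_inner_two hu hu).congr ?_
    filter_upwards [ae_restrict_of_ae hV0] with x h2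
    simp only [RCLike.inner_apply, conj_trivial]
    rw [mul_mul_mul_comm, Real.mul_self_sqrt h2.le, mul_assoc]
  have hi : Integrable (fun x => ⟪flux (A x) (G x), G x⟫ + V x * u x * u x) (volume.restrict Ω) :=
    hi1.add hi2
  rw [ofReal_integral_eq_lintegral_ofReal hi]
  · refine lintegral_mono_ae ?_
    filter_upwards [ae_restrict_of_ae hA.le_inner_flux, ae_restrict_of_ae hV0] with x h1 h2
    rw [← ofReal_norm, ← ENNReal.ofReal_pow (norm_nonneg _), ← ofReal_norm,
      ← ENNReal.ofReal_pow (norm_nonneg _), ← ENNReal.ofReal_add (by positivity) (by positivity),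
      ← ENNReal.ofReal_mul hm0.le]
    refine ENNReal.ofReal_le_ofReal ?_
    rw [Real.norm_eq_abs, sq_abs, mul_pow, Real.sq_sqrt h2.le]
    have h3 := h1 (G x)
    have h4 : 0 ≤ V x * u x ^ 2 := by positivity
    nlinarith [min_le_left μ 1, min_le_right μ 1, sq_nonneg ‖G x‖]
  · filter_upwards [ae_restrict_of_ae hA.le_inner_flux, ae_restrict_of_ae hV0] with x h1 h2
    have h3 := h1 (G x)
    have h4 : 0 ≤ V x * u x * u x := by rw [mul_assoc]; exact mul_nonneg h2.le (mul_self_nonneg _)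
    have h5 : 0 ≤ μ * ‖G x‖ ^ 2 := by positivity
    simp only [Pi.zero_apply]
    linarith

/-- Testing with `u` itself bounds the energy `X` by `∫ f u`, and `exists_local_bound` gives `(∫ f
u)² ≤ K r² X ∫ f²`. Dividing by `X` gives `X ≤ K' r² ∫ f²`, and the local bound supplies the other
`r²`. As `X` is global, the centre `c` may be far from the support of `f`. -/
lemma exists_energy_bound (hd : 3 ≤ d) (e : Eu d) {C D μ : ℝ} (hC : 1 ≤ C) (hD : 2 ≤ D)
    (hμ : 0 < μ) : ∃ K : ℝ, 0 < K ∧ ∀ (Ω : Set (Eu d)), ConeRegion Ω e →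
    ∀ (P : Eu d → ℝ≥0∞), IsPotential C P → IsDoubling D P →
    ∀ V : Eu d → ℝ, (∀ᵐ x, P x = ENNReal.ofReal (V x)) → (∀ᵐ x, 0 < V x) →
    ∀ A : Eu d → Matrix (Fin d) (Fin d) ℝ, IsElliptic μ A →
    ∀ (u : Eu d → ℝ) (G : Eu d → Eu d), HasWeakGrad Ω u G → FiniteEnergyOn V Ω u G →
    ∀ (f : Eu d → ℝ), MemLp f 2 (volume.restrict Ω) → form A V Ω u G u G = ∫ x in Ω, f x * u x →
    ∀ (y : Eu d) (r : ℝ), 0 < r → (∀ x ∉ ball y r, f x = 0) → ∀ c : Eu d,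
      ∫⁻ x in Ω ∩ ball c r, ‖u x‖ₑ ^ 2
        ≤ ENNReal.ofReal (K * r ^ 4) * ∫⁻ x in Ω, ‖f x‖ₑ ^ 2 := by
  obtain ⟨K, hK, hloc⟩ := exists_local_bound hd e hC hD
  have hm0 : 0 < min μ 1 := lt_min hμ one_pos
  refine ⟨K ^ 2 / (min μ 1) ^ 2, by positivity, ?_⟩
  intro Ω hΩ P hP hPD V hVP hV0 A hA u G hu hE f hf hform y r hr hfs c
  have hb := hloc Ω hΩ P hP hPD u G hu hE.1
  have hen := energy_le_form hμ hA hVP hV0 hE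
  set X := (∫⁻ x in Ω, ‖G x‖ₑ ^ 2) + ∫⁻ x in Ω, P x * ‖u x‖ₑ ^ 2 with hX
  set F := ∫⁻ x in Ω, ‖f x‖ₑ ^ 2 with hF
  have hXt : X ≠ ⊤ := by
    rw [hX, lintegral_potential_eq hVP hV0]
    exact ENNReal.add_ne_top.2 ⟨(lintegral_enorm_sq_lt_top hE.1).ne,
      (lintegral_enorm_sq_lt_top hE.2).ne⟩
  have hum : AEStronglyMeasurable u (volume.restrict Ω) := hu.locInt.aestronglyMeasurable
  have h1 : ENNReal.ofReal (form A V Ω u G u G)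
      ≤ ∫⁻ x in Ω ∩ ball y r, ‖f x‖ₑ * ‖u x‖ₑ := by
    rw [hform]
    calc ENNReal.ofReal (∫ x in Ω, f x * u x) ≤ ‖∫ x in Ω, f x * u x‖ₑ := by
          rw [← ofReal_norm]
          exact ENNReal.ofReal_le_ofReal (le_abs_self _)
      _ ≤ ∫⁻ x in Ω, ‖f x * u x‖ₑ := enorm_integral_le_lintegral_enorm _
      _ = ∫⁻ x in Ω, ‖f x‖ₑ * ‖u x‖ₑ := by simp only [enorm_mul]
      _ = _ := setLIntegral_eq_inter_ball fun x hx => by rw [hfs x hx]; simp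
  have hνle : volume.restrict (Ω ∩ ball y r) ≤ volume.restrict Ω :=
    Measure.restrict_mono Set.inter_subset_left le_rfl
  have h2 : (ENNReal.ofReal (min μ 1) * X) ^ 2 ≤ F * (ENNReal.ofReal (K * r ^ 2) * X) := by
    calc (ENNReal.ofReal (min μ 1) * X) ^ 2
        ≤ (∫⁻ x in Ω ∩ ball y r, ‖f x‖ₑ * ‖u x‖ₑ) ^ 2 := by
          gcongr
          exact hen.trans h1
      _ ≤ (∫⁻ x in Ω ∩ ball y r, ‖f x‖ₑ ^ 2) * ∫⁻ x in Ω ∩ ball y r, ‖u x‖ₑ ^ 2 :=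
          lintegral_mul_sq_le (hf.1.mono_measure hνle).enorm (hum.mono_measure hνle).enorm
      _ ≤ _ := by
          gcongr
          · exact lintegral_mono' hνle le_rfl
          · exact hb y r hr
  have h3 : ENNReal.ofReal ((min μ 1) ^ 2) * X ≤ ENNReal.ofReal (K * r ^ 2) * F := by
    by_cases hX0 : X = 0
    · rw [hX0, mul_zero]
      exact bot_le
    · rw [← ENNReal.mul_le_mul_iff_right hX0 hXt, ENNReal.ofReal_pow hm0.le]
      calc X * (ENNReal.ofReal (min μ 1) ^ 2 * X) = (ENNReal.ofReal (min μ 1) * X) ^ 2 := by ring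
        _ ≤ _ := h2
        _ = _ := by ring
  refine (hb c r hr).trans ?_
  calc ENNReal.ofReal (K * r ^ 2) * X
      = ENNReal.ofReal (K * r ^ 2 / (min μ 1) ^ 2) * (ENNReal.ofReal ((min μ 1) ^ 2) * X) := by
        rw [← mul_assoc, ← ENNReal.ofReal_mul (by positivity), div_mul_cancel₀ _ (by positivity)]
    _ ≤ ENNReal.ofReal (K * r ^ 2 / (min μ 1) ^ 2) * (ENNReal.ofReal (K * r ^ 2) * F) := by gcongr
    _ = _ := by
        rw [← mul_assoc, ← ENNReal.ofReal_mul (by positivity)]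
        congr 2
        ring

end EnergyEstimate

/-! ### Square integrability by duality with test functions. -/

section Duality
variable {d : ℕ}

/-- A smooth function with support in a bounded open set can be chosen close to its indicator. -/
lemma exists_exhaustion {U : Set (Eu d)} (hU : IsOpen U) (hb : Bornology.IsBounded U) :
    ∃ χ : ℕ → Eu d → ℝ, (∀ j, ContDiff ℝ ∞ (χ j)) ∧ (∀ j, HasCompactSupport (χ j)) ∧
      (∀ j, tsupport (χ j) ⊆ U) ∧ (∀ j x, 0 ≤ χ j x) ∧ (∀ j x, χ j x ≤ 1) ∧
      (∀ x ∈ U, ∀ᶠ j in atTop, χ j x = 1) ∧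
      ∀ j, ∃ i, ∀ x ∈ tsupport (χ j), χ i x = 1 := by
  obtain ⟨f, hfs, hf, hf01⟩ := hU.exists_contDiff_support_eq (n := ⊤)
  have hf0 : ∀ x, 0 ≤ f x := fun x => (hf01 (Set.mem_range_self x)).1
  -- `χ_j` vanishes where `(j + 1) f ≤ 1` and equals `1` where `(j + 1) f ≥ 2`; hence `χ_{2j+1} = 1`
  -- on the support of `χ_j`.
  obtain ⟨χ, hχ⟩ : ∃ χ : ℕ → Eu d → ℝ,
    χ = fun (j : ℕ) x => Real.smoothTransition (((j : ℝ) + 1) * f x - 1) := ⟨_, rfl⟩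
  have hsub : ∀ j, tsupport (χ j) ⊆ {x | 1 ≤ ((j : ℝ) + 1) * f x} := by
    intro j
    refine closure_minimal (fun x hx => ?_)
      (isClosed_le continuous_const (continuous_const.mul hf.continuous))
    by_contra hn
    refine hx ?_
    rw [hχ]
    refine Real.smoothTransition.zero_of_nonpos ?_
    rw [Set.mem_ofPred_eq, not_le] at hn
    linarith
  have hsubU : ∀ j, tsupport (χ j) ⊆ U := fun j x hx => by
    have h1 := hsub j hx
    rw [Set.mem_ofPred_eq] at h1
    rw [← hfs]
    intro h0
    rw [h0, mul_zero] at h1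
    linarith
  refine ⟨χ, fun j => ?_, fun j => ?_, hsubU, fun j x => ?_, fun j x => ?_, fun x hx => ?_,
    fun j => ⟨2 * j + 1, fun x hx => ?_⟩⟩
  · rw [hχ]
    exact Real.smoothTransition.contDiff.comp ((contDiff_const.mul hf).sub contDiff_const)
  · exact Metric.isCompact_of_isClosed_isBounded (isClosed_tsupport _) (hb.subset (hsubU j))
  · rw [hχ]
    exact Real.smoothTransition.nonneg _
  · rw [hχ]
    exact Real.smoothTransition.le_one _
  · rw [← hfs] at hx
    have hfx : 0 < f x := lt_of_le_of_ne (hf0 x) (Ne.symm hx)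
    obtain ⟨n, hn⟩ := exists_nat_gt (2 / f x)
    filter_upwards [eventually_ge_atTop n] with j hj
    rw [hχ]
    refine Real.smoothTransition.one_of_one_le ?_
    rw [div_lt_iff₀ hfx] at hn
    have : (n : ℝ) ≤ j := by exact_mod_cast hj
    nlinarith
  · have h1 := hsub j hx
    rw [Set.mem_ofPred_eq] at h1
    rw [hχ]
    refine Real.smoothTransition.one_of_one_le ?_
    push_cast
    linarith

/-- A continuous function which is bounded, as a functional on test functions, in the `L²` norm,
is square integrable. -/
lemma lintegral_sq_le_of_dual {U : Set (Eu d)} (hU : IsOpen U) (hb : Bornology.IsBounded U)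
    {g : Eu d → ℝ} (hg : ContinuousOn g U) {B : ℝ}
    (hdual : ∀ f : Eu d → ℝ, ContDiff ℝ ∞ f → HasCompactSupport f → tsupport f ⊆ U →
      ‖∫ x in U, g x * f x‖ₑ ^ 2 ≤ ENNReal.ofReal B * ∫⁻ x in U, ‖f x‖ₑ ^ 2) :
    ∫⁻ x in U, ‖g x‖ₑ ^ 2 ≤ ENNReal.ofReal B := by
  obtain ⟨χ, hχ, hχc, hχs, hχ0, hχ1, hχl, hχi⟩ := exists_exhaustion hU hb
  have hcont : ∀ j, Continuous fun x => χ j x * g x := fun j =>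
    continuous_iff_continuousAt.2 fun x => by
      by_cases hx : x ∈ tsupport (χ j)
      · exact (hχ j).continuous.continuousAt.mul (hg.continuousAt (hU.mem_nhds (hχs j hx)))
      · have h1 : (fun x => χ j x * g x) =ᶠ[𝓝 x] fun _ => 0 := by
          filter_upwards [(isClosed_tsupport (χ j)).isOpen_compl.mem_nhds hx] with z hz
          rw [image_eq_zero_of_notMem_tsupport hz, zero_mul]
        exact continuousAt_const.congr h1.symm
  have hcs : ∀ j, HasCompactSupport fun x => χ j x * g x := fun j => (hχc j).mul_right
  have hL : ∀ j, MemLp (fun x => χ j x * g x) 2 volume := fun j =>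
    (hcont j).memLp_of_hasCompactSupport (hcs j)
  have key : ∀ j, ∫⁻ x in U, ‖χ j x * g x‖ₑ ^ 2 ≤ ENNReal.ofReal B := by
    intro j
    obtain ⟨i, hi⟩ := hχi j
    -- The natural test function `χ_j g` is only continuous. It is approximated in `L²` by `χ_i²
    -- φ_m` with `φ_m` smooth, where `χ_i = 1` on the support of `χ_j`: the support stays in `U` and
    -- the limit is unchanged.
    obtain ⟨h, hh⟩ : ∃ h : Eu d → ℝ, h = fun x => χ j x * g x := ⟨_, rfl⟩
    have hhL : MemLp h 2 volume := by rw [hh]; exact hL j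
    have hex : ∀ m : ℕ, ∃ φ : Eu d → ℝ, ContDiff ℝ ∞ φ ∧
        eLpNorm (fun x => φ x - h x) 2 volume ≤ ((m : ℝ≥0∞) + 1)⁻¹ := by
      intro m
      obtain ⟨δ₀, hδ₀, hm⟩ := exists_eLpNorm_mollify_sub_le (0 : Eu d) one_le_two (by simp) hhL
        (ε := ((m : ℝ≥0∞) + 1)⁻¹) (by simp)
      exact ⟨_, mollify_contDiff _ _ (hhL.locallyIntegrable one_le_two),
        hm (δ₀ / 2) (by positivity) (by linarith)⟩
    choose φ hφ hφle using hex
    have hih : ∀ x, χ i x * h x = h x := fun x => by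
      by_cases hx : x ∈ tsupport (χ j)
      · rw [hi x hx, one_mul]
      · rw [hh]
        simp only [image_eq_zero_of_notMem_tsupport hx, zero_mul, mul_zero]
    set ν := volume.restrict U with hν
    have hfL : ∀ m, MemLp (fun x => χ i x * φ m x) 2 ν := fun m =>
      ((((hχ i).mul (hφ m)).continuous).memLp_of_hasCompactSupport
        ((hχc i).mul_right) (μ := volume)).restrict _
    have hhν : MemLp h 2 ν := hhL.restrict _
    have hlim : Tendsto (fun m => eLpNorm (fun x => χ i x * φ m x - h x) 2 ν) atTop (𝓝 0) := by
      have h0 : Tendsto (fun m : ℕ => ((m : ℝ≥0∞) + 1)⁻¹) atTop (𝓝 0) := by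
        have := ENNReal.tendsto_inv_nat_nhds_zero.comp (tendsto_add_atTop_nat 1)
        simpa [Function.comp_def] using this
      refine tendsto_of_tendsto_of_tendsto_of_le_of_le tendsto_const_nhds h0 (fun _ => bot_le)
        fun m => le_trans ?_ (hφle m)
      refine (eLpNorm_mono_measure _ Measure.restrict_le_self).trans (eLpNorm_mono fun x => ?_)
      have : χ i x * φ m x - h x = χ i x * (φ m x - h x) := by rw [mul_sub, hih]
      rw [this, norm_mul, Real.norm_of_nonneg (hχ0 i x)]
      exact mul_le_of_le_one_left (norm_nonneg _) (hχ1 i x)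
    have hgi : MemLp (fun x => χ i x * g x) 2 ν := (hL i).restrict _
    have t1 := tendsto_integral_inner hgi hhν hfL hlim
    have t1' : Tendsto (fun m => ‖∫ x, ⟪χ i x * g x, χ i x * φ m x⟫ ∂ν‖ₑ ^ 2) atTop
        (𝓝 (‖∫ x, ⟪χ i x * g x, h x⟫ ∂ν‖ₑ ^ 2)) := ENNReal.Tendsto.pow t1.enorm
    have t2 : Tendsto (fun m => ENNReal.ofReal B * (eLpNorm (fun x => χ i x * φ m x - h x) 2 ν
        + eLpNorm h 2 ν) ^ 2) atTop (𝓝 (ENNReal.ofReal B * (0 + eLpNorm h 2 ν) ^ 2)) :=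
      ENNReal.Tendsto.const_mul (ENNReal.Tendsto.pow (hlim.add tendsto_const_nhds))
        (Or.inr ENNReal.ofReal_ne_top)
    have hle := le_of_tendsto_of_tendsto' t1' t2 fun m => ?_
    · rw [zero_add, eLpNorm_two_sq] at hle
      set Y := ∫⁻ x, ‖h x‖ₑ ^ 2 ∂ν with hY
      have hYt : Y ≠ ⊤ := (lintegral_enorm_sq_lt_top hhν).ne
      have h1 : Y ≤ ‖∫ x, ⟪χ i x * g x, h x⟫ ∂ν‖ₑ := by
        -- The pairing equals `g h = χ_j g²`, which dominates `χ_j² g²` because `0 ≤ χ_j ≤ 1`.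
        have hint : ∀ x, h x ^ 2 ≤ ⟪χ i x * g x, h x⟫ := fun x => by
          have e1 : ⟪χ i x * g x, h x⟫ = g x * h x := by
            simp only [RCLike.inner_apply, conj_trivial]
            calc h x * (χ i x * g x) = (χ i x * h x) * g x := by ring
              _ = g x * h x := by rw [hih, mul_comm]
          rw [e1, hh]
          dsimp only
          have h2 := hχ0 j x
          have h3 := hχ1 j x
          nlinarith [mul_nonneg h2 (sub_nonneg.2 h3), mul_self_nonneg (g x),
            mul_nonneg (mul_nonneg h2 (sub_nonneg.2 h3)) (mul_self_nonneg (g x))]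
        have hii := MemLp.integrable_inner_two hgi hhν
        rw [← ofReal_norm, Real.norm_eq_abs]
        refine le_trans ?_ (ENNReal.ofReal_le_ofReal (le_abs_self _))
        rw [ofReal_integral_eq_lintegral_ofReal hii
          (ae_of_all _ fun x => (sq_nonneg _).trans (hint x))]
        refine lintegral_mono fun x => ?_
        rw [← ofReal_norm, ← ENNReal.ofReal_pow (norm_nonneg _), Real.norm_eq_abs, sq_abs]
        exact ENNReal.ofReal_le_ofReal (hint x)
      have h2 : Y ^ 2 ≤ ENNReal.ofReal B * Y := (pow_le_pow_left' h1 2).trans hle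
      have h3 : Y ≤ ENNReal.ofReal B := by
        by_cases hY0 : Y = 0
        · rw [hY0]
          exact bot_le
        · rw [← ENNReal.mul_le_mul_iff_right hY0 hYt, ← sq, mul_comm Y]
          exact h2
      rw [hY, hh] at h3
      exact h3
    · have h1 := hdual (fun x => χ i x * (χ i x * φ m x)) ((hχ i).mul ((hχ i).mul (hφ m)))
        (hχc i).mul_right (tsupport_mul_subset_left.trans (hχs i))
      have e1 : ∫ x, ⟪χ i x * g x, χ i x * φ m x⟫ ∂ν
          = ∫ x in U, g x * (χ i x * (χ i x * φ m x)) := by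
        refine integral_congr_ae (ae_of_all _ fun x => ?_)
        simp only [RCLike.inner_apply, conj_trivial]
        ring
      rw [e1]
      refine h1.trans ?_
      gcongr
      rw [← eLpNorm_two_sq]
      gcongr
      calc eLpNorm (fun x => χ i x * (χ i x * φ m x)) 2 ν
          ≤ eLpNorm (fun x => χ i x * φ m x) 2 ν := eLpNorm_mono fun x => by
            rw [norm_mul, Real.norm_of_nonneg (hχ0 i x)]
            exact mul_le_of_le_one_left (norm_nonneg _) (hχ1 i x)
        _ = eLpNorm ((fun x => χ i x * φ m x - h x) + h) 2 ν := by
            congr 1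
            ext1 x
            simp
        _ ≤ _ := eLpNorm_add_le ((hfL m).1.sub hhν.1) hhν.1 one_le_two
  have hgm : AEMeasurable (fun x => g x) (volume.restrict U) :=
    (hg.aestronglyMeasurable hU.measurableSet).aemeasurable
  have hlim : ∀ x ∈ U, Tendsto (fun j => ‖χ j x * g x‖ₑ ^ 2) atTop (𝓝 (‖g x‖ₑ ^ 2)) := by
    intro x hx
    refine tendsto_const_nhds.congr' ?_
    filter_upwards [hχl x hx] with j hj
    rw [hj, one_mul]
  calc ∫⁻ x in U, ‖g x‖ₑ ^ 2
      = ∫⁻ x in U, liminf (fun j => ‖χ j x * g x‖ₑ ^ 2) atTop :=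
        setLIntegral_congr_fun hU.measurableSet fun x hx => (hlim x hx).liminf_eq.symm
    _ ≤ liminf (fun j => ∫⁻ x in U, ‖χ j x * g x‖ₑ ^ 2) atTop := by
        refine lintegral_liminf_le' fun j => ?_
        exact ((hcont j).measurable.enorm.pow_const 2).aemeasurable
    _ ≤ _ := liminf_le_of_le (by isBoundedDefault) fun b hb => by
        obtain ⟨k, hk'⟩ := hb.exists
        exact hk'.trans (key k)

end Duality

/-! ### Pointwise bounds for the Neumann function. -/

section Pointwise
variable {d : ℕ} {e : Eu d} {Ω : Set (Eu d)} {V : Eu d → ℝ} {P : Eu d → ℝ≥0∞}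
  {A : Eu d → Matrix (Fin d) (Fin d) ℝ}

/-- De Giorgi's bound holds almost everywhere; continuity off the diagonal makes it a bound at the
given point. -/
lemma le_of_ae_le_of_continuousOn {U : Set (Eu d)} (hU : IsOpen U) {g : Eu d → ℝ} {κ : ℝ}
    (hg : ContinuousOn g U) (h : ∀ᵐ x ∂(volume.restrict U), g x ≤ κ) : ∀ x ∈ U, g x ≤ κ := by
  have h1 : (fun x => max (g x) κ) =ᵐ[volume.restrict U] fun _ => κ := by
    filter_upwards [h] with x hx using max_eq_right hx
  intro x hx
  have h2 := Measure.eqOn_open_of_ae_eq h1 hU (hg.sup continuousOn_const) continuousOn_const hx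
  exact max_eq_right_iff.1 h2

lemma finiteEnergyOn_test (hP : ∀ x r, ∫⁻ z in ball x r, P z ≠ ⊤)
    (hV : AEStronglyMeasurable V volume) (hVP : ∀ᵐ x, P x = ENNReal.ofReal (V x))
    (hV0 : ∀ᵐ x, 0 < V x) {φ : Eu d → ℝ} (hφ : ContDiff ℝ ∞ φ) (hc : HasCompactSupport φ) :
    FiniteEnergyOn V Ω φ (gradient φ) := by
  refine ⟨((continuous_gradient hφ one_le_infty).memLp_of_hasCompactSupport
    (hasCompactSupport_gradient hc) (μ := volume)).restrict _, ?_⟩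
  refine MemLp.restrict _ (memLp_two_of_lintegral
    ((Real.continuous_sqrt.comp_aestronglyMeasurable hV).mul hφ.continuous.aestronglyMeasurable) ?_)
  obtain ⟨C, hC⟩ := hc.exists_bound_of_continuous hφ.continuous
  obtain ⟨R, hR⟩ := hc.isBounded.subset_ball (0 : Eu d)
  have h1 := lintegral_potential_eq (S := Set.univ) (u := φ) hVP hV0
  rw [Measure.restrict_univ] at h1
  rw [← h1, ← setLIntegral_univ, setLIntegral_eq_inter_ball (c := 0) (R := R) fun x hx => by
    rw [image_eq_zero_of_notMem_tsupport fun h => hx (hR h)]; simp, Set.univ_inter]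
  calc ∫⁻ x in ball 0 R, P x * ‖φ x‖ₑ ^ 2
      ≤ ∫⁻ x in ball 0 R, P x * ENNReal.ofReal C ^ 2 := by
        refine lintegral_mono fun x => ?_
        gcongr
        rw [← ofReal_norm]
        exact ENNReal.ofReal_le_ofReal (hC x)
    _ = (∫⁻ x in ball 0 R, P x) * ENNReal.ofReal C ^ 2 :=
        lintegral_mul_const' _ _ (by finiteness)
    _ < ⊤ := ENNReal.mul_lt_top (lt_top_iff_ne_top.2 (hP 0 R)) (by finiteness)

lemma SubSol.mono {C₀ : ℝ≥0∞} {c : Eu d} {R R' : ℝ} {w : Eu d → ℝ} (h : SubSol C₀ P Ω c R w)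
    (hR : R' ≤ R) : SubSol C₀ P Ω c R' w :=
  ⟨h.nonneg, h.memLp.mono_measure (Measure.restrict_mono
    (Set.inter_subset_inter_right _ (ball_subset_ball hR)) le_rfl),
    fun k hk η h1 h2 h3 => h.cacc k hk η h1 h2 (h3.trans (ball_subset_ball hR))⟩

lemma lintegral_max_zero_le (S : Set (Eu d)) (u : Eu d → ℝ) :
    ∫⁻ x in S, ‖max (u x) 0‖ₑ ^ 2 ≤ ∫⁻ x in S, ‖u x‖ₑ ^ 2 := by
  refine lintegral_mono fun x => pow_le_pow_left' ?_ 2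
  rw [← ofReal_norm, ← ofReal_norm, Real.norm_of_nonneg (le_max_right _ _), Real.norm_eq_abs]
  exact ENNReal.ofReal_le_ofReal (max_le (le_abs_self _) (abs_nonneg _))

/-- Continuity in the first variable of potentials of test functions. -/
lemma continuousOn_kernel {N : Eu d → Eu d → ℝ}
    (hN : ContinuousOn (fun p : Eu d × Eu d => N p.1 p.2) {p | p.1 ∈ Ω ∧ p.2 ∈ Ω ∧ p.1 ≠ p.2})
    {f : Eu d → ℝ} (hf : Continuous f) (hc : HasCompactSupport f) {S T : Set (Eu d)}
    (hS : IsOpen S) (hT : IsOpen T) (hST : Disjoint S T) (hSΩ : S ⊆ Ω) (hTΩ : T ⊆ Ω)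
    (hfT : tsupport f ⊆ T) : ContinuousOn (fun z => ∫ ξ in Ω, N z ξ * f ξ) S := by
  have h0 : ∀ z, ∫ ξ in Ω, N z ξ * f ξ = ∫ ξ, N z ξ * f ξ := fun z =>
    setIntegral_eq_integral_of_forall_compl_eq_zero fun ξ hξ => by
      rw [image_eq_zero_of_notMem_tsupport fun h => hξ (hTΩ (hfT h)), mul_zero]
  simp only [h0]
  refine continuousOn_integral_of_compact_support (k := tsupport f) hc ?_ fun z ξ _ hξ => by
    rw [image_eq_zero_of_notMem_tsupport hξ, mul_zero]
  rintro ⟨z, ξ⟩ ⟨hz, -⟩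
  refine ContinuousAt.continuousWithinAt ?_
  by_cases hξ : ξ ∈ tsupport f
  · have hmem : S ×ˢ T ⊆ {p : Eu d × Eu d | p.1 ∈ Ω ∧ p.2 ∈ Ω ∧ p.1 ≠ p.2} := fun p hp =>
      ⟨hSΩ hp.1, hTΩ hp.2, hST.ne_of_mem hp.1 hp.2⟩
    have h1 : ContinuousAt (fun p : Eu d × Eu d => N p.1 p.2) (z, ξ) :=
      (hN.mono hmem).continuousAt ((hS.prod hT).mem_nhds ⟨hz, hfT hξ⟩)
    exact h1.mul (hf.continuousAt.comp continuousAt_snd)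
  · have h1 : (fun p : Eu d × Eu d => N p.1 p.2 * f p.2) =ᶠ[𝓝 (z, ξ)] fun _ => 0 := by
      have h2 : ∀ᶠ p : Eu d × Eu d in 𝓝 (z, ξ), p.2 ∈ (tsupport f)ᶜ :=
        continuousAt_snd.eventually ((isClosed_tsupport f).isOpen_compl.mem_nhds hξ)
      filter_upwards [h2] with p hp
      rw [image_eq_zero_of_notMem_tsupport hp, mul_zero]
    exact continuousAt_const.congr h1.symm

/-- The `L²` bound for the Neumann function away from the pole. -/
lemma exists_lintegral_neumann_le (hd : 3 ≤ d) (e : Eu d) {C D μ : ℝ} (hC : 1 ≤ C) (hD : 2 ≤ D)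
    (hμ : 0 < μ) : ∃ K : ℝ, 0 < K ∧ ∀ (Ω : Set (Eu d)), ConeRegion Ω e →
    ∀ (P : Eu d → ℝ≥0∞), IsPotential C P → IsDoubling D P →
    ∀ V : Eu d → ℝ, (∀ᵐ x, P x = ENNReal.ofReal (V x)) → (∀ᵐ x, 0 < V x) →
    (∀ x r, 0 < r → MemLp V ⊤ (volume.restrict (ball x r))) → AEStronglyMeasurable V volume →
    ∀ A : Eu d → Matrix (Fin d) (Fin d) ℝ, IsElliptic μ A →
    ∀ N : Eu d → Eu d → ℝ, IsNeumannFunction A V Ω N →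
    ∀ x ∈ Ω, ∀ (y : Eu d) (r : ℝ), 0 < r → ‖x - y‖ = 2 * r →
      ∫⁻ z in Ω ∩ ball y r, ‖N x z‖ₑ ^ 2 ≤ ENNReal.ofReal (K * r ^ 4 / r ^ d) := by
  obtain ⟨K₂, hK₂, hsup⟩ := exists_sup_bound e (caccConst_pos hμ)
  obtain ⟨K₃, hK₃, hen⟩ := exists_energy_bound hd e hC hD hμ
  refine ⟨K₂ * K₃, by positivity, ?_⟩
  intro Ω hΩ P hP hPD V hVP hV0 hVb hVm A hA N hN x hx y r hr hxy
  have hdisj : Disjoint (ball x r) (ball y r) := by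
    refine ball_disjoint_ball ?_
    rw [dist_eq_norm, hxy]
    linarith
  have hU : IsOpen (Ω ∩ ball y r) := hΩ.isOpen.inter isOpen_ball
  have hxS : x ∈ Ω ∩ ball x (r / 2) := ⟨hx, mem_ball_self (by positivity)⟩
  refine lintegral_sq_le_of_dual hU (isBounded_ball.subset Set.inter_subset_right) ?_ ?_
  · exact hN.continuousOn.comp (continuousOn_const.prodMk continuousOn_id) fun z hz =>
      ⟨hx, hz.1, hdisj.ne_of_mem (mem_ball_self hr) hz.2⟩
  intro f hf hc hfs
  obtain ⟨G, hG, hE, htest⟩ := hN.kernel f hf hc (hfs.trans Set.inter_subset_left)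
  obtain ⟨u, hu⟩ : ∃ u : Eu d → ℝ, u = fun x => ∫ y in Ω, N x y * f y := ⟨_, rfl⟩
  rw [← hu] at hG hE htest
  have hf0 : ∀ z ∉ ball y r, f z = 0 := fun z hz =>
    image_eq_zero_of_notMem_tsupport fun h => hz (hfs h).2
  have hfL : MemLp f 2 (volume.restrict Ω) :=
    (hf.continuous.memLp_of_hasCompactSupport hc (μ := volume)).restrict _
  have hux : ∫ z in Ω ∩ ball y r, N x z * f z = u x := by
    rw [hu]
    refine (setIntegral_eq_of_subset_of_forall_sdiff_eq_zero hΩ.isOpen.measurableSet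
      Set.inter_subset_left fun z hz => ?_).symm
    rw [hf0 z fun h => hz.2 ⟨hz.1, h⟩, mul_zero]
  have hFeq : ∫⁻ z in Ω ∩ ball y r, ‖f z‖ₑ ^ 2 = ∫⁻ z in Ω, ‖f z‖ₑ ^ 2 :=
    (setLIntegral_eq_inter_ball fun z hz => by rw [hf0 z hz]; simp).symm
  rw [hux, hFeq]
  have hub := hen Ω hΩ P hP hPD V hVP hV0 A hA u G hG hE f hfL (htest u G hG hE) y r hr hf0 x
  have hFt : ∫⁻ z in Ω, ‖f z‖ₑ ^ 2 ≠ ⊤ := (lintegral_enorm_sq_lt_top hfL).ne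
  -- The support of `f` lies in `B(y, r)`, disjoint from `B(x, r)`, so the right-hand side vanishes
  -- against test functions supported near `x`.
  have hloc : LocalSol A V Ω x r u G := by
    refine ⟨hG, ?_, hE.1.mono_measure (Measure.restrict_mono Set.inter_subset_left le_rfl), ?_⟩
    · refine memLp_two_of_lintegral (hG.locInt.aestronglyMeasurable.mono_measure
        (Measure.restrict_mono Set.inter_subset_left le_rfl)) (hub.trans_lt ?_)
      exact ENNReal.mul_lt_top ENNReal.ofReal_lt_top (lt_top_iff_ne_top.2 hFt)
    · intro φ hφ hφc hφs
      rw [htest φ (gradient φ) (hasWeakGrad_of_contDiff (hφ.of_le one_le_infty))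
        (finiteEnergyOn_test hP.finite hVm hVP hV0 hφ hφc)]
      rw [← integral_zero (Eu d) ℝ (μ := volume.restrict Ω)]
      congr 1
      ext1 z
      by_cases hz : z ∈ ball y r
      · rw [image_eq_zero_of_notMem_tsupport fun h => hdisj.notMem_of_mem_left (hφs h) hz, mul_zero]
      · rw [hf0 z hz, zero_mul]
  have hcont : ContinuousOn u (Ω ∩ ball x (r / 2)) := by
    rw [hu]
    exact continuousOn_kernel hN.continuousOn hf.continuous hc
      (hΩ.isOpen.inter isOpen_ball) hU
      (hdisj.mono (Set.inter_subset_right.trans (ball_subset_ball (by linarith)))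
        Set.inter_subset_right) Set.inter_subset_left Set.inter_subset_left hfs
  have hV0' : ∀ᵐ x, 0 ≤ V x := hV0.mono fun x hx => hx.le
  obtain ⟨F, hF⟩ : ∃ F, F = (∫⁻ z in Ω, ‖f z‖ₑ ^ 2).toReal := ⟨_, rfl⟩
  have hF0 : 0 ≤ F := by rw [hF]; positivity
  have hFe : ∫⁻ z in Ω, ‖f z‖ₑ ^ 2 = ENNReal.ofReal F := by rw [hF, ENNReal.ofReal_toReal hFt]
  rw [hFe] at hub ⊢
  -- The estimate for subsolutions is one-sided; it is applied to `u` and to `-u`.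
  have hone : ∀ κ : ℝ, 0 < κ → K₂ * K₃ * r ^ 4 / r ^ d * F ≤ κ ^ 2 →
      ∀ (g : Eu d → ℝ) (H : Eu d → Eu d),
      LocalSol A V Ω x r g H → ContinuousOn g (Ω ∩ ball x (r / 2)) →
      ∫⁻ z in Ω ∩ ball x r, ‖g z‖ₑ ^ 2 ≤ ENNReal.ofReal (K₃ * r ^ 4) * ENNReal.ofReal F →
      g x ≤ κ := by
    intro κ hκ hκF g H hg hgc hgb
    have h1 := hsup Ω hΩ P x r _ hr (hg.subSol hμ hA hΩ (hVb x r hr) hV0' hVP) κ hκ ?_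
    · refine (le_max_left _ _).trans (le_of_ae_le_of_continuousOn (hΩ.isOpen.inter isOpen_ball)
        (hgc.sup continuousOn_const) h1 x hxS)
    · refine (mul_le_mul_right ((lintegral_max_zero_le _ _).trans hgb) _).trans ?_
      rw [← ENNReal.ofReal_mul (by positivity), ← ENNReal.ofReal_mul hK₂.le]
      refine ENNReal.ofReal_le_ofReal ?_
      calc K₂ * (K₃ * r ^ 4 * F) = K₂ * K₃ * r ^ 4 / r ^ d * F * r ^ d := by field_simp
        _ ≤ _ := by gcongr
  rw [← ofReal_norm, ← ENNReal.ofReal_pow (norm_nonneg _), ← ENNReal.ofReal_mul (by positivity)]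
  -- The margin `ε` keeps `κ` positive even when `f` vanishes.
  refine ENNReal.ofReal_le_ofReal (le_of_forall_pos_le_add fun ε hε => ?_)
  have hpos : 0 < K₂ * K₃ * r ^ 4 / r ^ d * F + ε := by positivity
  have hsq : √(K₂ * K₃ * r ^ 4 / r ^ d * F + ε) ^ 2 = K₂ * K₃ * r ^ 4 / r ^ d * F + ε :=
    Real.sq_sqrt hpos.le
  have hκ := Real.sqrt_pos.2 hpos
  rw [← hsq]
  gcongr
  rw [Real.norm_eq_abs]
  refine abs_le'.2 ⟨hone _ hκ (by rw [hsq]; linarith) u G hloc hcont hub,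
    hone _ hκ (by rw [hsq]; linarith) _ _ hloc.neg hcont.neg ?_⟩
  simpa only [enorm_neg] using hub

/-- Pointwise decay of the Neumann function in terms of the maximal function. -/
lemma exists_neumann_bound (hd : 3 ≤ d) (e : Eu d) (C_V : ℝ) {μ : ℝ} (hμ : 0 < μ) (k : ℕ) :
    ∃ K : ℝ, 0 < K ∧ ∀ (Ω : Set (Eu d)), ConeRegion Ω e →
    ∀ A : Eu d → Matrix (Fin d) (Fin d) ℝ, IsElliptic μ A → ∀ V : Eu d → ℝ, IsBInfty C_V V →
    ∀ N : Eu d → Eu d → ℝ, IsNeumannFunction A V Ω N → ∀ x ∈ Ω, ∀ y ∈ Ω, x ≠ y →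
      |N x y| ≤ K / (1 + ‖x - y‖ * fpsMax V y) ^ k * (1 / ‖x - y‖ ^ (d - 2)) := by
  have hC : 1 ≤ max C_V 1 := le_max_right _ _
  obtain ⟨D, hD, hdbl⟩ := exists_doubling d hC
  obtain ⟨K₁, hK₁, hsup⟩ := exists_sup_bound e (caccConst_pos hμ)
  obtain ⟨K₂, hK₂, hL2⟩ := exists_lintegral_neumann_le hd e hC hD hμ
  obtain ⟨J, K₃, hK₃, hdec⟩ := exists_decay (by omega : 2 ≤ d) e hC hD (caccConst_pos hμ) k
  obtain ⟨θ, hθ⟩ : ∃ θ, θ = ((1 : ℝ) / 2) ^ J := ⟨_, rfl⟩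
  have hθ0 : 0 < θ := by rw [hθ]; positivity
  have hθ1 : θ ≤ 1 := by rw [hθ]; exact pow_le_one₀ (by norm_num) (by norm_num)
  -- `q₁` combines De Giorgi's constant with the `L²` bound; `q₂` also contains the decay constant
  -- and the loss `θ^{-d}` from working in the ball of radius `r θ`. Square roots appear because the
  -- integrals bound `κ²`.
  obtain ⟨q₁, hq₁⟩ : ∃ q, q = √(K₁ * K₂) := ⟨_, rfl⟩
  obtain ⟨q₂, hq₂⟩ : ∃ q, q = √(K₁ * K₂ * K₃ / θ ^ d) := ⟨_, rfl⟩
  have hq₁0 : 0 < q₁ := by rw [hq₁]; exact Real.sqrt_pos.2 (by positivity)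
  have hq₂0 : 0 < q₂ := by rw [hq₂]; exact Real.sqrt_pos.2 (by positivity)
  have hq₁s : q₁ ^ 2 = K₁ * K₂ := by rw [hq₁]; exact Real.sq_sqrt (by positivity)
  have hq₂s : q₂ ^ 2 = K₁ * K₂ * K₃ / θ ^ d := by rw [hq₂]; exact Real.sq_sqrt (by positivity)
  refine ⟨3 ^ k * 2 ^ (d - 2) * (q₁ + q₂), by positivity, ?_⟩
  intro Ω hΩ A hA V hV N hN x hx y hy hxy
  obtain ⟨P, hVP, hP⟩ := hV.exists_potential
  have hPD := hdbl P hP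
  obtain ⟨r, hr⟩ : ∃ r, r = ‖x - y‖ / 2 := ⟨_, rfl⟩
  have hr0 : 0 < r := by
    rw [hr]
    exact half_pos (norm_pos_iff.2 (sub_ne_zero.2 hxy))
  have hxyr : ‖x - y‖ = 2 * r := by linarith
  obtain ⟨l, hl⟩ : ∃ l, l = r * fpsMax V y := ⟨_, rfl⟩
  have hm0 : 0 ≤ fpsMax V y := by
    refine Real.sInf_nonneg ?_
    rintro s ⟨ρ, hρ, _, rfl⟩
    positivity
  have hl0 : 0 ≤ l := by rw [hl]; positivity
  have hdisj : Disjoint (ball x r) (ball y r) := by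
    refine ball_disjoint_ball ?_
    rw [dist_eq_norm, hxyr]
    linarith
  have hV0' : ∀ᵐ x, 0 ≤ V x := hV.pos.mono fun x hx => hx.le
  have hB := hL2 Ω hΩ P hP hPD V hVP hV.pos hV.locBounded hV.aestronglyMeasurable A hA N hN x hx y r
    hr0 hxyr
  have hcont : ContinuousOn (N x) (Ω ∩ ball y r) :=
    hN.continuousOn.comp (continuousOn_const.prodMk continuousOn_id) fun z hz =>
      ⟨hx, hz.1, hdisj.ne_of_mem (mem_ball_self hr0) hz.2⟩
  have hU : IsOpen (Ω ∩ ball y r) := hΩ.isOpen.inter isOpen_ball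
  obtain ⟨G, hG, -, hE, htest⟩ := hN.pole x hx
  have hloc : LocalSol A V Ω y r (N x) G := by
    refine ⟨hG, ?_, ?_, fun φ hφ hφc hφs => ?_⟩
    · exact memLp_two_of_lintegral (hcont.aestronglyMeasurable hU.measurableSet)
        (hB.trans_lt ENNReal.ofReal_lt_top)
    · have hsub : Ω ∩ ball y r ⊆ Ω \ ball x r := fun z hz =>
        ⟨hz.1, fun h => hdisj.notMem_of_mem_left h hz.2⟩
      exact (hE r hr0).1.mono_measure (Measure.restrict_mono hsub le_rfl)
    · rw [htest φ hφ hφc]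
      exact image_eq_zero_of_notMem_tsupport fun h =>
        hdisj.notMem_of_mem_left (mem_ball_self hr0) (hφs h)
  obtain ⟨n, hn⟩ := Nat.exists_eq_add_of_le (by omega : 2 ≤ d)
  have hn' : d - 2 = n := by omega
  have hone : ∀ (g : Eu d → ℝ) (H : Eu d → Eu d), LocalSol A V Ω y r g H →
      ContinuousOn g (Ω ∩ ball y r) →
      ∫⁻ z in Ω ∩ ball y r, ‖g z‖ₑ ^ 2 ≤ ENNReal.ofReal (K₂ * r ^ 4 / r ^ d) →
      g y ≤ 3 ^ k * (q₁ + q₂) / (1 + 2 * l) ^ k * (r ^ n)⁻¹ := by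
    intro g H hg hgc hgb
    have hsub := hg.subSol hμ hA hΩ (hV.locBounded y r hr0) hV0' hVP
    have hgb' := (lintegral_max_zero_le _ _).trans hgb
    have hpt : ∀ (ρ κ : ℝ), 0 < ρ → ρ ≤ r →
        (∀ᵐ z ∂(volume.restrict (Ω ∩ ball y (ρ / 2))), max (g z) 0 ≤ κ) → g y ≤ κ := by
      intro ρ κ hρ hρr hae
      exact (le_max_left _ _).trans (le_of_ae_le_of_continuousOn (hΩ.isOpen.inter isOpen_ball)
        ((hgc.mono (Set.inter_subset_inter_right _ (ball_subset_ball (by linarith)))).sup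
          continuousOn_const) hae y ⟨hy, mem_ball_self (by positivity)⟩)
    -- Here `|x - y| m(y, V) = 2 l`. If `l < 1`, the factor `(1 + 2 l)^k` is at most `3^k` and no
    -- decay is needed; otherwise `1 + 2 l ≤ 3 l` and the decay estimate supplies `l^{-k}`.
    rcases lt_or_ge l 1 with h1 | h1
    · have h2 := hpt r (q₁ * (r ^ n)⁻¹) hr0 le_rfl
        (hsup Ω hΩ P y r _ hr0 hsub (q₁ * (r ^ n)⁻¹) (by positivity) ?_)
      · refine h2.trans ?_
        gcongr
        rw [le_div_iff₀ (by positivity)]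
        calc q₁ * (1 + 2 * l) ^ k ≤ (q₁ + q₂) * 3 ^ k := by
              gcongr
              · linarith
              · linarith
          _ = _ := mul_comm _ _
      · refine (mul_le_mul_right hgb' _).trans ?_
        rw [← ENNReal.ofReal_mul hK₁.le]
        refine ENNReal.ofReal_le_ofReal (le_of_eq ?_)
        rw [mul_pow, hq₁s, hn]
        field_simp
        ring
    · have h3 := hdec Ω hΩ P hP hPD V hVP hV.pos y r _ hr0 (by rwa [← hl]) hsub
      rw [← hl, ← hθ] at h3
      have hl1 : 0 < l := by linarith
      have h2 := hpt (r * θ) (q₂ * (r ^ n)⁻¹ * (l ^ k)⁻¹) (by positivity)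
        (mul_le_of_le_one_right hr0.le hθ1)
        (hsup Ω hΩ P y (r * θ) _ (by positivity) (hsub.mono (mul_le_of_le_one_right hr0.le hθ1))
          (q₂ * (r ^ n)⁻¹ * (l ^ k)⁻¹) (by positivity) ?_)
      · refine h2.trans ?_
        rw [mul_right_comm]
        gcongr
        rw [le_div_iff₀ (by positivity)]
        have h4 : (1 + 2 * l) ^ k ≤ 3 ^ k * l ^ k := by
          rw [← mul_pow]
          gcongr
          linarith
        calc q₂ * (l ^ k)⁻¹ * (1 + 2 * l) ^ k ≤ q₂ * (l ^ k)⁻¹ * (3 ^ k * l ^ k) := by gcongr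
          _ = 3 ^ k * q₂ := by field_simp
          _ ≤ _ := by
            gcongr
            linarith
      · refine (mul_le_mul_right (h3.trans (mul_le_mul_right hgb' _)) _).trans ?_
        rw [← ENNReal.ofReal_mul (by positivity), ← ENNReal.ofReal_mul hK₁.le]
        refine ENNReal.ofReal_le_ofReal (le_of_eq ?_)
        rw [mul_pow, mul_pow, hq₂s, mul_pow r θ, hn, inv_pow, inv_pow, ← pow_mul l, mul_comm 2 k]
        field_simp
        ring
  have hfin : 3 ^ k * 2 ^ (d - 2) * (q₁ + q₂) / (1 + ‖x - y‖ * fpsMax V y) ^ k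
      * (1 / ‖x - y‖ ^ (d - 2)) = 3 ^ k * (q₁ + q₂) / (1 + 2 * l) ^ k * (r ^ n)⁻¹ := by
    rw [hxyr, hl, hn', mul_pow 2 r, mul_assoc 2 r]
    field_simp
  rw [hfin]
  refine abs_le'.2 ⟨hone _ _ hloc hcont hB, hone _ _ hloc.neg hcont.neg ?_⟩
  simpa only [enorm_neg] using hB

end Pointwise

/-! ### The region above a Lipschitz graph is a cone region. -/

section Graph
variable {n : ℕ}

lemma norm_horiz_le (z : Eu (n + 1)) : ‖horiz z‖ ≤ ‖z‖ := by
  rw [EuclideanSpace.norm_eq, EuclideanSpace.norm_eq]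
  refine Real.sqrt_le_sqrt ?_
  rw [Fin.sum_univ_castSucc]
  exact le_add_of_nonneg_right (sq_nonneg _)

lemma abs_vert_le (z : Eu (n + 1)) : |vert z| ≤ ‖z‖ := PiLp.norm_apply_le z (Fin.last n)

lemma horiz_add (z w : Eu (n + 1)) : horiz (z + w) = horiz z + horiz w := rfl

lemma horiz_smul (s : ℝ) (w : Eu (n + 1)) : horiz (s • w) = s • horiz w := rfl

/-- A vector within distance `1` of `(0, M + 1)` has horizontal part shorter than `1` and vertical
part larger than `M`, so it climbs faster than the graph can. -/
lemma graphRegion_coneRegion {M : ℝ≥0} {Ψ : Eu n → ℝ} (hΨ : LipschitzWith M Ψ) :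
    ConeRegion (graphRegion Ψ) (EuclideanSpace.single (Fin.last n) ((M : ℝ) + 1)) where
  isOpen := by
    have h1 : Continuous (horiz : Eu (n + 1) → Eu n) := by
      unfold horiz
      fun_prop
    have h2 : Continuous (vert : Eu (n + 1) → ℝ) := by
      unfold vert
      fun_prop
    exact isOpen_lt (hΨ.continuous.comp h1) h2
  shift x hx w hw s hs := by
    obtain ⟨e, he⟩ : ∃ e : Eu (n + 1), e = EuclideanSpace.single (Fin.last n) ((M : ℝ) + 1) :=
      ⟨_, rfl⟩
    rw [← he, mem_ball_iff_norm] at hw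
    have heh : horiz e = 0 := by
      ext i
      simp [he, horiz]
    have hev : vert e = M + 1 := by simp [he, vert]
    have h1 : ‖horiz w‖ < 1 := by
      have e1 : horiz w = horiz (w - e) := by
        have : horiz (w - e) = horiz w - horiz e := rfl
        rw [this, heh, sub_zero]
      rw [e1]
      exact (norm_horiz_le _).trans_lt hw
    have h2 : M < vert w := by
      have e1 : vert (w - e) = vert w - vert e := rfl
      have h3 := (abs_vert_le (w - e)).trans_lt hw
      rw [e1, hev, abs_lt] at h3
      linarith
    have h3 := hΨ.dist_le_mul (horiz (x + s • w)) (horiz x)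
    rw [horiz_add, dist_self_add_left, horiz_smul, norm_smul, Real.norm_of_nonneg hs,
      Real.dist_eq] at h3
    have h4 := (le_abs_self _).trans h3
    have hx' : Ψ (horiz x) < vert x := hx
    have h5 : vert (x + s • w) = vert x + s * vert w := rfl
    change Ψ (horiz (x + s • w)) < vert (x + s • w)
    rw [h5, horiz_add, horiz_smul]
    have h6 : (M : ℝ) * (s * ‖horiz w‖) ≤ s * vert w := by
      calc (M : ℝ) * (s * ‖horiz w‖) = s * (M * ‖horiz w‖) := by ring
        _ ≤ s * vert w := by
          refine mul_le_mul_of_nonneg_left ?_ hs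
          exact (mul_le_of_le_one_right M.coe_nonneg h1.le).trans h2.le
    linarith

lemma IsCoefficient.isElliptic {μ : ℝ} {Ω : Set (Eu (n + 1))}
    {A : Eu (n + 1) → Matrix (Fin (n + 1)) (Fin (n + 1)) ℝ} (h : IsCoefficient μ Ω A) :
    IsElliptic μ A := ⟨h.measurable, h.elliptic, h.bounded⟩

end Graph

end SchrodingerNeumann

theorem proposition6p3 (n : ℕ) (hn : 2 ≤ n) (μ : ℝ) (hμ : 0 < μ) (M : ℝ≥0) (C_V : ℝ)
    (k : ℕ) (hk : 1 ≤ k) :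
    ∃ C_k : ℝ, 0 < C_k ∧
      ∀ (Ψ : SchrodingerNeumann.Eu n → ℝ), LipschitzWith M Ψ →
      ∀ (A : SchrodingerNeumann.Eu (n + 1) → Matrix (Fin (n + 1)) (Fin (n + 1)) ℝ),
        SchrodingerNeumann.IsCoefficient μ (SchrodingerNeumann.graphRegion Ψ) A →
      ∀ (V : SchrodingerNeumann.Eu (n + 1) → ℝ), SchrodingerNeumann.IsBInfty C_V V →
      ∀ (N : SchrodingerNeumann.Eu (n + 1) → SchrodingerNeumann.Eu (n + 1) → ℝ),
        SchrodingerNeumann.IsNeumannFunction A V (SchrodingerNeumann.graphRegion Ψ) N →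
      ∀ x ∈ SchrodingerNeumann.graphRegion Ψ, ∀ y ∈ SchrodingerNeumann.graphRegion Ψ, x ≠ y →
        |N x y| ≤ C_k / (1 + ‖x - y‖ * SchrodingerNeumann.fpsMax V y) ^ k
          * (1 / ‖x - y‖ ^ (n + 1 - 2)) := by
  -- The axis of the cone depends on `M` alone, so the constant is fixed before `Ψ`, `A`, `V` and
  -- `N`.
  obtain ⟨K, hK, h⟩ := SchrodingerNeumann.exists_neumann_bound (d := n + 1) (by omega)
    (EuclideanSpace.single (Fin.last n) ((M : ℝ) + 1)) C_V hμ k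
  exact ⟨K, hK, fun Ψ hΨ A hA V hV N hN x hx y hy hxy =>
    h _ (SchrodingerNeumann.graphRegion_coneRegion hΨ) A hA.isElliptic V hV N hN x hx y hy hxy⟩
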